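/- **Setting.** Algorithms are (oracle) Turing-type machines; a randomized algorithm may toss fair coins, and its running time is its worst-case running time. A parameterized problem is a set $L\subseteq\{0,1\}^*\times\mathbb N$. $\mathsf{FPT}$ is the class of parameterized problems decided by a deterministic algorithm in time $f(k)\cdot\mathrm{poly}(|x|,k)$ for a computable non-decreasing $f$; $\mathsf{FPT}_{\mathrm{rand}}$ is the class of problems for which a randomized algorithm with running time of this form accepts every yes-instance with probability at least $1/2$ and never accepts a no-instance. A parameterized reduction from $L$ to $L'$ is a deterministic algorithm with running time $f(k)\cdot\mathrm{poly}(|x|,k)$, $f$ computable, that maps $(x,k)$ to $(x',k')$ with $(x,k)\in L\iff(x',k')\in L'$ and $k'\le g(k)$ for a computable $g$. $\mathsf{W}[2]$ is the class of problems with a parameterized reduction to $k$-Hitting Set (given a family of subsets of $\{1,\dots,n\}$ and $k$, is there a set of size at most $k$ that meets every member of the family?), and a problem is $\mathsf W[2]$-hard if $k$-Hitting Set has a parameterized reduction to it. *Learning Feedback Vertex Set.* Read $x\in\{0,1\}^{N^2}$ as the adjacency matrix of a simple graph $G_x$ on $N$ vertices. A string $r\in\{0,1\}^N$ represents the vertex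 set $S_r$ of which it is the characteristic vector, and thereby the concept $c_r:\{0,1\}^{N^2}\to\{0,1\}$ with $c_r(x)=1$ iff $G_x-S_r$ is a forest. The parameter of $r$ is $\kappa(r)=|S_r|$, and every distribution has the parameter $\ell=1$. *FPT-sample-PAC.* A parameterized learning problem lies in FPT-sample-PAC if there is a randomized algorithm that, given $n$, rationals $\varepsilon,\delta\in(0,1]$ (through $\lceil1/\varepsilon\rceil$, $\lceil 1/\delta\rceil$), the parameter $k=\kappa(r^*)$ of a hidden representation $r^*$ of size $s$ of some concept $c^*:\{0,1\}^n\to\{0,1\}$ and the parameter $\ell$ of a hidden distribution $\mathcal D$ on $\{0,1\}^n$, and given access to an oracle for labeled samples $(x,c^*(x))$ with $x\sim\mathcal D$, always outputs a representation of parameter at most $k$, and with probability at least $1-\delta$ outputs a representation of an $n$-ary concept $c$ with $\Pr_{x\sim\mathcal D}[c(x)\ne c^*(x)]\le\varepsilon$; its running time and its number of oracle queries are both at most $f(k,\ell)\cdot\mathrm{poly}(n,s,1/\varepsilon,1/\delta)$ for a computable non-decreasing $f$. **Theorem.** 1. The consistency checking problem for Learning Feedback Vertex Set (given graphs on a common vertex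 set, pairwise distinct as adjacency matrices, with labels in $\{0,1\}$, and the parameter $k$, is there a vertex set of size at most $k$ that is a feedback vertex set of exactly those graphs that are labeled $1$?) is $\mathsf W[2]$-hard, even when all samples are positive: there is a parameterized reduction from $k$-Hitting Set all of whose outputs have only the label $1$. 2. Unless every problem in $\mathsf W[2]$ is decided by a randomized fixed-parameter algorithm with one-sided error, that is, unless $\mathsf W[2]\subseteq\mathsf{FPT}_{\mathrm{rand}}$, Learning Feedback Vertex Set is not in FPT-sample-PAC. 3. Consequently, if randomized fixed-parameter algorithms with one-sided error can be derandomized ($\mathsf{FPT}_{\mathrm{rand}}\subseteq\mathsf{FPT}$), then, unless $\mathsf{FPT}=\mathsf W[2]$, Learning Feedback Vertex Set is not in FPT-sample-PAC. -/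

import Mathlib

/-! ## Model of computation

Algorithms are structured programs over finitely many stacks of bits (the stacks named in the
program), that is, multi-tape Turing machines whose tapes are used as stacks.  Every elementary
operation costs one step.  Besides the usual operations a program may toss a fair coin and may ask
an oracle for a fresh labelled sample. -/

namespace ParamPAC

/-- Programs.
* `push x b` puts the bit `b` on stack `x`, `pop x` removes the top of stack `x`;
* `toss x` puts a fair random bit on stack `x`;
* `query x y` draws a fresh labelled sample from the oracle, puts the bits of the sample point on
  stack `x` and then its label on stack `y`;
* `seq p q` runs `p`, then `q`;
* `branch x p q r` runs `p`, `q` or `r` when stack `x` is empty, has top bit `false`, or has top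
  bit `true`, respectively;
* `loop x p` repeats `p` while stack `x` is not empty. -/
inductive Prog : Type
  | push (x : ℕ) (b : Bool)
  | pop (x : ℕ)
  | toss (x : ℕ)
  | query (x y : ℕ)
  | seq (p q : Prog)
  | branch (x : ℕ) (p q r : Prog)
  | loop (x : ℕ) (p : Prog)

/-- A program is deterministic if it neither tosses coins nor queries the oracle. -/
def Prog.IsDeterministic : Prog → Prop
  | .push _ _ => True
  | .pop _ => True
  | .toss _ => False
  | .query _ _ => False
  | .seq p q => p.IsDeterministic ∧ q.IsDeterministic
  | .branch _ p q r => p.IsDeterministic ∧ q.IsDeterministic ∧ r.IsDeterministic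
  | .loop _ p => p.IsDeterministic

/-- Contents of the stacks (the head of the list is the top of the stack), number of steps made so
far, and number of oracle queries made so far. -/
structure State : Type where
  stack : ℕ → List Bool
  time : ℕ
  queries : ℕ

/-- The state after one step that changes nothing else. -/
def State.tick (s : State) : State := { s with time := s.time + 1 }

/-- Replace the contents of stack `x` by `l`. -/
def State.set (s : State) (x : ℕ) (l : List Bool) : State :=
  { s with stack := Function.update s.stack x l }

/-- A sampling oracle: each query returns an independent draw of a point with its label. -/
abbrev Oracle : Type := PMF (List Bool × Bool)

/-- The trivial oracle, for computations without access to samples. -/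
noncomputable def noOracle : Oracle := PMF.pure ([], false)

/-- A while loop, cut off (with result `none`) after `fuel` tests of the loop condition. -/
noncomputable def runLoop (x : ℕ) (body : State → PMF (Option State)) :
    ℕ → State → PMF (Option State)
  | 0, _ => PMF.pure none
  | fuel + 1, s =>
      match s.stack x with
      | [] => PMF.pure (some s.tick)
      | _ :: _ => (body s.tick).bind fun o =>
          match o with
          | none => PMF.pure none
          | some s' => runLoop x body fuel s'

/-- The distribution of the final state of a program, where the result is `none` if some loop is
tested more than `fuel` times.  As each test costs one step, a computation of at most `fuel` steps
is never cut off. -/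
noncomputable def Prog.eval (O : Oracle) (fuel : ℕ) : Prog → State → PMF (Option State)
  | .push x b, s => PMF.pure (some (s.tick.set x (b :: s.stack x)))
  | .pop x, s => PMF.pure (some (s.tick.set x (s.stack x).tail))
  | .toss x, s =>
      (PMF.uniformOfFintype Bool).map fun b => some (s.tick.set x (b :: s.stack x))
  | .query x y, s =>
      O.map fun a =>
        let s' := s.tick.set x (a.1 ++ s.stack x)
        some { s'.set y (a.2 :: s'.stack y) with queries := s.queries + 1 }
  | .seq p q, s => (Prog.eval O fuel p s).bind fun o =>
      match o with
      | none => PMF.pure none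
      | some s' => Prog.eval O fuel q s'
  | .branch x p q r, s =>
      match s.stack x with
      | [] => Prog.eval O fuel p s.tick
      | false :: _ => Prog.eval O fuel q s.tick
      | true :: _ => Prog.eval O fuel r s.tick
  | .loop x p, s => runLoop x (Prog.eval O fuel p) fuel s

/-- The initial state whose first stacks hold the given inputs, all other stacks being empty. -/
def initial (inputs : List (List Bool)) : State :=
  ⟨fun i => inputs.getD i [], 0, 0⟩

/-- Unary notation for natural numbers. -/
def unary (k : ℕ) : List Bool := List.replicate k true

/-- The distribution of the outcome of running `p` for at most `T` steps. -/
noncomputable def Prog.run (p : Prog) (O : Oracle) (inputs : List (List Bool)) (T : ℕ) :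
    PMF (Option State) :=
  p.eval O T (initial inputs)

/-- Whatever the coins and the oracle answers, `p` halts after at most `T` steps, in a state that
satisfies `Q`. -/
def Prog.HaltsWithin (p : Prog) (O : Oracle) (inputs : List (List Bool)) (T : ℕ)
    (Q : State → Prop) : Prop :=
  ∀ o ∈ (p.run O inputs T).support, ∃ s, o = some s ∧ s.time ≤ T ∧ Q s

/-- The probability that `p` ends, within `T` steps, in a state that satisfies `Q`. -/
noncomputable def Prog.prob (p : Prog) (O : Oracle) (inputs : List (List Bool)) (T : ℕ)
    (Q : State → Prop) : ENNReal :=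
  (p.run O inputs T).toOuterMeasure {o | ∃ s, o = some s ∧ s.time ≤ T ∧ Q s}

/-! ## Parameterized complexity -/

/-- A parameterized problem is a set of pairs of a bit string and a parameter. -/
abbrev ParamProblem : Type := Set (List Bool × ℕ)

/-- The inputs of a program for an instance `(x, k)`: the string, and the parameter in unary (for
running times `f(k) · poly` the way in which `k` is written is immaterial). -/
def instanceInputs (x : List Bool) (k : ℕ) : List (List Bool) := [x, unary k]

/-- The answer of a decision procedure is the top bit of stack `0`. -/
def State.Accepts (s : State) : Prop := (s.stack 0).head? = some true

/-- The class FPT: problems decided by a deterministic algorithm in time `f(k) · poly`. -/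
def FPT : Set ParamProblem :=
  {L | ∃ (p : Prog) (f : ℕ → ℕ) (c : ℕ), p.IsDeterministic ∧ Computable f ∧ Monotone f ∧
    ∀ x k, p.HaltsWithin noOracle (instanceInputs x k) (f k * (x.length + k + 1) ^ c)
      fun s => s.Accepts ↔ (x, k) ∈ L}

/-- Randomized FPT with one-sided error: problems for which a randomized algorithm with (worst case)
running time `f(k) · poly` accepts yes-instances with probability at least one half and never
accepts a no-instance. -/
def RandFPT : Set ParamProblem :=
  {L | ∃ (p : Prog) (f : ℕ → ℕ) (c : ℕ), Computable f ∧ Monotone f ∧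
    ∀ x k,
      p.HaltsWithin noOracle (instanceInputs x k) (f k * (x.length + k + 1) ^ c)
        (fun s => s.Accepts → (x, k) ∈ L) ∧
      ((x, k) ∈ L →
        2⁻¹ ≤ p.prob noOracle (instanceInputs x k) (f k * (x.length + k + 1) ^ c)
          State.Accepts)}

/-- There is a parameterized reduction from `L` to `L'` that produces only instances in `P`. -/
def ReducesInto (L L' : ParamProblem) (P : Set (List Bool × ℕ)) : Prop :=
  ∃ (p : Prog) (f g : ℕ → ℕ) (c : ℕ), p.IsDeterministic ∧ Computable f ∧ Computable g ∧
    ∀ x k, p.HaltsWithin noOracle (instanceInputs x k) (f k * (x.length + k + 1) ^ c)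
      fun s => ∃ x' k', s.stack 0 = x' ∧ s.stack 1 = unary k' ∧
        ((x, k) ∈ L ↔ (x', k') ∈ L') ∧ k' ≤ g k ∧ (x', k') ∈ P

/-- There is a parameterized reduction from `L` to `L'`. -/
def Reduces (L L' : ParamProblem) : Prop := ReducesInto L L' Set.univ

/-- Encoding of a number `n` and a list of strings, all of which have the same length determined
by `n`: the number in unary, then the strings, each announced by a bit `true`. -/
def encodeRows (n : ℕ) (rows : List (List Bool)) : List Bool :=
  unary n ++ false :: (rows.flatMap (fun r => true :: r) ++ [false])

/-- Hitting Set, parameterized by the size of the solution: given a family of subsets of an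
`n`-element universe (by characteristic vectors) and `k`, is there a set of at most `k` elements
that meets every member of the family?  Strings that encode no instance are no-instances. -/
def hittingSet : ParamProblem :=
  {i | ∃ (n : ℕ) (F : List (Finset (Fin n))),
    i.1 = encodeRows n (F.map fun A => List.ofFn fun j => decide (j ∈ A)) ∧
    ∃ H : Finset (Fin n), H.card ≤ i.2 ∧ ∀ A ∈ F, (A ∩ H).Nonempty}

/-- The class W[2]: everything that has a parameterized reduction to Hitting Set. -/
def W2 : Set ParamProblem := {L | Reduces L hittingSet}

/-! ## Parameterized PAC learning -/

/-- A concept: a Boolean function, together with its arity. -/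
abbrev Concept : Type := Σ n : ℕ, ((Fin n → Bool) → Bool)

/-- A learning problem: a concept class with a representation scheme. -/
structure LearningProblem : Type where
  concepts : Set Concept
  rep : List Bool → Concept
  range_rep : Set.range rep = concepts

/-- A parameterized learning problem: a learning problem with a parameterization `repParam` of
representations and a parameterization `distParam` of distributions. -/
structure ParamLearningProblem : Type extends LearningProblem where
  repParam : ℕ → Set (List Bool)
  exists_mem_repParam : ∀ r, ∃ k, r ∈ repParam k
  distParam : ∀ n : ℕ, PMF (Fin n → Bool) → ℕ
  distParam_mono : ∀ (n : ℕ) (D D' : PMF (Fin n → Bool)),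
    D.support ⊆ D'.support → distParam n D ≤ distParam n D'

/-- The parameter value of a representation: the least `k` such that `r` lies in the `k`-th set. -/
noncomputable def ParamLearningProblem.kappa (P : ParamLearningProblem) (r : List Bool) : ℕ :=
  sInf {k | r ∈ P.repParam k}

/-- The oracle that draws `x` from `D` and returns `x` with the label `c x`. -/
noncomputable def sampleOracle {n : ℕ} (c : (Fin n → Bool) → Bool) (D : PMF (Fin n → Bool)) :
    Oracle :=
  D.map fun x => (List.ofFn x, c x)

/-- Generalization error of a hypothesis `c` for the hidden concept `c₀` under `D`. -/
noncomputable def err {n : ℕ} (c c₀ : (Fin n → Bool) → Bool) (D : PMF (Fin n → Bool)) : ENNReal :=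
  D.toOuterMeasure {x | c x ≠ c₀ x}

/-- Integer valued functions of `(n, s, 1/ε, 1/δ, k, ℓ)`. -/
abbrev Cost : Type := ℕ × ℕ × ℕ × ℕ × ℕ × ℕ → ℕ

/-- Inputs of a learning algorithm.  The rational accuracy and confidence parameters are handed
over as the integers `⌈1/ε⌉` and `⌈1/δ⌉`.  This is no restriction, as `ε` and `δ` may always be
decreased to `1/⌈1/ε⌉` and `1/⌈1/δ⌉`, and it makes the length of the input polynomial in `1/ε` and
`1/δ`, which the length of a fraction need not be. -/
def learnerInputs (n e d k l : ℕ) : List (List Bool) :=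
  [unary n, unary e, unary d, unary k, unary l]

/-- `(T,S)`-PAC learnability: a randomized program, given `n`, `ε`, `δ` and the parameters
`k` and `ℓ` of the hidden representation `r₀` and of the hidden distribution `D`, and given
oracle access to samples labelled by the concept `c₀` of `r₀`, always makes at most
`O(T(n,s,1/ε,1/δ,k,ℓ))` steps and `O(S(n,s,1/ε,1/δ,k,ℓ))` queries, where `s = |r₀|`, and leaves on
stack `0` a hypothesis with parameter at most `k`; with probability at least `1 - δ` the hypothesis
has error at most `ε`. -/
def PACLearnable (P : ParamLearningProblem) (T S : Cost) : Prop :=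
  ∃ (A : Prog) (C : ℕ), ∀ (n : ℕ) (ε δ : ℚ), 0 < ε → ε ≤ 1 → 0 < δ → δ ≤ 1 →
    ∀ (r₀ : List Bool) (c₀ : (Fin n → Bool) → Bool), P.rep r₀ = ⟨n, c₀⟩ →
    ∀ (D : PMF (Fin n → Bool)) (k l e d : ℕ),
      k = P.kappa r₀ → l = P.distParam n D → e = ⌈1 / ε⌉₊ → d = ⌈1 / δ⌉₊ →
      A.HaltsWithin (sampleOracle c₀ D) (learnerInputs n e d k l)
        (C * T (n, r₀.length, e, d, k, l))
        (fun s => s.queries ≤ C * S (n, r₀.length, e, d, k, l) ∧ s.stack 0 ∈ P.repParam k) ∧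
      1 - ENNReal.ofReal δ ≤
        A.prob (sampleOracle c₀ D) (learnerInputs n e d k l)
          (C * T (n, r₀.length, e, d, k, l))
          (fun s => ∃ c : (Fin n → Bool) → Bool,
            P.rep (s.stack 0) = ⟨n, c⟩ ∧ err c c₀ D ≤ ENNReal.ofReal ε)

/-- The functions bounded by `f(k,ℓ) · poly(n,s,1/ε,1/δ)` for a computable non-decreasing `f`. -/
def fpt : Set Cost :=
  {T | ∃ (f : ℕ × ℕ → ℕ) (c : ℕ), Computable f ∧ Monotone f ∧
    ∀ n s e d k l, T (n, s, e, d, k, l) ≤ f (k, l) * (n + s + e + d + 1) ^ c}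

/-- The learning problems that are `(T,S)`-PAC learnable for some non-decreasing `T` and `S` in
given sets of functions. -/
def PAC (Ts Ss : Set Cost) : Set ParamLearningProblem :=
  {P | ∃ T ∈ Ts, ∃ S ∈ Ss, Monotone T ∧ Monotone S ∧ PACLearnable P T S}

/-- The class FPT-sample-PAC. -/
def fptSamplePAC : Set ParamLearningProblem := PAC fpt fpt

/-! ## Consistency checking -/

/-- The encoding of a list of labelled samples, every sample preceded by its label. -/
def encodeSamples {n : ℕ} (X : List ((Fin n → Bool) × Bool)) : List Bool :=
  encodeRows n (X.map fun a => a.2 :: List.ofFn a.1)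

/-- Consistency checking for a learning problem with constant parameterization of distributions,
parameterized by `k`: given labelled samples at pairwise distinct points and `k`, is there a
representation in the `k`-th set whose concept agrees with all labels? -/
def consistency (P : ParamLearningProblem) : ParamProblem :=
  {i | ∃ (n : ℕ) (X : List ((Fin n → Bool) × Bool)), (X.map Prod.fst).Nodup ∧
    i.1 = encodeSamples X ∧
    ∃ (r : List Bool) (c : (Fin n → Bool) → Bool), r ∈ P.repParam i.2 ∧ P.rep r = ⟨n, c⟩ ∧
      ∀ a ∈ X, c a.1 = a.2}

/-- The inputs of consistency checking all of whose samples are positive. -/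
def positiveSamples : Set (List Bool × ℕ) :=
  {i | ∃ (n : ℕ) (X : List ((Fin n → Bool) × Bool)), (X.map Prod.fst).Nodup ∧
    i.1 = encodeSamples X ∧ ∀ a ∈ X, a.2 = true}

/-! ## Learning Feedback Vertex Set -/

/-- The simple graph on `N` vertices with adjacency matrix `x` (read row by row; an edge may be
indicated by either of its two entries, and the diagonal is ignored). -/
def graphOf (N : ℕ) (x : Fin (N * N) → Bool) : SimpleGraph (Fin N) :=
  SimpleGraph.fromRel fun u v => x (finProdFinEquiv (u, v)) = true

/-- `S` is a feedback vertex set of `G`: deleting `S` leaves a forest. -/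
def IsFeedbackVertexSet {V : Type} (G : SimpleGraph V) (S : Set V) : Prop :=
  (G.induce Sᶜ).IsAcyclic

open Classical in
/-- The concept represented by a vertex set `S`: is `S` a feedback vertex set of the graph with the
given adjacency matrix? -/
noncomputable def fvsConcept (N : ℕ) (S : Set (Fin N)) : Concept :=
  ⟨N * N, fun x => decide (IsFeedbackVertexSet (graphOf N x) S)⟩

/-- A bit string of length `N` represents a set of vertices of an `N`-vertex graph, as its
characteristic vector. -/
noncomputable def fvsRep (r : List Bool) : Concept :=
  fvsConcept r.length {v | r.get v = true}

/-- Learning Feedback Vertex Set, parameterized by the size of the feedback vertex set. -/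
noncomputable def learningFVS : ParamLearningProblem where
  concepts := {c | ∃ (N : ℕ) (S : Set (Fin N)), c = fvsConcept N S}
  rep := fvsRep
  range_rep := by
    classical
    ext c
    constructor
    · rintro ⟨r, rfl⟩
      exact ⟨_, _, rfl⟩
    · rintro ⟨N, S, rfl⟩
      have key : ∀ (r : List Bool) (h : r.length = N),
          (∀ v : Fin r.length, r.get v = true ↔ Fin.cast h v ∈ S) → fvsRep r = fvsConcept N S := by
        intro r h hv
        subst h
        have hS : {v | r.get v = true} = S := by
          ext v
          exact hv v
        unfold fvsRep
        rw [hS]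
      refine ⟨List.ofFn fun v => decide (v ∈ S), key _ (List.length_ofFn) ?_⟩
      intro v
      simp [Fin.cast]
  repParam := fun k => {r | r.count true ≤ k}
  exists_mem_repParam := fun r => ⟨r.count true, le_refl (r.count true)⟩
  distParam := fun _ _ => 1
  distParam_mono := fun _ _ _ _ => le_refl _

end ParamPAC

/-!
A nonempty set of vertices, arranged as a cycle, turns the question whether a vertex set meets it
into the question whether the vertex set is a feedback vertex set: deleting a vertex of a cycle
leaves a path (`isFVS_of_hit`), and a set that misses the cycle leaves it intact (`hit_of_isFVS`).
To obtain genuine cycles from sets with one or two elements, every element is represented by three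
vertices (`exists_three_isOn`).

*Consistency checking.* The samples for a family of sets are the cycles of its members, all labelled
positively. Each cycle gets a private vertex in addition, so that repeated sets yield distinct
samples; a private vertex in a solution may be replaced by any element of its set
(`hasHittingSet_of_forall_isFVS`). Hence consistency with these samples is the existence of a
hitting set (`mem_consistency_iff`). The matrices are written by an explicit program in cubic time
(`reducesInto_consistency`); a string that encodes no family of nonempty sets is recognized by an
automaton and replaced by a no-instance.

*Learning.* Suppose that vertex sets can be learnt, let a family with encoding of length `L` and a
number `k` be given, and let `2 ^ b ≤ 2 L + 1` be a power of two larger than the number of sets. If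
there is a hitting set of size at most `k`, extend it to a set of exactly `k` vertices and take this
as the hidden representation. For the distribution that draws one of the cycles (or, for padding,
the empty graph) by `b` coin tosses, all labels are positive, so the oracle can be simulated without
knowing the hidden set (`sampler_drawSample`). Each cycle has probability at least `2⁻¹ ^ b`, so a
hypothesis with error at most `1 / (2 L + 2)` is consistent with all of them, and gives a hitting
set (`le_prob_of_learner`). The hypothesis is checked before the algorithm accepts, and so the error
is one-sided (`hasHittingSet_of_hit`, `solve_correct`).

If there is no hitting set, then nothing is known about the behaviour of the learner, and it need
not even stop. So it is simulated under a clock, which is set to the guaranteed running time on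
yes-instances. The simulation is compared with the learner by an inequality between expectations
that has the strength of a coupling (`Dominated`, `Sampler.simulated`). To set the clock, a program
has to compute the factor `f(k)` in a time that is again bounded by a computable function; such a
program is compiled from Mathlib's codes for partial recursive functions, together with a computable
count of its steps (`exists_runs_of_computable`). This places Hitting Set in `RandFPT`
(`hittingSet_mem_randFPT`).

*Classes.* `RandFPT` is closed under reductions (`mem_randFPT_of_reduces`), so it contains `W2` if
vertex sets can be learnt. If moreover `RandFPT ⊆ FPT`, then `W2 ⊆ FPT`, and the other inclusion
always holds, since a decision procedure can output a fixed yes- or no-instance (`fpt_subset_w2`).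

Deterministic computations are described by `Runs`, which relates the contents of the stacks before
and after and bounds the number of steps; running times are obtained by composing such statements.
-/

namespace ParamPAC

/-! ### Deterministic runs and the cut-off of loops -/

/-- Enlarging the bodies' cut-off and the number of admitted tests does not change a loop none of
whose computations is cut off. -/
theorem runLoop_mono (x : ℕ) (b b' : State → PMF (Option State))
    (h : ∀ s, none ∉ (b s).support → b' s = b s) :
    ∀ (n n' : ℕ) (s : State), n ≤ n' → none ∉ (runLoop x b n s).support →
      runLoop x b' n' s = runLoop x b n s := by
  intro n
  induction n with
  | zero => intro n' s _ hn; simp [runLoop] at hn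
  | succ n ih =>
    intro n' s hle hn
    obtain ⟨n', rfl⟩ : ∃ m, n' = m + 1 := ⟨n' - 1, by omega⟩
    unfold runLoop at hn ⊢
    split
    · rfl
    · rename_i a l hs
      rw [hs] at hn
      simp only [PMF.mem_support_bind_iff, not_exists, not_and] at hn
      have hb : none ∉ (b s.tick).support := fun hc => hn none hc (by simp)
      rw [h _ hb]
      ext1 o
      simp only [PMF.bind_apply]
      refine tsum_congr fun o' => ?_
      by_cases ho : o' ∈ (b s.tick).support
      · cases o' with
        | none => rfl
        | some s' =>
          have := hn (some s') ho
          simp only at this ⊢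
          rw [ih n' s' (by omega) this]
      · rw [PMF.mem_support_iff, not_not] at ho
        simp [ho]

/-- If no computation is cut off at `F` tests, then a larger bound gives the same outcome. -/
theorem Prog.eval_mono (O : Oracle) {F F' : ℕ} (hF : F ≤ F') :
    ∀ (p : Prog) (s : State), none ∉ (p.eval O F s).support → p.eval O F' s = p.eval O F s := by
  intro p
  induction p with
  | push x b => intro s _; rfl
  | pop x => intro s _; rfl
  | toss x => intro s _; rfl
  | query x y => intro s _; rfl
  | seq p q ihp ihq =>
    intro s hn
    unfold Prog.eval at hn ⊢
    simp only [PMF.mem_support_bind_iff, not_exists, not_and] at hn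
    have hb : none ∉ (p.eval O F s).support := fun hc => hn none hc (by simp)
    rw [ihp _ hb]
    ext1 o
    simp only [PMF.bind_apply]
    refine tsum_congr fun o' => ?_
    by_cases ho : o' ∈ (p.eval O F s).support
    · cases o' with
      | none => rfl
      | some s' =>
        have := hn (some s') ho
        simp only at this ⊢
        rw [ihq s' this]
    · rw [PMF.mem_support_iff, not_not] at ho
      simp [ho]
  | branch x p q r ihp ihq ihr =>
    intro s hn
    unfold Prog.eval at hn ⊢
    split
    · rename_i hs; rw [hs] at hn; exact ihp _ hn
    · rename_i hs; rw [hs] at hn; exact ihq _ hn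
    · rename_i hs; rw [hs] at hn; exact ihr _ hn
  | loop x p ih =>
    intro s hn
    exact runLoop_mono x _ _ ih F F' s hF hn

/-- Contents of all stacks. -/
abbrev Stacks : Type := ℕ → List Bool

/-- Without tossing coins or asking the oracle, `p` transforms `σ` into `σ'` in at most `B`
steps. -/
def Runs (p : Prog) (σ σ' : Stacks) (B : ℕ) : Prop :=
  ∃ t ≤ B, ∀ (O : Oracle) (F time q : ℕ), B ≤ F →
    p.eval O F ⟨σ, time, q⟩ = PMF.pure (some ⟨σ', time + t, q⟩)

theorem Runs.mono {p : Prog} {σ σ' : Stacks} {B B' : ℕ} (h : Runs p σ σ' B) (hB : B ≤ B') :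
    Runs p σ σ' B' := by
  obtain ⟨t, ht, h⟩ := h
  exact ⟨t, ht.trans hB, fun O F time q hF => h O F time q (hB.trans hF)⟩

theorem Runs.push (x : ℕ) (b : Bool) (σ : Stacks) :
    Runs (.push x b) σ (Function.update σ x (b :: σ x)) 1 :=
  ⟨1, le_rfl, fun _ _ _ _ _ => rfl⟩

theorem Runs.pop (x : ℕ) (σ : Stacks) :
    Runs (.pop x) σ (Function.update σ x (σ x).tail) 1 :=
  ⟨1, le_rfl, fun _ _ _ _ _ => rfl⟩

theorem Runs.seq {p q : Prog} {σ₁ σ₂ σ₃ : Stacks} {B₁ B₂ : ℕ} (hp : Runs p σ₁ σ₂ B₁)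
    (hq : Runs q σ₂ σ₃ B₂) : Runs (.seq p q) σ₁ σ₃ (B₁ + B₂) := by
  obtain ⟨t, ht, hp⟩ := hp
  obtain ⟨u, hu, hq⟩ := hq
  refine ⟨t + u, by omega, fun O F time c hF => ?_⟩
  simp only [Prog.eval]
  rw [hp O F time c (by omega), PMF.pure_bind]
  simp only
  rw [hq O F _ c (by omega), add_assoc]

theorem Runs.branch_nil {x : ℕ} {p q r : Prog} {σ σ' : Stacks} {B : ℕ} (hx : σ x = [])
    (h : Runs p σ σ' B) : Runs (.branch x p q r) σ σ' (B + 1) := by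
  obtain ⟨t, ht, h⟩ := h
  refine ⟨t + 1, by omega, fun O F time c hF => ?_⟩
  simp only [Prog.eval, hx, State.tick]
  rw [h O F _ c (by omega), add_assoc, add_comm 1 t]

theorem Runs.branch_false {x : ℕ} {p q r : Prog} {σ σ' : Stacks} {B : ℕ} {l : List Bool}
    (hx : σ x = false :: l) (h : Runs q σ σ' B) : Runs (.branch x p q r) σ σ' (B + 1) := by
  obtain ⟨t, ht, h⟩ := h
  refine ⟨t + 1, by omega, fun O F time c hF => ?_⟩
  simp only [Prog.eval, hx, State.tick]
  rw [h O F _ c (by omega), add_assoc, add_comm 1 t]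

theorem Runs.branch_true {x : ℕ} {p q r : Prog} {σ σ' : Stacks} {B : ℕ} {l : List Bool}
    (hx : σ x = true :: l) (h : Runs r σ σ' B) : Runs (.branch x p q r) σ σ' (B + 1) := by
  obtain ⟨t, ht, h⟩ := h
  refine ⟨t + 1, by omega, fun O F time c hF => ?_⟩
  simp only [Prog.eval, hx, State.tick]
  rw [h O F _ c (by omega), add_assoc, add_comm 1 t]

theorem Runs.loop_nil {x : ℕ} {p : Prog} {σ : Stacks} (hx : σ x = []) :
    Runs (.loop x p) σ σ 1 := by
  refine ⟨1, le_rfl, fun O F time c hF => ?_⟩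
  obtain ⟨F, rfl⟩ : ∃ m, F = m + 1 := ⟨F - 1, by omega⟩
  simp only [Prog.eval, runLoop, hx, State.tick]

theorem Runs.loop_cons {x : ℕ} {p : Prog} {σ₁ σ₂ σ₃ : Stacks} {B₁ B₂ : ℕ} (hx : σ₁ x ≠ [])
    (hp : Runs p σ₁ σ₂ B₁) (hl : Runs (.loop x p) σ₂ σ₃ B₂) :
    Runs (.loop x p) σ₁ σ₃ (B₁ + B₂ + 1) := by
  obtain ⟨t, ht, hp⟩ := hp
  obtain ⟨u, hu, hl⟩ := hl
  refine ⟨t + u + 1, by omega, fun O F time c hF => ?_⟩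
  obtain ⟨F, rfl⟩ : ∃ m, F = m + 1 := ⟨F - 1, by omega⟩
  simp only [Prog.eval]
  unfold runLoop
  obtain ⟨a, l, hx⟩ := List.exists_cons_of_ne_nil hx
  simp only [hx, State.tick]
  rw [hp O (F + 1) _ c (by omega), PMF.pure_bind]
  simp only
  have h1 := hl O F (time + 1 + t) c (by omega)
  simp only [Prog.eval] at h1
  rw [runLoop_mono x (p.eval O F) _ (fun s hs => Prog.eval_mono O (Nat.le_succ F) p s hs) F F _
    le_rfl (by rw [h1]; simp), h1]
  congr 3
  omega

/-- A loop over a stack `x` that runs through the family of states `S`, indexed by the remaining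
contents of `x` and an accumulated value. -/
theorem Runs.loop_fold {α : Type*} {x : ℕ} {p : Prog} (S : List Bool → α → Stacks)
    (g : α → Bool → α) (t : ℕ) (hx : ∀ l a, S l a x = l) :
    ∀ (l : List Bool) (a : α),
      (∀ b l₁ l₂, l = l₁ ++ b :: l₂ →
        Runs p (S (b :: l₂) (l₁.foldl g a)) (S l₂ ((l₁ ++ [b]).foldl g a)) t) →
      Runs (.loop x p) (S l a) (S [] (l.foldl g a)) ((t + 1) * l.length + 1) := by
  intro l
  induction l with
  | nil =>
    intro a _
    exact (Runs.loop_nil (hx [] a)).mono (by simp)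
  | cons b l ih =>
    intro a h
    have h1 := h b [] l rfl
    have h2 := ih (g a b) (fun b' l₁ l₂ e => by
      have := h b' (b :: l₁) l₂ (by simp [e])
      simpa using this)
    refine (Runs.loop_cons (by simp [hx]) h1 h2).mono ?_
    simp only [List.length_cons]
    ring_nf
    omega

/-- The stacks whose first contents are those in a given list, the others being empty. -/
def stk (L : List (List Bool)) : Stacks := fun i => L.getD i []

theorem initial_eq_stk (L : List (List Bool)) : initial L = ⟨stk L, 0, 0⟩ := rfl

theorem update_stk {L : List (List Bool)} {x : ℕ} (hx : x < L.length) (v : List Bool) :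
    Function.update (stk L) x v = stk (L.set x v) := by
  funext i
  by_cases h : i = x
  · subst h
    simp [stk, hx]
  · simp [stk, h, Ne.symm h]

theorem Runs.push_stk {L : List (List Bool)} (x : ℕ) (b : Bool) (hx : x < L.length) :
    Runs (.push x b) (stk L) (stk (L.set x (b :: L.getD x []))) 1 := by
  rw [← update_stk hx]; exact Runs.push x b _

theorem Runs.pop_stk {L : List (List Bool)} (x : ℕ) (hx : x < L.length) :
    Runs (.pop x) (stk L) (stk (L.set x (L.getD x []).tail)) 1 := by
  rw [← update_stk hx]; exact Runs.pop x _

/-! ### Basic programs on stacks -/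

namespace Prog

/-- A program without effect. -/
def skip (x : ℕ) : Prog := .seq (.push x true) (.pop x)

/-- Pop the bits of stack `x` one by one, and run `p` for every bit `false` and `q` for every bit
`true`. -/
def forBits (x : ℕ) (p q : Prog) : Prog :=
  .loop x (.branch x (.pop x) (.seq (.pop x) p) (.seq (.pop x) q))

/-- Empty stack `x`. -/
def clear (x : ℕ) : Prog := .loop x (.pop x)

/-- Move the bits of `x` to `y` one by one; this reverses their order. -/
def move (x y : ℕ) : Prog := forBits x (.push y false) (.push y true)

/-- Move the bits of `x` one by one to both `y` and `z`. -/
def moveTwo (x y z : ℕ) : Prog :=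
  forBits x (.seq (.push y false) (.push z false)) (.seq (.push y true) (.push z true))

/-- Put a copy of `x` on top of `y`, using the empty stack `t`. -/
def copy (x y t : ℕ) : Prog := .seq (move x t) (moveTwo t x y)

/-- Push the bit `b` on `y` once for every bit of `x`, using the empty stack `t`. -/
def pushEach (x y : ℕ) (b : Bool) (t : ℕ) : Prog :=
  .seq (move x t) (forBits t (.seq (.push x false) (.push y b)) (.seq (.push x true) (.push y b)))

end Prog

theorem Runs.congr {p : Prog} {σ σ' τ : Stacks} {B : ℕ} (h : Runs p σ σ' B) (e : σ' = τ) :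
    Runs p σ τ B := e ▸ h

theorem Runs.skip (x : ℕ) (σ : Stacks) : Runs (.skip x) σ σ 2 :=
  ((Runs.push x true σ).seq (Runs.pop x _)).congr (by simp)

/-- A loop over the bits of a stack maintains an invariant that relates the remaining bits to a
value `a` describing the other stacks. -/
theorem Runs.forBits_inv {α : Type*} {x : ℕ} {p q : Prog} (S : List Bool → α → Stacks)
    (Inv : List Bool → α → Prop) (t : ℕ) (hx : ∀ l a, S l a x = l)
    (hS : ∀ l l' a, Function.update (S l a) x l' = S l' a)
    (hp : ∀ l a, Inv (false :: l) a → ∃ a', Inv l a' ∧ Runs p (S l a) (S l a') t)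
    (hq : ∀ l a, Inv (true :: l) a → ∃ a', Inv l a' ∧ Runs q (S l a) (S l a') t) :
    ∀ (l : List Bool) (a : α), Inv l a →
      ∃ a', Inv [] a' ∧ Runs (.forBits x p q) (S l a) (S [] a') ((t + 3) * l.length + 1) := by
  intro l
  induction l with
  | nil =>
    intro a h
    exact ⟨a, h, (Runs.loop_nil (hx [] a)).mono (by simp)⟩
  | cons b l ih =>
    intro a h
    have key : ∃ a', Inv l a' ∧ Runs (.branch x (.pop x) (.seq (.pop x) p) (.seq (.pop x) q))
        (S (b :: l) a) (S l a') (t + 2) := by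
      have hpop : Runs (.pop x) (S (b :: l) a) (S l a) 1 := by
        have := Runs.pop x (S (b :: l) a)
        rw [hx, hS] at this
        exact this
      cases b with
      | false =>
        obtain ⟨a', h', r⟩ := hp l a h
        exact ⟨a', h', (Runs.branch_false (hx _ _) (hpop.seq r)).mono (by omega)⟩
      | true =>
        obtain ⟨a', h', r⟩ := hq l a h
        exact ⟨a', h', (Runs.branch_true (hx _ _) (hpop.seq r)).mono (by omega)⟩
    obtain ⟨a', h', r⟩ := key
    obtain ⟨a'', h'', r'⟩ := ih a' h'
    refine ⟨a'', h'', (Runs.loop_cons (by simp [hx]) r r').mono ?_⟩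
    simp only [List.length_cons]
    ring_nf
    omega

/-- A loop over the bits of a stack that folds a function over these bits. -/
theorem Runs.forBits_fold {α : Type*} {x : ℕ} {p q : Prog} (S : List Bool → α → Stacks)
    (g : α → Bool → α) (t : ℕ) (hx : ∀ l a, S l a x = l)
    (hS : ∀ l l' a, Function.update (S l a) x l' = S l' a) (l : List Bool) (a : α)
    (hp : ∀ l₁ l₂, l = l₁ ++ false :: l₂ →
      Runs p (S l₂ (l₁.foldl g a)) (S l₂ (g (l₁.foldl g a) false)) t)
    (hq : ∀ l₁ l₂, l = l₁ ++ true :: l₂ →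
      Runs q (S l₂ (l₁.foldl g a)) (S l₂ (g (l₁.foldl g a) true)) t) :
    Runs (.forBits x p q) (S l a) (S [] (l.foldl g a)) ((t + 3) * l.length + 1) := by
  obtain ⟨a', h, r⟩ := Runs.forBits_inv S
    (fun l₂ a' => ∃ l₁, l = l₁ ++ l₂ ∧ a' = l₁.foldl g a) t hx hS
    (fun l₂ a' ⟨l₁, e, ha⟩ => ⟨g a' false, ⟨l₁ ++ [false], by simp [e], by simp [ha]⟩,
      by rw [ha]; exact hp l₁ l₂ e⟩)
    (fun l₂ a' ⟨l₁, e, ha⟩ => ⟨g a' true, ⟨l₁ ++ [true], by simp [e], by simp [ha]⟩,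
      by rw [ha]; exact hq l₁ l₂ e⟩) l a ⟨[], rfl, rfl⟩
  obtain ⟨l₁, e, ha⟩ := h
  rw [List.append_nil] at e
  rw [ha, ← e] at r
  exact r

/-- A loop that ignores the values of the bits and iterates a function. -/
theorem Runs.forBits_iterate {α : Type*} {x : ℕ} {p : Prog} (S : List Bool → α → Stacks)
    (g : α → α) (t : ℕ) (hx : ∀ l a, S l a x = l)
    (hS : ∀ l l' a, Function.update (S l a) x l' = S l' a) (l : List Bool) (a : α)
    (hp : ∀ l₂ i, i < l.length → Runs p (S l₂ (g^[i] a)) (S l₂ (g (g^[i] a))) t) :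
    Runs (.forBits x p p) (S l a) (S [] (g^[l.length] a)) ((t + 3) * l.length + 1) := by
  have hf : ∀ (l : List Bool) a, l.foldl (fun a _ => g a) a = g^[l.length] a := by
    intro l
    induction l with
    | nil => intro a; rfl
    | cons b l ih => intro a; simp [ih]
  have := Runs.forBits_fold (p := p) (q := p) S (fun a _ => g a) t hx hS l a
    (fun l₁ l₂ e => by rw [hf]; exact hp l₂ _ (by simp [e]))
    (fun l₁ l₂ e => by rw [hf]; exact hp l₂ _ (by simp [e]))
  rwa [hf] at this

theorem Runs.clear (x : ℕ) (σ : Stacks) :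
    Runs (.clear x) σ (Function.update σ x []) (2 * (σ x).length + 1) := by
  have := Runs.loop_fold (x := x) (p := .pop x) (fun l (_ : Unit) => Function.update σ x l)
    (fun a _ => a) 1 (by simp) (σ x) () (fun b l₁ l₂ _ => by
      simpa using Runs.pop x (Function.update σ x (b :: l₂)))
  simpa [Prog.clear] using this

theorem Runs.move {x y : ℕ} (h : x ≠ y) (σ : Stacks) :
    Runs (.move x y) σ (Function.update (Function.update σ y ((σ x).reverse ++ σ y)) x [])
      (4 * (σ x).length + 1) := by
  have hf : ∀ (l a : List Bool), l.foldl (fun a b => b :: a) a = l.reverse ++ a := by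
    intro l; induction l with
    | nil => intro a; rfl
    | cons b l ih => intro a; simp [ih]
  have := Runs.forBits_fold (x := x) (p := .push y false) (q := .push y true)
    (fun l a => Function.update (Function.update σ y a) x l) (fun a b => b :: a) 1 (by simp)
    (by simp) (σ x) (σ y)
    (fun l₁ l₂ _ => by
      refine (Runs.push _ _ _).congr ?_
      rw [Function.update_comm h]; simp [h.symm])
    (fun l₁ l₂ _ => by
      refine (Runs.push _ _ _).congr ?_
      rw [Function.update_comm h]; simp [h.symm])
  rw [hf] at this
  simpa [Prog.move] using this

theorem Runs.moveTwo {x y z : ℕ} (hxy : x ≠ y) (hxz : x ≠ z) (hyz : y ≠ z) (σ : Stacks) :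
    Runs (.moveTwo x y z) σ
      (Function.update (Function.update (Function.update σ y ((σ x).reverse ++ σ y)) z
        ((σ x).reverse ++ σ z)) x []) (5 * (σ x).length + 1) := by
  have hf : ∀ (l a c : List Bool), l.foldl (fun (a : List Bool × List Bool) b =>
      (b :: a.1, b :: a.2)) (a, c) = (l.reverse ++ a, l.reverse ++ c) := by
    intro l; induction l with
    | nil => intro a c; rfl
    | cons b l ih => intro a c; simp [ih]
  have key : ∀ b l₂ (a : List Bool × List Bool), Runs (.seq (.push y b) (.push z b))
      (Function.update (Function.update (Function.update σ y a.1) z a.2) x l₂)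
      (Function.update (Function.update (Function.update σ y (b :: a.1)) z (b :: a.2)) x l₂) 2 := by
    intro b l₂ a
    refine ((Runs.push _ _ _).seq (Runs.push _ _ _)).congr ?_
    funext i
    by_cases h1 : i = x
    · subst h1; simp [hxy, hxz]
    · by_cases h2 : i = z
      · subst h2; simp [hxz.symm, hyz.symm]
      · by_cases h3 : i = y
        · subst h3; simp [hxy.symm, hyz]
        · simp [h1, h2, h3]
  have := Runs.forBits_fold (x := x) (p := .seq (.push y false) (.push z false))
    (q := .seq (.push y true) (.push z true))
    (fun l (a : List Bool × List Bool) =>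
      Function.update (Function.update (Function.update σ y a.1) z a.2) x l)
    (fun a b => (b :: a.1, b :: a.2)) 2 (by simp) (by simp) (σ x) (σ y, σ z)
    (fun l₁ l₂ _ => key _ _ _) (fun l₁ l₂ _ => key _ _ _)
  rw [hf] at this
  simpa [Prog.moveTwo] using this

theorem Runs.copy {x y t : ℕ} (hxy : x ≠ y) (hxt : x ≠ t) (hyt : y ≠ t) (σ : Stacks)
    (ht : σ t = []) :
    Runs (.copy x y t) σ (Function.update σ y (σ x ++ σ y)) (9 * (σ x).length + 2) := by
  refine (((Runs.move hxt σ).seq (Runs.moveTwo hxt.symm hyt.symm hxy _)).mono ?_).congr ?_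
  · simp [ht, hxt.symm]; omega
  · funext i
    by_cases h1 : i = x
    · subst h1; simp [hxy, hxt, ht, hxt.symm]
    · by_cases h2 : i = t
      · subst h2; simp [hyt.symm, ht]
      · by_cases h3 : i = y
        · subst h3; simp [hxt.symm, hxy.symm, hyt, ht]
        · simp [h1, h2, h3]

theorem Runs.pushEach {x y t : ℕ} (b : Bool) (hxy : x ≠ y) (hxt : x ≠ t) (hyt : y ≠ t)
    (σ : Stacks) (ht : σ t = []) :
    Runs (.pushEach x y b t) σ
      (Function.update σ y (List.replicate (σ x).length b ++ σ y)) (9 * (σ x).length + 2) := by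
  have hf : ∀ (l a c : List Bool), l.foldl (fun (a : List Bool × List Bool) b' =>
      (b' :: a.1, b :: a.2)) (a, c) = (l.reverse ++ a, List.replicate l.length b ++ c) := by
    intro l; induction l with
    | nil => intro a c; rfl
    | cons b l ih => intro a c; simp [ih, List.replicate_succ', List.append_assoc]
  have key : ∀ b' l₂ (a : List Bool × List Bool), Runs (.seq (.push x b') (.push y b))
      (Function.update (Function.update (Function.update σ x a.1) y a.2) t l₂)
      (Function.update (Function.update (Function.update σ x (b' :: a.1)) y (b :: a.2)) t l₂)
      2 := by
    intro b' l₂ a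
    refine ((Runs.push _ _ _).seq (Runs.push _ _ _)).congr ?_
    funext i
    by_cases h1 : i = x
    · subst h1; simp [hxy, hxt]
    · by_cases h2 : i = y
      · subst h2; simp [hxy.symm, hyt]
      · by_cases h3 : i = t
        · subst h3; simp [hxt.symm, hyt.symm]
        · simp [h1, h2, h3]
  have := Runs.forBits_fold (x := t) (p := .seq (.push x false) (.push y b))
    (q := .seq (.push x true) (.push y b))
    (fun l (a : List Bool × List Bool) =>
      Function.update (Function.update (Function.update σ x a.1) y a.2) t l)
    (fun a b' => (b' :: a.1, b :: a.2)) 2 (by simp) (by simp) (σ x).reverse ([], σ y)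
    (fun l₁ l₂ _ => key _ _ _) (fun l₁ l₂ _ => key _ _ _)
  rw [hf] at this
  have e : Function.update (Function.update (Function.update σ x []) y (σ y)) t (σ x).reverse =
      Function.update (Function.update σ t ((σ x).reverse ++ σ t)) x [] := by
    funext i
    by_cases h1 : i = x
    · subst h1; simp [hxt, hxy]
    · by_cases h3 : i = t
      · subst h3; simp [ht, hxt.symm]
      · by_cases h2 : i = y
        · subst h2; simp [hxy.symm, hyt]
        · simp [h1, h2, h3]
  simp only [e] at this
  have h2 := (Runs.move hxt σ).seq this
  refine (h2.mono (by simp; omega)).congr ?_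
  funext i
  by_cases h3 : i = t
  · subst h3; simp [ht, hyt.symm]
  · by_cases h2 : i = y
    · subst h2; simp [hyt]
    · by_cases h1 : i = x
      · subst h1; simp [hxt, hxy]
      · simp [h2, h3]

theorem Runs.clear_stk {L : List (List Bool)} (x : ℕ) (hx : x < L.length) :
    Runs (.clear x) (stk L) (stk (L.set x [])) (2 * (L.getD x []).length + 1) := by
  rw [← update_stk hx]; exact Runs.clear x _

theorem Runs.move_stk {L : List (List Bool)} {x y : ℕ} (h : x ≠ y) (hx : x < L.length)
    (hy : y < L.length) :
    Runs (.move x y) (stk L) (stk ((L.set y ((L.getD x []).reverse ++ L.getD y [])).set x []))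
      (4 * (L.getD x []).length + 1) := by
  rw [← update_stk (by simpa using hx), ← update_stk hy]; exact Runs.move h _

theorem Runs.copy_stk {L : List (List Bool)} {x y t : ℕ} (hxy : x ≠ y) (hxt : x ≠ t) (hyt : y ≠ t)
    (hy : y < L.length) (ht : L.getD t [] = []) :
    Runs (.copy x y t) (stk L) (stk (L.set y (L.getD x [] ++ L.getD y [])))
      (9 * (L.getD x []).length + 2) := by
  rw [← update_stk hy]; exact Runs.copy hxy hxt hyt _ ht

theorem Runs.pushEach_stk {L : List (List Bool)} {x y t : ℕ} (b : Bool) (hxy : x ≠ y)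
    (hxt : x ≠ t) (hyt : y ≠ t) (hy : y < L.length) (ht : L.getD t [] = []) :
    Runs (.pushEach x y b t) (stk L)
      (stk (L.set y (List.replicate (L.getD x []).length b ++ L.getD y [])))
      (9 * (L.getD x []).length + 2) := by
  rw [← update_stk hy]; exact Runs.pushEach b hxy hxt hyt _ ht

/-! ### Adjacency matrices of cycles -/

/-- The position of the first `true` behind position `u` of `w`, where the search starts again at
the beginning if it is unsuccessful. -/
def nextPos (w : List Bool) (u : ℕ) : ℕ :=
  if true ∈ w.drop (u + 1) then u + 1 + (w.drop (u + 1)).findIdx id else w.findIdx id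

/-- The string of length `N` with its only `true` at position `p`. -/
def mask (N p : ℕ) : List Bool :=
  List.replicate p false ++ true :: List.replicate (N - 1 - p) false

/-- Row `u` of the adjacency matrix of the cycle through the positions of the bits `true` of `w`,
in their natural order. -/
def cycRow (w : List Bool) (u : ℕ) : List Bool :=
  if w[u]? = some true then mask w.length (nextPos w u) else List.replicate w.length false

/-- The adjacency matrix, row by row, of the (directed) cycle through the positions of the bits
`true` of `w`. -/
def cycBits (w : List Bool) : List Bool := (List.range w.length).flatMap (cycRow w)

theorem length_mask {N p : ℕ} (h : p < N) : (mask N p).length = N := by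
  simp [mask]; omega

theorem nextPos_lt {w : List Bool} (h : true ∈ w) (u : ℕ) : nextPos w u < w.length := by
  unfold nextPos
  split
  · rename_i h'
    have : (w.drop (u + 1)).findIdx id < (w.drop (u + 1)).length :=
      List.findIdx_lt_length_of_exists ⟨true, h', rfl⟩
    rw [List.length_drop] at this
    omega
  · exact List.findIdx_lt_length_of_exists ⟨true, h, rfl⟩

theorem length_cycRow (w : List Bool) (u : ℕ) : (cycRow w u).length = w.length := by
  unfold cycRow
  split
  · rename_i h
    exact length_mask (nextPos_lt (List.mem_of_getElem? h) u)
  · simp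

theorem length_flatMap_const {α : Type*} (l : List α) (f : α → List Bool) (n : ℕ)
    (h : ∀ a ∈ l, (f a).length = n) : (l.flatMap f).length = l.length * n := by
  induction l with
  | nil => simp
  | cons a l ih =>
    rw [List.flatMap_cons, List.length_append, h a (by simp),
      ih fun b hb => h b (by simp [hb]), List.length_cons]
    ring

theorem length_cycBits (w : List Bool) : (cycBits w).length = w.length * w.length := by
  have := length_flatMap_const (List.range w.length) (cycRow w) w.length
    (fun u _ => length_cycRow w u)
  simpa [cycBits] using this

namespace Prog

/-- One pass over the bits of stack 6, from the last position to the first.  Stack 7 receives the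
processed bits, stack 8 holds the row that points to the most recent bit `true`, and the rows of
the matrix are collected on stack 9. -/
def cyclePass : Prog :=
  forBits 6
    (.seq (pushEach 6 9 false 11) (.seq (pushEach 7 9 false 11)
      (.seq (.push 9 false) (.push 7 false))))
    (.seq (copy 8 9 11) (.seq (clear 8) (.seq (pushEach 7 8 false 11) (.seq (.push 8 true)
      (.seq (pushEach 6 8 false 11) (.push 7 true))))))

/-- Write the matrix of the cycle described by the reversed contents of stack 6 on stack 9.  Going
backwards, the successor of the last vertex is not known yet when it is needed; hence there are two
passes, the first of which finds the row that points to the first bit `true`. -/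
def cycle : Prog :=
  .seq cyclePass (.seq (clear 9) (.seq (move 7 6) (.seq cyclePass (.seq (clear 7) (clear 8)))))

end Prog

section
variable (a0 a1 a2 a3 a4 a5 a10 : List Bool) (rest : List (List Bool))

theorem cyclePass_false (l pr mk out : List Bool) (N : ℕ) (hN : l.length + pr.length + 1 = N) :
    Runs (.seq (.pushEach 6 9 false 11) (.seq (.pushEach 7 9 false 11)
      (.seq (.push 9 false) (.push 7 false))))
      (stk (a0::a1::a2::a3::a4::a5::l::pr::mk::out::a10::[]::rest))
      (stk (a0::a1::a2::a3::a4::a5::l::(false::pr)::mk::(List.replicate N false ++ out)::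
        a10::[]::rest))
      (20 * N + 10) := by
  refine (((Runs.pushEach_stk false (by decide) (by decide) (by decide) (by simp) rfl).seq
    ((Runs.pushEach_stk false (by decide) (by decide) (by decide) (by simp) rfl).seq
    ((Runs.push_stk 9 false (by simp)).seq (Runs.push_stk 7 false (by simp))))).mono ?_).congr ?_
  · simp; omega
  · have e : List.replicate N false =
        false :: (List.replicate pr.length false ++ List.replicate l.length false) := by
      rw [List.replicate_append_replicate, ← List.replicate_succ]; congr 1; omega
    rw [e, List.cons_append, List.append_assoc]
    rfl

theorem cyclePass_true (l pr mk out : List Bool) (N : ℕ) (hN : l.length + pr.length + 1 = N)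
    (hmk : mk.length ≤ N) :
    Runs (.seq (.copy 8 9 11) (.seq (.clear 8) (.seq (.pushEach 7 8 false 11) (.seq (.push 8 true)
      (.seq (.pushEach 6 8 false 11) (.push 7 true))))))
      (stk (a0::a1::a2::a3::a4::a5::l::pr::mk::out::a10::[]::rest))
      (stk (a0::a1::a2::a3::a4::a5::l::(true::pr)::(mask N l.length)::(mk ++ out)::a10::[]::rest))
      (20 * N + 10) := by
  refine (((Runs.copy_stk (by decide) (by decide) (by decide) (by simp) rfl).seq
    ((Runs.clear_stk 8 (by simp)).seq
    ((Runs.pushEach_stk false (by decide) (by decide) (by decide) (by simp) rfl).seq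
    ((Runs.push_stk 8 true (by simp)).seq
    ((Runs.pushEach_stk false (by decide) (by decide) (by decide) (by simp) rfl).seq
    (Runs.push_stk 7 true (by simp))))))).mono ?_).congr ?_
  · simp; omega
  · have e : N - 1 - l.length = pr.length := by omega
    simp [mask, e]

theorem findIdx_cons_false (pr : List Bool) : (false :: pr).findIdx id = pr.findIdx id + 1 := by
  simp [List.findIdx_cons]

/-- The first pass determines the row that points to the first bit `true`. -/
theorem cyclePass_first (w : List Bool) :
    ∃ mk out, (true ∈ w → mk = mask w.length (w.findIdx id)) ∧ mk.length ≤ w.length ∧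
      out.length ≤ w.length * w.length ∧
      Runs .cyclePass (stk (a0::a1::a2::a3::a4::a5::w.reverse::[]::[]::[]::a10::[]::rest))
        (stk (a0::a1::a2::a3::a4::a5::[]::w::mk::out::a10::[]::rest))
        ((20 * w.length + 13) * w.length + 1) := by
  obtain ⟨⟨pr, mk, out⟩, ⟨h1, h2, h3, h4⟩, r⟩ := Runs.forBits_inv (x := 6)
    (fun l (a : List Bool × List Bool × List Bool) =>
      stk (a0::a1::a2::a3::a4::a5::l::a.1::a.2.1::a.2.2::a10::[]::rest))
    (fun l a => w = l.reverse ++ a.1 ∧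
      (true ∈ a.1 → a.2.1 = mask w.length (l.length + a.1.findIdx id)) ∧
      a.2.1.length ≤ w.length ∧ a.2.2.length ≤ a.1.length * w.length)
    (20 * w.length + 10) (fun _ _ => rfl) (fun _ _ _ => update_stk (by simp) _)
    (fun l ⟨pr, mk, out⟩ ⟨h1, h2, h3, h4⟩ => by
      have hN : l.length + pr.length + 1 = w.length := by rw [h1]; simp; omega
      refine ⟨(false :: pr, mk, List.replicate w.length false ++ out), ⟨by simp [h1], ?_, h3, ?_⟩,
        cyclePass_false _ _ _ _ _ _ _ _ l pr mk out _ hN⟩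
      · intro h
        rw [h2 (by simpa using h), findIdx_cons_false]
        simp only [List.length_cons]
        congr 1; omega
      · simp only [List.length_append, List.length_replicate, List.length_cons] at h4 ⊢
        rw [add_mul, one_mul]; omega)
    (fun l ⟨pr, mk, out⟩ ⟨h1, h2, h3, h4⟩ => by
      have hN : l.length + pr.length + 1 = w.length := by rw [h1]; simp; omega
      refine ⟨(true :: pr, mask w.length l.length, mk ++ out), ⟨by simp [h1], ?_, ?_, ?_⟩,
        cyclePass_true _ _ _ _ _ _ _ _ l pr mk out _ hN h3⟩
      · intro h
        simp [List.findIdx_cons]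
      · exact (length_mask (by omega)).le
      · simp only [List.length_append, List.length_cons] at h3 h4 ⊢
        rw [add_mul, one_mul]; omega)
    w.reverse ([], [], []) (by simp)
  simp only [List.reverse_nil, List.nil_append, List.length_nil, zero_add] at h1 h2 h3 h4
  subst h1
  exact ⟨mk, out, h2, h3, h4, r.mono (by simp)⟩

/-- The second pass writes the matrix. -/
theorem cyclePass_second (w mk : List Bool) (hmk : true ∈ w → mk = mask w.length (w.findIdx id))
    (hmk' : mk.length ≤ w.length) :
    ∃ mk' : List Bool, mk'.length ≤ w.length ∧
      Runs .cyclePass (stk (a0::a1::a2::a3::a4::a5::w.reverse::[]::mk::[]::a10::[]::rest))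
        (stk (a0::a1::a2::a3::a4::a5::[]::w::mk'::cycBits w::a10::[]::rest))
        ((20 * w.length + 13) * w.length + 1) := by
  obtain ⟨⟨pr, mk, out⟩, ⟨h1, h2, h3, h4⟩, r⟩ := Runs.forBits_inv (x := 6)
    (fun l (a : List Bool × List Bool × List Bool) =>
      stk (a0::a1::a2::a3::a4::a5::l::a.1::a.2.1::a.2.2::a10::[]::rest))
    (fun l a => w = l.reverse ++ a.1 ∧
      (true ∈ w → a.2.1 = mask w.length
        (if true ∈ a.1 then l.length + a.1.findIdx id else w.findIdx id)) ∧
      a.2.1.length ≤ w.length ∧ a.2.2 = (List.range' l.length a.1.length).flatMap (cycRow w))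
    (20 * w.length + 10) (fun _ _ => rfl) (fun _ _ _ => update_stk (by simp) _)
    (fun l ⟨pr, mk, out⟩ ⟨h1, h2, h3, h4⟩ => by
      have hN : l.length + pr.length + 1 = w.length := by rw [h1]; simp; omega
      refine ⟨(false :: pr, mk, List.replicate w.length false ++ out), ⟨by simp [h1], ?_, h3, ?_⟩,
        cyclePass_false _ _ _ _ _ _ _ _ l pr mk out _ hN⟩
      · intro h
        rw [h2 h, findIdx_cons_false]
        simp only [List.length_cons, List.mem_cons, Bool.true_eq_false, false_or]
        congr 1; split <;> omega
      · simp only [List.length_cons] at h4 ⊢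
        rw [List.range'_succ, List.flatMap_cons, h4]
        congr 1
        have : w[l.length]? = some false := by rw [h1]; simp
        simp [cycRow, this])
    (fun l ⟨pr, mk, out⟩ ⟨h1, h2, h3, h4⟩ => by
      have hN : l.length + pr.length + 1 = w.length := by rw [h1]; simp; omega
      refine ⟨(true :: pr, mask w.length l.length, mk ++ out), ⟨by simp [h1], ?_, ?_, ?_⟩,
        cyclePass_true _ _ _ _ _ _ _ _ l pr mk out _ hN h3⟩
      · intro h
        simp [List.findIdx_cons]
      · exact (length_mask (by omega)).le
      · simp only [List.length_cons] at h2 h4 ⊢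
        rw [List.range'_succ, List.flatMap_cons, h4]
        congr 1
        have h5 : w[l.length]? = some true := by rw [h1]; simp
        have h6 : w.drop (l.length + 1) = pr := by
          rw [h1, List.reverse_cons, List.append_assoc, ← List.drop_drop, List.drop_left' (by simp)]
          rfl
        rw [h2 (List.mem_of_getElem? h5)]
        simp only [cycRow, h5, if_true, nextPos, h6])
    w.reverse ([], mk, []) (by simpa using ⟨hmk, hmk'⟩)
  simp only [List.reverse_nil, List.nil_append, List.length_nil, zero_add] at h1 h2 h3 h4
  subst h1
  refine ⟨mk, h3, (r.mono (by simp)).congr ?_⟩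
  simp only [h4, cycBits, List.range_eq_range']

/-- The bits of `w` are on stack 6 in reversed order, since rows are read onto a stack. -/
theorem Runs.cycle (w : List Bool) :
    Runs .cycle (stk (a0::a1::a2::a3::a4::a5::w.reverse::[]::[]::[]::a10::[]::rest))
      (stk (a0::a1::a2::a3::a4::a5::[]::[]::[]::cycBits w::a10::[]::rest))
      (60 * (w.length + 1) ^ 2) := by
  obtain ⟨mk, out, h1, h2, h3, r⟩ := cyclePass_first a0 a1 a2 a3 a4 a5 a10 rest w
  obtain ⟨mk', h4, r'⟩ := cyclePass_second a0 a1 a2 a3 a4 a5 a10 rest w mk h1 h2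
  rw [← List.append_nil w.reverse] at r'
  refine Runs.mono (r.seq ((Runs.clear_stk 9 (by simp)).seq
    ((Runs.move_stk (x := 7) (y := 6) (by decide) (by simp) (by simp)).seq (r'.seq
      ((Runs.clear_stk 7 (by simp)).seq (Runs.clear_stk 8 (by simp))))))) ?_
  simp
  nlinarith
end

/-! ### Decoding Hitting Set instances -/

/-- State of the automaton that reads the encoding of a Hitting Set instance: the number `n` read so
far, the phase (empty: reading `n`; top `true`: reading rows; top `false`: done), a flag that is
empty if the current row has no bit `true` yet, a nonempty list if an error has occurred, the
number of missing bits of the current row, and the rows read so far, reversed. -/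
structure Scan : Type where
  num : List Bool
  phase : List Bool
  flag : List Bool
  bad : List Bool
  missing : List Bool
  rows : List Bool

/-- Transition function of the automaton. -/
def Scan.step (s : Scan) : Bool → Scan
  | false =>
    match s.phase with
    | [] => { s with phase := true :: s.phase }
    | false :: _ => { s with bad := true :: s.bad }
    | true :: _ =>
      match s.missing with
      | [] =>
        match s.flag with
        | [] => { s with bad := true :: s.bad }
        | _ :: _ => { s with phase := false :: s.phase }
      | _ :: m => { s with missing := m, rows := false :: s.rows }
  | true =>
    match s.phase with
    | [] => { s with num := true :: s.num }
    | false :: _ => { s with bad := true :: s.bad }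
    | true :: _ =>
      match s.missing with
      | [] =>
        match s.flag with
        | [] => { s with bad := true :: s.bad }
        | _ :: f => { s with flag := f, missing := s.num, rows := true :: s.rows }
      | _ :: m => { s with flag := true :: s.flag.tail, missing := m, rows := true :: s.rows }

/-- The initial state. -/
def Scan.start : Scan := ⟨[], [], [true], [], [], []⟩

/-- A family of nonempty subsets of an `n`-element set, given by characteristic vectors. -/
def IsFamily (n : ℕ) (rows : List (List Bool)) : Prop := ∀ r ∈ rows, r.length = n ∧ true ∈ r

/-- The rows of a family, each announced by a bit `true`. -/
def joinRows (rows : List (List Bool)) : List Bool := rows.flatMap (fun r => true :: r)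

theorem scan_unary (k : ℕ) (s : Scan) (h : s.phase = []) :
    (unary k).foldl Scan.step s = { s with num := unary k ++ s.num } := by
  induction k generalizing s with
  | zero => rfl
  | succ k ih =>
    have e : unary (k + 1) = true :: unary k := rfl
    rw [e, List.foldl_cons]
    have : s.step true = { s with num := true :: s.num } := by simp [Scan.step, h]
    rw [this, ih { s with num := true :: s.num } h]
    have : unary k ++ true :: s.num = true :: (unary k ++ s.num) := by
      have : unary k ++ [true] = true :: unary k := by
        simp only [unary, ← List.replicate_succ', ← List.replicate_succ]
      rw [← List.singleton_append, ← List.append_assoc, this, List.cons_append]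
    simp [this]

theorem scan_row (r : List Bool) (s : Scan) (ph : List Bool) (h : s.phase = true :: ph)
    (hf : s.flag = [] ∨ s.flag = [true]) (hl : s.missing.length = r.length) :
    r.foldl Scan.step s =
      { s with flag := if true ∈ r then [true] else s.flag, missing := [],
               rows := r.reverse ++ s.rows } := by
  induction r generalizing s with
  | nil =>
    have : s.missing = [] := List.eq_nil_of_length_eq_zero hl
    cases s
    simp at this ⊢
    exact this
  | cons b r ih =>
    obtain ⟨c, m, hm⟩ := List.exists_cons_of_ne_nil
      (List.ne_nil_of_length_pos (l := s.missing) (by simp [hl]))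
    rw [List.foldl_cons]
    cases b with
    | false =>
      have : s.step false = { s with missing := m, rows := false :: s.rows } := by
        simp [Scan.step, h, hm]
      rw [this, ih { s with missing := m, rows := false :: s.rows } h hf (by simpa [hm] using hl)]
      simp
    | true =>
      have : s.step true = { s with flag := [true], missing := m, rows := true :: s.rows } := by
        simp only [Scan.step, h, hm]
        rcases hf with hf | hf <;> simp [hf]
      rw [this, ih { s with flag := [true], missing := m, rows := true :: s.rows } h (Or.inr rfl)
        (by simpa [hm] using hl)]
      simp

theorem scan_joinRows (n : ℕ) (rows : List (List Bool)) (hr : IsFamily n rows) (s : Scan)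
    (ph : List Bool) (h : s.phase = true :: ph) (hf : s.flag = [true])
    (hm : s.missing = []) (hn : s.num = unary n) :
    (joinRows rows).foldl Scan.step s = { s with rows := (joinRows rows).reverse ++ s.rows } := by
  induction rows generalizing s with
  | nil => simp [joinRows]
  | cons r rows ih =>
    have e : joinRows (r :: rows) = true :: (r ++ joinRows rows) := by simp [joinRows]
    have h1 : s.step true = { s with flag := [], missing := s.num, rows := true :: s.rows } := by
      simp [Scan.step, h, hf, hm]
    obtain ⟨hr1, hr2⟩ := hr r (by simp)
    rw [e, List.foldl_cons, h1, List.foldl_append,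
      scan_row r { s with flag := [], missing := s.num, rows := true :: s.rows } ph h (Or.inl rfl)
        (by simp [hn, unary, hr1]),
      ih (fun r' h' => hr r' (by simp [h']))
        { s with flag := _, missing := [], rows := r.reverse ++ true :: s.rows } h
        (by simp [hr2]) rfl hn]
    simp [hr2, hf, hm]

/-- The automaton accepts the encodings of families. -/
theorem scan_encodeRows (n : ℕ) (rows : List (List Bool)) (hr : IsFamily n rows) :
    (encodeRows n rows).foldl Scan.step Scan.start =
      ⟨unary n, [false, true], [true], [], [], (joinRows rows).reverse⟩ := by
  have e : encodeRows n rows = unary n ++ (false :: (joinRows rows ++ [false])) := rfl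
  rw [e, List.foldl_append, scan_unary _ _ rfl, List.foldl_cons, List.foldl_append]
  rw [scan_joinRows n rows hr _ [] rfl rfl rfl (by simp [Scan.start, Scan.step])]
  simp [Scan.start, Scan.step]

/-- Everything that the automaton accepts is the encoding of a family. -/
theorem scan_sound (x : List Bool) :
    ∀ s, s = x.foldl Scan.step Scan.start → s.bad = [] →
      (s.phase = [] → x = s.num ∧ ∃ n, s.num = unary n ∧ s.flag = [true] ∧ s.missing = []) ∧
      (∀ ph, s.phase = true :: ph → s.flag.length ≤ 1 ∧
        ∃ n rows, s.num = unary n ∧ IsFamily n rows ∧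
        ((s.missing = [] ∧ s.flag = [true] ∧ x = unary n ++ false :: joinRows rows) ∨
          ∃ cur : List Bool, x = unary n ++ false :: (joinRows rows ++ true :: cur) ∧
            cur.length + s.missing.length = n ∧ (s.flag = [] ∨ true ∈ cur))) ∧
      (∀ ph, s.phase = false :: ph → ∃ n rows, IsFamily n rows ∧ x = encodeRows n rows) := by
  induction x using List.reverseRecOn with
  | nil =>
    rintro s rfl _
    refine ⟨fun _ => ⟨rfl, 0, rfl, rfl, rfl⟩, ?_, ?_⟩ <;> simp [Scan.start]
  | append_singleton x b ih =>
    intro s hs hb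
    rw [List.foldl_append] at hs
    obtain ⟨t, ht⟩ : ∃ t, t = x.foldl Scan.step Scan.start := ⟨_, rfl⟩
    rw [← ht] at hs
    simp only [List.foldl_cons, List.foldl_nil] at hs
    have ih := ih t ht
    have joinRows_snoc : ∀ (rows : List (List Bool)) (r : List Bool),
        joinRows (rows ++ [r]) = joinRows rows ++ true :: r := by
      intro rows r; simp [joinRows]
    have fam_snoc : ∀ n (rows : List (List Bool)) (r : List Bool), IsFamily n rows →
        r.length = n → true ∈ r → IsFamily n (rows ++ [r]) := by
      intro n rows r h1 h2 h3 r' h'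
      rcases List.mem_append.1 h' with h' | h'
      · exact h1 r' h'
      · rw [List.mem_singleton.1 h']; exact ⟨h2, h3⟩
    match hp : t.phase with
    | [] =>
      cases b with
      | false =>
        have e : s = { t with phase := true :: t.phase } := by rw [hs]; simp [Scan.step, hp]
        subst e
        obtain ⟨h1, n, h2, h3, h4⟩ := (ih hb).1 hp
        refine ⟨by simp, ?_, by simp⟩
        rintro ph -
        refine ⟨by simp [h3], n, [], h2, by simp [IsFamily], Or.inl ⟨h4, h3, ?_⟩⟩
        simp [h1, h2, joinRows]
      | true =>
        have e : s = { t with num := true :: t.num } := by rw [hs]; simp [Scan.step, hp]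
        subst e
        obtain ⟨h1, n, h2, h3, h4⟩ := (ih hb).1 hp
        refine ⟨?_, by simp [hp], by simp [hp]⟩
        rintro -
        refine ⟨?_, n + 1, by simp [h2, unary, List.replicate_succ], h3, h4⟩
        rw [h1, h2]
        simp only [unary, ← List.replicate_succ', ← List.replicate_succ]
    | false :: ph =>
      have e : s = { t with bad := true :: t.bad } := by rw [hs]; cases b <;> simp [Scan.step, hp]
      rw [e] at hb
      simp at hb
    | true :: ph =>
      match hm : t.missing with
      | [] =>
        match hf : t.flag with
        | [] =>
          have e : s = { t with bad := true :: t.bad } := by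
            rw [hs]; cases b <;> simp [Scan.step, hp, hm, hf]
          rw [e] at hb
          simp at hb
        | c :: f =>
          have hgood : t.bad = [] → f = [] ∧ ∃ n rows, t.num = unary n ∧ IsFamily n rows ∧
              x = unary n ++ false :: joinRows rows := by
            intro hb
            obtain ⟨h0, n, rows, h1, h2, h3⟩ := (ih hb).2.1 ph hp
            refine ⟨by simpa [hf] using h0, ?_⟩
            rcases h3 with ⟨_, _, h3⟩ | ⟨cur, h3, h4, h5⟩
            · exact ⟨n, rows, h1, h2, h3⟩
            · refine ⟨n, rows ++ [cur], h1, fam_snoc _ _ _ h2 (by simpa [hm] using h4) ?_, ?_⟩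
              · simpa [hf] using h5
              · rw [joinRows_snoc, h3]
          cases b with
          | false =>
            have e : s = { t with phase := false :: t.phase } := by
              rw [hs]; simp [Scan.step, hp, hm, hf]
            subst e
            obtain ⟨h0, n, rows, h1, h2, h3⟩ := hgood hb
            refine ⟨by simp, by simp, ?_⟩
            rintro ph' -
            refine ⟨n, rows, h2, ?_⟩
            simp [encodeRows, h3, joinRows]
          | true =>
            have e : s = { t with flag := f, missing := t.num, rows := true :: t.rows } := by
              rw [hs]; simp [Scan.step, hp, hm, hf]
            subst e
            obtain ⟨h0, n, rows, h1, h2, h3⟩ := hgood hb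
            refine ⟨by simp [hp], ?_, by simp [hp]⟩
            rintro ph' -
            refine ⟨by simp [h0], n, rows, h1, h2, Or.inr ⟨[], ?_, ?_, Or.inl h0⟩⟩
            · simp [h3]
            · simp [h1, unary]
      | c :: m =>
        have hgood : t.bad = [] → t.flag.length ≤ 1 ∧ ∃ n rows, t.num = unary n ∧
            IsFamily n rows ∧ ∃ cur : List Bool, x = unary n ++ false ::
              (joinRows rows ++ true :: cur) ∧
            cur.length + (m.length + 1) = n ∧ (t.flag = [] ∨ true ∈ cur) := by
          intro hb
          obtain ⟨h0, n, rows, h1, h2, h3⟩ := (ih hb).2.1 ph hp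
          refine ⟨h0, ?_⟩
          rcases h3 with ⟨h3, _, _⟩ | ⟨cur, h3, h4, h5⟩
          · simp [hm] at h3
          · exact ⟨n, rows, h1, h2, cur, h3, by simpa [hm] using h4, h5⟩
        cases b with
        | false =>
          have e : s = { t with missing := m, rows := false :: t.rows } := by
            rw [hs]; simp [Scan.step, hp, hm]
          subst e
          obtain ⟨h0, n, rows, h1, h2, cur, h3, h4, h5⟩ := hgood hb
          refine ⟨by simp [hp], ?_, by simp [hp]⟩
          rintro ph' -
          refine ⟨h0, n, rows, h1, h2, Or.inr ⟨cur ++ [false], by simp [h3], ?_, by simpa using h5⟩⟩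
          simp; omega
        | true =>
          have e : s = { t with flag := true :: t.flag.tail, missing := m, rows := true ::
            t.rows } := by
            rw [hs]; simp [Scan.step, hp, hm]
          subst e
          obtain ⟨h0, n, rows, h1, h2, cur, h3, h4, h5⟩ := hgood hb
          refine ⟨by simp [hp], ?_, by simp [hp]⟩
          rintro ph' -
          refine ⟨by simp; omega, n, rows, h1, h2, Or.inr
            ⟨cur ++ [true], by simp [h3], ?_, by simp⟩⟩
          simp; omega

/-- The family `rows` of subsets of an `n`-element set has a hitting set of size at most `k`. -/
def HasHittingSet (n : ℕ) (rows : List (List Bool)) (k : ℕ) : Prop :=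
  ∃ H : Finset (Fin n), H.card ≤ k ∧ ∀ r ∈ rows, ∃ i ∈ H, r[(i : ℕ)]? = some true

theorem unary_append_false_inj {n n' : ℕ} {l l' : List Bool}
    (h : unary n ++ false :: l = unary n' ++ false :: l') : n = n' ∧ l = l' := by
  induction n generalizing n' with
  | zero => cases n' <;> simp_all [unary, List.replicate_succ]
  | succ n ih =>
    cases n' with
    | zero => simp [unary, List.replicate_succ] at h
    | succ n' =>
      simp only [unary, List.replicate_succ, List.cons_append, List.cons.injEq, true_and] at h
      obtain ⟨rfl, h2⟩ := ih (by simpa [unary] using h)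
      exact ⟨rfl, h2⟩

theorem joinRows_append_false_inj {m : ℕ} {rows rows' : List (List Bool)} {e e' : List Bool}
    (hr : ∀ r ∈ rows, r.length = m) (hr' : ∀ r ∈ rows', r.length = m)
    (h : joinRows rows ++ false :: e = joinRows rows' ++ false :: e') : rows = rows' := by
  induction rows generalizing rows' with
  | nil => cases rows' <;> simp_all [joinRows]
  | cons r rows ih =>
    cases rows' with
    | nil => simp [joinRows] at h
    | cons r' rows' =>
      simp only [joinRows, List.flatMap_cons, List.cons_append, List.append_assoc,
        List.cons.injEq, true_and] at h
      have h1 := List.append_inj h ((hr r (by simp)).trans (hr' r' (by simp)).symm)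
      rw [h1.1, ih (fun r h => hr r (by simp [h])) (fun r h => hr' r (by simp [h])) h1.2]

/-- Encodings can be decoded, if the lengths of the rows are a function of the number `n`. -/
theorem encodeRows_inj (f : ℕ → ℕ) {n n' : ℕ} {rows rows' : List (List Bool)}
    (hr : ∀ r ∈ rows, r.length = f n) (hr' : ∀ r ∈ rows', r.length = f n')
    (h : encodeRows n rows = encodeRows n' rows') : n = n' ∧ rows = rows' := by
  obtain ⟨rfl, h2⟩ := unary_append_false_inj h
  exact ⟨rfl, joinRows_append_false_inj hr hr' h2⟩

theorem mem_hittingSet_iff (x : List Bool) (k : ℕ) :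
    (x, k) ∈ hittingSet ↔
      ∃ n rows, IsFamily n rows ∧ x = encodeRows n rows ∧ HasHittingSet n rows k := by
  constructor
  · rintro ⟨n, F, hx, H, hH, hF⟩
    refine ⟨n, _, ?_, hx, H, hH, ?_⟩
    · intro r hr
      obtain ⟨A, hA, rfl⟩ := List.mem_map.1 hr
      obtain ⟨i, hi⟩ := hF A hA
      refine ⟨by simp, ?_⟩
      simp only [List.mem_ofFn, decide_eq_true_eq]
      exact ⟨i, (Finset.mem_inter.1 hi).1⟩
    · intro r hr
      obtain ⟨A, hA, rfl⟩ := List.mem_map.1 hr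
      obtain ⟨i, hi⟩ := hF A hA
      obtain ⟨h1, h2⟩ := Finset.mem_inter.1 hi
      exact ⟨i, h2, by simp [h1]⟩
  · rintro ⟨n, rows, hr, hx, H, hH, hF⟩
    refine ⟨n, rows.map fun r => Finset.univ.filter fun j : Fin n => r[(j : ℕ)]? = some true, ?_,
      H, hH, ?_⟩
    · simp only at hx ⊢
      rw [hx, List.map_map]
      congr 1
      rw [eq_comm]
      refine (List.map_congr_left fun r h => ?_).trans (List.map_id rows)
      obtain ⟨rfl, -⟩ := hr r h
      refine List.ext_getElem (by simp) fun i h1 h2 => ?_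
      simp only [List.length_ofFn, Function.comp] at h1
      simp
    · intro A hA
      obtain ⟨r, h, rfl⟩ := List.mem_map.1 hA
      obtain ⟨i, h1, h2⟩ := hF r h
      exact ⟨i, by simp [h1, h2]⟩

theorem mem_hittingSet_encodeRows {n : ℕ} {rows : List (List Bool)} (hr : IsFamily n rows) (k : ℕ) :
    (encodeRows n rows, k) ∈ hittingSet ↔ HasHittingSet n rows k := by
  rw [mem_hittingSet_iff]
  constructor
  · rintro ⟨n', rows', hr', h, hk⟩
    obtain ⟨rfl, rfl⟩ := encodeRows_inj id (fun r h => (hr r h).1) (fun r h => (hr' r h).1) h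
    exact hk
  · exact fun h => ⟨n, rows, hr, rfl, h⟩

namespace Prog

/-- Transition of the automaton for a bit `false`; stacks 2, 4, 5, 6, 10, 3 hold the components of
its state. -/
def scanFalse : Prog :=
  .branch 4 (.push 4 true) (.push 6 true)
    (.branch 10 (.branch 5 (.push 6 true) (.push 4 false) (.push 4 false))
      (.seq (.pop 10) (.push 3 false)) (.seq (.pop 10) (.push 3 false)))

/-- Transition of the automaton for a bit `true`. -/
def scanTrue : Prog :=
  .branch 4 (.push 2 true) (.push 6 true)
    (.branch 10
      (.branch 5 (.push 6 true)
        (.seq (.pop 5) (.seq (.push 3 true) (copy 2 10 11)))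
        (.seq (.pop 5) (.seq (.push 3 true) (copy 2 10 11))))
      (.seq (.pop 10) (.seq (.push 3 true) (.seq (.pop 5) (.push 5 true))))
      (.seq (.pop 10) (.seq (.push 3 true) (.seq (.pop 5) (.push 5 true)))))

/-- Accept the instance: tidy up and restore the order of the rows. -/
def keepInstance : Prog :=
  .seq (clear 4) (.seq (clear 5) (.seq (move 3 11) (.seq (move 11 12) (move 12 3))))

/-- Replace the instance by the no-instance that consists of a one-element set and the parameter
`0`. -/
def replaceInstance : Prog :=
  .seq (clear 1) (.seq (clear 2) (.seq (clear 3) (.seq (clear 4) (.seq (clear 5) (.seq (clear 6)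
    (.seq (clear 10) (.seq (.push 2 true) (.seq (.push 3 true) (.push 3 true)))))))))

/-- Decode a Hitting Set instance; instances that are malformed or contain the empty set are
replaced by a fixed no-instance. -/
def decode : Prog :=
  .seq (.seq (.push 5 true) (forBits 0 scanFalse scanTrue))
    (.branch 6 (.branch 4 replaceInstance keepInstance replaceInstance)
      replaceInstance replaceInstance)

end Prog

section
variable (a7 a8 a9 : List Bool) (rest : List (List Bool))

/-- The stacks while the automaton is running. -/
def scanStk (k l : List Bool) (s : Scan) : Stacks :=
  stk (l::k::s.num::s.rows::s.phase::s.flag::s.bad::a7::a8::a9::s.missing::[]::[]::rest)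

theorem scanFalse_runs (k l : List Bool) (s : Scan) :
    Runs .scanFalse (scanStk a7 a8 a9 rest k l s) (scanStk a7 a8 a9 rest k l (s.step false))
      (9 * s.num.length + 20) := by
  obtain ⟨num, phase, flag, bad, missing, rows⟩ := s
  match phase with
  | [] =>
    exact (Runs.branch_nil rfl (Runs.push_stk 4 true (by simp))).mono (by omega)
  | false :: _ =>
    exact (Runs.branch_false rfl (Runs.push_stk 6 true (by simp))).mono (by omega)
  | true :: _ =>
    match missing with
    | [] =>
      match flag with
      | [] =>
        exact (Runs.branch_true rfl (Runs.branch_nil rfl (Runs.branch_nil rfl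
          (Runs.push_stk 6 true (by simp))))).mono (by omega)
      | false :: _ =>
        exact (Runs.branch_true rfl (Runs.branch_nil rfl (Runs.branch_false rfl
          (Runs.push_stk 4 false (by simp))))).mono (by omega)
      | true :: _ =>
        exact (Runs.branch_true rfl (Runs.branch_nil rfl (Runs.branch_true rfl
          (Runs.push_stk 4 false (by simp))))).mono (by omega)
    | false :: _ =>
      exact (Runs.branch_true rfl (Runs.branch_false rfl ((Runs.pop_stk 10 (by simp)).seq
        (Runs.push_stk 3 false (by simp))))).mono (by omega)
    | true :: _ =>
      exact (Runs.branch_true rfl (Runs.branch_true rfl ((Runs.pop_stk 10 (by simp)).seq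
        (Runs.push_stk 3 false (by simp))))).mono (by omega)

theorem scanTrue_runs (k l : List Bool) (s : Scan) :
    Runs .scanTrue (scanStk a7 a8 a9 rest k l s) (scanStk a7 a8 a9 rest k l (s.step true))
      (9 * s.num.length + 20) := by
  obtain ⟨num, phase, flag, bad, missing, rows⟩ := s
  match phase with
  | [] =>
    exact (Runs.branch_nil rfl (Runs.push_stk 2 true (by simp))).mono (by omega)
  | false :: _ =>
    exact (Runs.branch_false rfl (Runs.push_stk 6 true (by simp))).mono (by omega)
  | true :: ph =>
    match missing with
    | [] =>
      have copy_num : ∀ (b : Bool) (f : List Bool), Runs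
          (.seq (.pop 5) (.seq (.push 3 true) (.copy 2 10 11)))
          (scanStk a7 a8 a9 rest k l ⟨num, true :: ph, b :: f, bad, [], rows⟩)
          (scanStk a7 a8 a9 rest k l ⟨num, true :: ph, f, bad, num, true :: rows⟩)
          (9 * num.length + 4) := by
        intro b f
        refine (((Runs.pop_stk 5 (by simp)).seq ((Runs.push_stk 3 true (by simp)).seq
          (Runs.copy_stk (x := 2) (y := 10) (t := 11) (by decide) (by decide) (by decide)
            (by simp) rfl))).mono ?_).congr ?_
        · simp; omega
        · simp [scanStk]
      match flag with
      | [] =>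
        exact (Runs.branch_true rfl (Runs.branch_nil rfl (Runs.branch_nil rfl
          (Runs.push_stk 6 true (by simp))))).mono (by omega)
      | false :: f =>
        exact (Runs.branch_true rfl (Runs.branch_nil rfl (Runs.branch_false rfl
          (copy_num false f)))).mono (by show _ ≤ 9 * num.length + 20; omega)
      | true :: f =>
        exact (Runs.branch_true rfl (Runs.branch_nil rfl (Runs.branch_true rfl
          (copy_num true f)))).mono (by show _ ≤ 9 * num.length + 20; omega)
    | false :: _ =>
      exact (Runs.branch_true rfl (Runs.branch_false rfl ((Runs.pop_stk 10 (by simp)).seq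
        ((Runs.push_stk 3 true (by simp)).seq ((Runs.pop_stk 5 (by simp)).seq
          (Runs.push_stk 5 true (by simp))))))).mono (by omega)
    | true :: _ =>
      exact (Runs.branch_true rfl (Runs.branch_true rfl ((Runs.pop_stk 10 (by simp)).seq
        ((Runs.push_stk 3 true (by simp)).seq ((Runs.pop_stk 5 (by simp)).seq
          (Runs.push_stk 5 true (by simp))))))).mono (by omega)

theorem scan_length (x : List Bool) (s : Scan) (hs : s = x.foldl Scan.step Scan.start) :
    s.num.length ≤ x.length ∧ s.phase.length ≤ x.length ∧ s.flag.length ≤ x.length + 1 ∧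
      s.bad.length ≤ x.length ∧ s.missing.length ≤ x.length ∧ s.rows.length ≤ x.length := by
  induction x using List.reverseRecOn generalizing s with
  | nil => subst hs; simp [Scan.start]
  | append_singleton x b ih =>
    rw [List.foldl_append] at hs
    have ih := ih _ rfl
    generalize x.foldl Scan.step Scan.start = t at hs ih
    obtain ⟨num, phase, flag, bad, missing, rows⟩ := t
    simp only [List.foldl_cons, List.foldl_nil] at hs ih
    subst hs
    simp only [List.length_append, List.length_singleton]
    cases b with
    | false =>
      match phase with
      | [] => simp [Scan.step]; simp at ih; omega
      | false :: _ => simp [Scan.step]; simp at ih; omega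
      | true :: _ =>
        match missing with
        | [] =>
          match flag with
          | [] => simp [Scan.step]; simp at ih; omega
          | _ :: _ => simp [Scan.step]; simp at ih; omega
        | _ :: _ => simp [Scan.step]; simp at ih; omega
    | true =>
      match phase with
      | [] => simp [Scan.step]; simp at ih; omega
      | false :: _ => simp [Scan.step]; simp at ih; omega
      | true :: _ =>
        match missing with
        | [] =>
          match flag with
          | [] => simp [Scan.step]; simp at ih; omega
          | _ :: _ => simp [Scan.step]; simp at ih; omega
        | _ :: _ => simp [Scan.step]; simp at ih; omega

theorem Runs.replaceInstance (k : List Bool) (s : Scan) (N : ℕ) (hk : k.length ≤ N)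
    (h : s.num.length ≤ N ∧ s.phase.length ≤ N ∧ s.flag.length ≤ N + 1 ∧
      s.bad.length ≤ N ∧ s.missing.length ≤ N ∧ s.rows.length ≤ N) :
    Runs .replaceInstance (scanStk a7 a8 a9 rest k [] s)
      (stk ([]::unary 0::unary 1::joinRows [[true]]::[]::[]::[]::a7::a8::a9::[]::[]::[]::rest))
      (14 * N + 20) := by
  refine ((Runs.clear_stk 1 (by simp)).seq ((Runs.clear_stk 2 (by simp)).seq
    ((Runs.clear_stk 3 (by simp)).seq ((Runs.clear_stk 4 (by simp)).seq
    ((Runs.clear_stk 5 (by simp)).seq ((Runs.clear_stk 6 (by simp)).seq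
    ((Runs.clear_stk 10 (by simp)).seq ((Runs.push_stk 2 true (by simp)).seq
    ((Runs.push_stk 3 true (by simp)).seq (Runs.push_stk 3 true (by simp))))))))))).mono ?_
  simp
  omega

theorem Runs.keepInstance (k num rows phase flag : List Bool) :
    Runs .keepInstance (scanStk a7 a8 a9 rest k [] ⟨num, phase, flag, [], [], rows⟩)
      (stk ([]::k::num::rows.reverse::[]::[]::[]::a7::a8::a9::[]::[]::[]::rest))
      (2 * phase.length + 2 * flag.length + 12 * rows.length + 10) := by
  refine (((Runs.clear_stk 4 (by simp)).seq ((Runs.clear_stk 5 (by simp)).seq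
    ((Runs.move_stk (x := 3) (y := 11) (by decide) (by simp) (by simp)).seq
    ((Runs.move_stk (x := 11) (y := 12) (by decide) (by simp) (by simp)).seq
    (Runs.move_stk (x := 12) (y := 3) (by decide) (by simp) (by simp)))))).mono ?_).congr ?_
  · simp
    omega
  · simp

/-- Every instance of Hitting Set is brought into the form of a family of nonempty sets. -/
theorem Runs.decode (x : List Bool) (k : ℕ) :
    ∃ n rows k', IsFamily n rows ∧ k' ≤ k ∧ n ≤ x.length + 1 ∧
      (joinRows rows).length ≤ x.length + 2 ∧ ((x, k) ∈ hittingSet ↔ HasHittingSet n rows k') ∧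
      Runs .decode (stk (x::unary k::[]::[]::[]::[]::[]::a7::a8::a9::[]::[]::[]::rest))
        (stk ([]::unary k'::unary n::joinRows rows::[]::[]::[]::a7::a8::a9::[]::[]::[]::rest))
        (100 * (x.length + k + 1) ^ 2) := by
  have hlen := scan_length x _ rfl
  have hsound := scan_sound x _ rfl
  have r : Runs (.seq (.push 5 true) (.forBits 0 .scanFalse .scanTrue))
      (stk (x::unary k::[]::[]::[]::[]::[]::a7::a8::a9::[]::[]::[]::rest))
      (scanStk a7 a8 a9 rest (unary k) [] (x.foldl Scan.step Scan.start))
      (1 + ((9 * x.length + 20 + 3) * x.length + 1)) := by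
    refine (Runs.push_stk 5 true (by simp)).seq
      (Runs.forBits_fold (x := 0) (fun l s => scanStk a7 a8 a9 rest (unary k) l s) Scan.step
        (9 * x.length + 20) (fun _ _ => rfl) (fun _ _ _ => update_stk (by simp) _) x Scan.start
        (fun l₁ l₂ e => (scanFalse_runs a7 a8 a9 rest _ _ _).mono ?_)
        (fun l₁ l₂ e => (scanTrue_runs a7 a8 a9 rest _ _ _).mono ?_))
    all_goals
      have h1 := (scan_length l₁ _ rfl).1
      have h2 : l₁.length ≤ x.length := by rw [e]; simp
      omega
  have hno : ¬ HasHittingSet 1 [[true]] 0 := by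
    rintro ⟨H, hH, h⟩
    obtain ⟨i, hi, -⟩ := h [true] (by simp)
    have : H = ∅ := Finset.card_eq_zero.1 (by omega)
    simp [this] at hi
  by_cases hgood : ∃ n rows, IsFamily n rows ∧ x = encodeRows n rows
  · obtain ⟨n, rows, hr, hx⟩ := hgood
    have hl : x.length = n + (joinRows rows).length + 2 := by
      rw [hx]; simp [encodeRows, joinRows, unary]; omega
    refine ⟨n, rows, k, hr, le_rfl, by omega, by omega, ?_, ?_⟩
    · rw [hx]; exact mem_hittingSet_encodeRows hr k
    · have h1 := scan_encodeRows n rows hr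
      rw [← hx] at h1
      rw [h1] at r
      refine ((r.seq (Runs.branch_nil rfl (Runs.branch_false rfl
        (Runs.keepInstance a7 a8 a9 rest (unary k) _ _ _ _)))).mono ?_).congr ?_
      · have h2 : (x.length + 1) ^ 2 ≤ (x.length + k + 1) ^ 2 := by gcongr; omega
        simp only [List.length_cons, List.length_nil, List.length_reverse]
        nlinarith [h2, hl]
      · simp
  · have hr : IsFamily 1 [[true]] := by simp [IsFamily]
    refine ⟨1, [[true]], 0, hr, by simp, by simp, by simp [joinRows], ?_, ?_⟩
    · refine iff_of_false (fun h => hgood ?_) hno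
      obtain ⟨n, rows, h1, h2, -⟩ := (mem_hittingSet_iff x k).1 h
      exact ⟨n, rows, h1, h2⟩
    · generalize x.foldl Scan.step Scan.start = s at *
      have hrep := Runs.replaceInstance a7 a8 a9 rest (unary k) s (x.length + k) (by simp [unary])
        (by omega)
      have hbound : 1 + ((9 * x.length + 20 + 3) * x.length + 1) +
          (14 * (x.length + k) + 20 + 1 + 1) ≤ 100 * (x.length + k + 1) ^ 2 := by nlinarith
      obtain ⟨num, phase, flag, bad, missing, rows⟩ := s
      match bad with
      | false :: _ => exact (r.seq (Runs.branch_false rfl hrep)).mono (by omega)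
      | true :: _ => exact (r.seq (Runs.branch_true rfl hrep)).mono (by omega)
      | [] =>
        match phase with
        | [] => exact (r.seq (Runs.branch_nil rfl (Runs.branch_nil rfl hrep))).mono hbound
        | true :: _ => exact (r.seq (Runs.branch_nil rfl (Runs.branch_true rfl hrep))).mono hbound
        | false :: ph => exact absurd ((hsound rfl).2.2 ph rfl) hgood
end

/-! ### Cycles and feedback vertex sets -/

/-- A graph is a forest if its vertices can be ordered so that every vertex has at most one smaller
neighbour. -/
theorem isAcyclic_of_order {V : Type*} (G : SimpleGraph V) (h : V → ℕ)
    (hne : ∀ u v, G.Adj u v → h u ≠ h v)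
    (h1 : ∀ v u u', G.Adj v u → G.Adj v u' → h u < h v → h u' < h v → u = u') : G.IsAcyclic := by
  classical
  intro v c hc
  obtain ⟨m, hm, hmax⟩ := c.support.toFinset.exists_max_image h ⟨v, by simp⟩
  rw [List.mem_toFinset] at hm
  have hc' := hc.rotate hm
  have hle : ∀ u ∈ (c.rotate m hm).support, h u ≤ h m := by
    intro u hu
    refine hmax u ?_
    rw [List.mem_toFinset]
    exact (SimpleGraph.Walk.mem_support_rotate_iff c m hm).1 hu
  have hnil := hc'.not_nil
  have a1 := (c.rotate m hm).adj_snd hnil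
  have a2 := (c.rotate m hm).adj_penultimate hnil
  exact hc'.snd_ne_penultimate (h1 m _ _ a1 a2.symm
    (lt_of_le_of_ne (hle _ (SimpleGraph.Walk.getVert_mem_support _ _)) (hne _ _ a1).symm)
    (lt_of_le_of_ne (hle _ (SimpleGraph.Walk.getVert_mem_support _ _)) (hne _ _ a2)))

/-- Bit `j` of `w` is present and equal to `true`. -/
def IsOn (w : List Bool) (j : ℕ) : Prop := w[j]? = some true

theorem IsOn.lt {w : List Bool} {j : ℕ} (h : IsOn w j) : j < w.length :=
  (List.getElem?_eq_some_iff.1 h).1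

theorem isOn_findIdx {w : List Bool} (h : true ∈ w) :
    IsOn w (w.findIdx id) ∧ ∀ j < w.findIdx id, ¬ IsOn w j := by
  have hlt : w.findIdx id < w.length := List.findIdx_lt_length_of_exists ⟨true, h, rfl⟩
  refine ⟨?_, fun j hj hon => ?_⟩
  · have := List.findIdx_getElem (w := hlt)
    unfold IsOn
    rw [List.getElem?_eq_getElem hlt]
    simpa using this
  · have := List.not_of_lt_findIdx hj
    obtain ⟨h1, h2⟩ := List.getElem?_eq_some_iff.1 hon
    simp [h2] at this

/-- There is no further bit `true` on the way from `u` to `v`. -/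
def IsNext (w : List Bool) (u v : ℕ) : Prop :=
  IsOn w v ∧ ((u < v ∧ ∀ j, u < j → j < v → ¬ IsOn w j) ∨
    (v ≤ u ∧ (∀ j, u < j → ¬ IsOn w j) ∧ ∀ j < v, ¬ IsOn w j))

theorem isOn_drop {w : List Bool} {i j : ℕ} : IsOn (w.drop i) j ↔ IsOn w (i + j) := by
  simp [IsOn]

theorem isNext_nextPos {w : List Bool} {u : ℕ} (hu : IsOn w u) : IsNext w u (nextPos w u) := by
  unfold nextPos
  split
  · rename_i h
    obtain ⟨h1, h2⟩ := isOn_findIdx h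
    refine ⟨isOn_drop.1 h1, Or.inl ⟨by omega, fun j hj hj' hon => ?_⟩⟩
    refine h2 (j - (u + 1)) (by omega) (isOn_drop.2 ?_)
    rwa [show u + 1 + (j - (u + 1)) = j by omega]
  · rename_i h
    obtain ⟨h1, h2⟩ := isOn_findIdx (List.mem_of_getElem? hu)
    have hlast : ∀ j, u < j → ¬ IsOn w j := by
      intro j hj hon
      apply h
      have : IsOn (w.drop (u + 1)) (j - (u + 1)) := isOn_drop.2 (by
        rwa [show u + 1 + (j - (u + 1)) = j by omega])
      exact List.mem_of_getElem? this
    refine ⟨h1, Or.inr ⟨?_, hlast, h2⟩⟩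
    by_contra hlt
    exact hlast _ (not_le.1 hlt) h1

theorem IsNext.unique {w : List Bool} {u v v' : ℕ} (h : IsNext w u v) (h' : IsNext w u v') :
    v = v' := by
  obtain ⟨h1, h2⟩ := h
  obtain ⟨h1', h2'⟩ := h'
  rcases h2 with ⟨h2, h3⟩ | ⟨h2, h3, h4⟩ <;> rcases h2' with ⟨h2', h3'⟩ | ⟨h2', h3', h4'⟩
  · rcases lt_trichotomy v v' with h | h | h
    · exact absurd h1 (h3' v h2 h)
    · exact h
    · exact absurd h1' (h3 v' h2' h)
  · exact absurd h1 (h3' v h2)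
  · exact absurd h1' (h3 v' h2')
  · rcases lt_trichotomy v v' with h | h | h
    · exact absurd h1 (h4' v h)
    · exact h
    · exact absurd h1' (h4 v' h)

theorem nextPos_eq_iff {w : List Bool} {u v : ℕ} (hu : IsOn w u) :
    nextPos w u = v ↔ IsNext w u v :=
  ⟨fun h => h ▸ isNext_nextPos hu, fun h => (isNext_nextPos hu).unique h⟩

theorem IsNext.unique_left {w : List Bool} {u u' v : ℕ} (hu : IsOn w u) (hu' : IsOn w u')
    (h : IsNext w u v) (h' : IsNext w u' v) : u = u' := by
  obtain ⟨h1, h2⟩ := h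
  obtain ⟨h1', h2'⟩ := h'
  rcases h2 with ⟨h2, h3⟩ | ⟨h2, h3, h4⟩ <;> rcases h2' with ⟨h2', h3'⟩ | ⟨h2', h3', h4'⟩
  · rcases lt_trichotomy u u' with h | h | h
    · exact absurd hu' (h3 u' h h2')
    · exact h
    · exact absurd hu (h3' u h h2)
  · exact absurd hu (h4' u h2)
  · exact absurd hu' (h4 u' h2')
  · rcases lt_trichotomy u u' with h | h | h
    · exact absurd hu' (h3 u' h)
    · exact h
    · exact absurd hu (h3' u h)

/-- The matrix of the cycle through the positions of the bits `true` of `w`, as a sample point: each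
vertex of the cycle has an entry for its successor only, as `graphOf` symmetrizes the matrix. -/
def cycMatrix (N : ℕ) (w : List Bool) : Fin (N * N) → Bool :=
  fun i => decide (w[(i : ℕ) / N]? = some true ∧ (i : ℕ) % N = nextPos w (i / N))

theorem getElem_mask (N p i : ℕ) (hi : i < (mask N p).length) :
    (mask N p)[i] = decide (i = p) := by
  simp only [mask, List.getElem_append]
  split
  · rename_i h
    simp at h
    simp; omega
  · rename_i h
    simp at h
    rw [List.getElem_cons]
    split
    · rename_i h'; simp at h'; simp; omega
    · rename_i h'; simp at h'; simp; omega

theorem cycBits_eq {N : ℕ} {w : List Bool} (hw : w.length = N) :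
    cycBits w = List.ofFn (cycMatrix N w) := by
  subst hw
  rw [List.ofFn_mul]
  unfold cycBits
  rw [show List.range w.length = List.ofFn fun i : Fin w.length => (i : ℕ) by
    simp [List.ofFn_eq_map], List.flatMap_def, List.map_ofFn]
  congr 2
  funext u
  refine List.ext_getElem (by simp [length_cycRow]) fun v h1 h2 => ?_
  have hv : v < w.length := by simpa using h2
  have e1 : ((u : ℕ) * w.length + v) / w.length = u := by
    rw [mul_comm, Nat.mul_add_div u.pos, Nat.div_eq_of_lt hv, add_zero]
  have e2 : ((u : ℕ) * w.length + v) % w.length = v := by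
    rw [mul_comm, Nat.mul_add_mod, Nat.mod_eq_of_lt hv]
  simp only [List.getElem_ofFn, Function.comp_apply, cycMatrix, e1, e2]
  unfold cycRow
  split
  · rename_i h
    simp only [getElem_mask, h, true_and]
  · rename_i h
    simp only [h, false_and, decide_false, List.getElem_replicate]

/-- Adjacency in the graph of the matrix. -/
theorem graphOf_cycMatrix {N : ℕ} (w : List Bool) (u v : Fin N) :
    (graphOf N (cycMatrix N w)).Adj u v ↔
      u ≠ v ∧ (IsOn w u ∧ IsNext w u v ∨ IsOn w v ∧ IsNext w v u) := by
  have key : ∀ u v : Fin N, cycMatrix N w (finProdFinEquiv (u, v)) = true ↔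
      IsOn w u ∧ IsNext w u v := by
    intro u v
    have hN : 0 < N := u.pos
    have h1 : ((v : ℕ) + N * u) / N = u := by
      rw [Nat.add_mul_div_left _ _ hN, Nat.div_eq_of_lt v.2, zero_add]
    have h2 : ((v : ℕ) + N * u) % N = v := by
      rw [Nat.add_mul_mod_self_left, Nat.mod_eq_of_lt v.2]
    simp only [cycMatrix, finProdFinEquiv_apply_val, h1, h2, decide_eq_true_eq]
    constructor
    · rintro ⟨a, b⟩
      exact ⟨a, (nextPos_eq_iff a).1 b.symm⟩
    · rintro ⟨a, b⟩
      exact ⟨a, ((nextPos_eq_iff a).2 b).symm⟩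
  simp only [graphOf, SimpleGraph.fromRel_adj, key]

/-- The zero matrix belongs to the empty graph, of which every vertex set is a feedback vertex set.
-/
theorem isFVS_of_no_bits {N : ℕ} {w : List Bool} (h : true ∉ w)
    (S : Set (Fin N)) : IsFeedbackVertexSet (graphOf N (cycMatrix N w)) S := by
  have : graphOf N (cycMatrix N w) = ⊥ := by
    ext u v
    simp only [graphOf_cycMatrix, SimpleGraph.bot_adj, iff_false]
    rintro ⟨-, ⟨h1, -⟩ | ⟨h1, -⟩⟩ <;> exact h (List.mem_of_getElem? h1)
  unfold IsFeedbackVertexSet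
  rw [this]
  exact SimpleGraph.isAcyclic_bot.induce _

/-- Deleting a vertex of the cycle leaves a forest: order the other vertices as they follow the
deleted one. -/
theorem isFVS_of_hit {N : ℕ} {w : List Bool} (S : Set (Fin N)) (z : Fin N)
    (hz : z ∈ S) (hon : IsOn w z) : IsFeedbackVertexSet (graphOf N (cycMatrix N w)) S := by
  unfold IsFeedbackVertexSet
  let h : Fin N → ℕ := fun v => if (z : ℕ) < v then v - z else v + N - z
  have hdef : ∀ v : Fin N, h v = if (z : ℕ) < v then (v : ℕ) - z else v + N - z := fun _ => rfl
  have hz' : ∀ v : ↥Sᶜ, (v.1 : ℕ) ≠ z := by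
    rintro ⟨v, hv⟩ e
    exact hv (by rwa [show v = z from Fin.ext e])
  refine isAcyclic_of_order _ (fun v => h v.1) ?_ ?_
  · rintro u v huv
    have hne : (u.1 : ℕ) ≠ v.1 := fun e => huv.ne (Subtype.ext (Fin.ext e))
    have := hz' u; have := hz' v
    have := u.1.2; have := v.1.2
    simp only [hdef]
    split <;> split <;> omega
  · have key : ∀ v u : ↥Sᶜ, ((graphOf N (cycMatrix N w)).induce Sᶜ).Adj v u → h u.1 < h v.1 →
        IsOn w u.1 ∧ IsNext w u.1 v.1 := by
      intro v u hvu hlt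
      rw [SimpleGraph.comap_adj, Function.Embedding.subtype_apply, Function.Embedding.subtype_apply,
        graphOf_cycMatrix w] at hvu
      obtain ⟨hne, ⟨h1, h2, h3⟩ | h1⟩ := hvu
      · exfalso
        have hne' : (v.1 : ℕ) ≠ u.1 := fun e => hne (Fin.ext e)
        have hv := hz' v; have hu := hz' u
        have := u.1.2; have := v.1.2; have := z.2
        simp only [hdef] at hlt
        rcases h3 with ⟨h3, h4⟩ | ⟨h3, h4, h5⟩
        · have : ¬ ((v.1 : ℕ) < z ∧ (z : ℕ) < u.1) := fun ⟨a, b⟩ => h4 z a b hon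
          split at hlt <;> split at hlt <;> omega
        · have : ¬ ((v.1 : ℕ) < z) := fun a => h4 z a hon
          have : ¬ ((z : ℕ) < u.1) := fun a => h5 z a hon
          split at hlt <;> split at hlt <;> omega
      · exact h1
    intro v u u' h1 h2 h3 h4
    obtain ⟨a1, a2⟩ := key v u h1 h3
    obtain ⟨b1, b2⟩ := key v u' h2 h4
    exact Subtype.ext (Fin.ext (a2.unique_left a1 b1 b2))

/-- A feedback vertex set meets the cycle: otherwise the edge that closes the cycle is no bridge,
since its ends are connected through the other vertices. -/
theorem hit_of_isFVS {N : ℕ} {w : List Bool} (hw : w.length = N) {i j k : ℕ} (hij : i < j)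
    (hjk : j < k) (hi : IsOn w i) (hj : IsOn w j) (hk : IsOn w k) (S : Set (Fin N))
    (hS : IsFeedbackVertexSet (graphOf N (cycMatrix N w)) S) : ∃ v ∈ S, IsOn w (v : ℕ) := by
  by_contra hno
  push Not at hno
  have hmem : ∀ v : ℕ, ∀ hv : IsOn w v, (⟨v, hw ▸ hv.lt⟩ : Fin N) ∈ Sᶜ := fun v hv h => hno _ h hv
  let G := (graphOf N (cycMatrix N w)).induce Sᶜ
  let vert : ∀ v : ℕ, IsOn w v → ↥Sᶜ := fun v hv => ⟨⟨v, hw ▸ hv.lt⟩, hmem v hv⟩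
  classical
  -- the first and the last vertex of the cycle
  obtain ⟨a, ha, hamin⟩ : ∃ a, IsOn w a ∧ ∀ b, IsOn w b → a ≤ b :=
    ⟨Nat.find ⟨i, hi⟩, Nat.find_spec ⟨i, hi⟩, fun b hb => Nat.find_min' _ hb⟩
  obtain ⟨c, hc, hcmax⟩ : ∃ c, IsOn w c ∧ ∀ b, IsOn w b → b ≤ c := by
    have := Nat.findGreatest_spec (P := IsOn w) (n := w.length) hi.lt.le hi
    exact ⟨_, this, fun b hb => Nat.le_findGreatest hb.lt.le hb⟩
  have hac : a < c := lt_of_le_of_lt (hamin i hi) (lt_of_lt_of_le (hij.trans hjk) (hcmax k hk))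
  have hadj : G.Adj (vert c hc) (vert a ha) := by
    rw [SimpleGraph.comap_adj]
    refine (graphOf_cycMatrix w _ _).2 ⟨fun e => ?_, Or.inl ⟨hc, ha, Or.inr ⟨hac.le, ?_, ?_⟩⟩⟩
    · simp [vert] at e; omega
    · intro b hb hon; exact absurd (hcmax b hon) (not_le.2 hb)
    · intro b hb hon; exact absurd (hamin b hon) (not_le.2 hb)
  have hbridge := (SimpleGraph.isAcyclic_iff_forall_adj_isBridge.1 hS) hadj
  rw [SimpleGraph.isBridge_iff] at hbridge
  have reach : ∀ b : ℕ, ∀ hb : IsOn w b,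
      (G \ SimpleGraph.fromEdgeSet {s(vert c hc, vert a ha)}).Reachable (vert a ha)
        (vert b hb) := by
    intro b
    induction b using Nat.strong_induction_on with
    | _ b ih =>
      intro hb
      by_cases hab : a = b
      · subst hab; rfl
      have hlt : a < b := lt_of_le_of_ne (hamin b hb) hab
      -- the predecessor of `b` on the cycle
      obtain ⟨p, hp, hpb, hpmax⟩ : ∃ p, IsOn w p ∧ p < b ∧ ∀ q, q < b → IsOn w q → q ≤ p := by
        have := Nat.findGreatest_spec (P := IsOn w) (n := b - 1) (by omega : a ≤ b - 1) ha
        have h2 := Nat.findGreatest_le (P := IsOn w) (b - 1)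
        exact ⟨_, this, by omega, fun q hq hon => Nat.le_findGreatest (by omega) hon⟩
      refine (ih p hpb hp).trans (SimpleGraph.Adj.reachable ?_)
      rw [SimpleGraph.sdiff_adj]
      constructor
      · rw [SimpleGraph.comap_adj]
        refine (graphOf_cycMatrix w _ _).2 ⟨fun e => ?_, Or.inl ⟨hp, hb, Or.inl ⟨hpb, ?_⟩⟩⟩
        · simp [vert] at e; omega
        · intro q hq hq' hon; exact absurd (hpmax q hq' hon) (not_le.2 hq)
      · rw [SimpleGraph.fromEdgeSet_adj]
        rintro ⟨h, -⟩
        simp only [Set.mem_singleton_iff, Sym2.eq_iff, Subtype.mk.injEq, Fin.mk.injEq, vert] at h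
        have := hamin i hi
        have := hcmax k hk
        rcases h with ⟨h1, h2⟩ | ⟨h1, h2⟩
        · omega
        · have := hpmax j (by omega) hj
          omega
  exact hbridge (reach c hc).symm

/-! ### Consistency checking and Hitting Set -/

/-- The bit string that describes a finite set of vertices. -/
def bitsOf {N : ℕ} (S : Finset (Fin N)) : List Bool := List.ofFn fun v => decide (v ∈ S)

theorem fvsRep_eq {N : ℕ} (r : List Bool) (h : r.length = N) (S : Set (Fin N))
    (hv : ∀ v : Fin N, r[(v : ℕ)]? = some true ↔ v ∈ S) : fvsRep r = fvsConcept N S := by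
  subst h
  have hS : {v | r.get v = true} = S := by
    ext v
    rw [← hv v]
    simp
  unfold fvsRep
  rw [hS]

theorem fvsRep_bitsOf {N : ℕ} (S : Finset (Fin N)) :
    fvsRep (bitsOf S) = fvsConcept N (S : Set (Fin N)) :=
  fvsRep_eq _ (by simp [bitsOf]) _ fun v => by simp [bitsOf]

theorem count_bitsOf {N : ℕ} (S : Finset (Fin N)) : (bitsOf S).count true = S.card := by
  rw [bitsOf, List.ofFn_eq_map, List.count, List.countP_map, List.countP_eq_length_filter,
    ← List.toFinset_card_of_nodup ((List.nodup_finRange N).filter _)]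
  congr 1
  ext v
  simp

theorem fvsConcept_apply {N : ℕ} {S : Set (Fin N)} {c : (Fin (N * N) → Bool) → Bool}
    (h : fvsConcept N S = ⟨N * N, c⟩) (x : Fin (N * N) → Bool) :
    c x = true ↔ IsFeedbackVertexSet (graphOf N x) S := by
  unfold fvsConcept at h
  have := eq_of_heq (Sigma.mk.inj h).2
  rw [← this]
  simp

/-- A representation of a concept on `N * N` bits is a vertex set. -/
theorem exists_of_fvsRep_eq {N : ℕ} {r : List Bool} {c : (Fin (N * N) → Bool) → Bool}
    (h : fvsRep r = ⟨N * N, c⟩) :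
    ∃ S : Finset (Fin N), r = bitsOf S ∧
      ∀ x, c x = true ↔ IsFeedbackVertexSet (graphOf N x) (S : Set (Fin N)) := by
  have hl : r.length = N := Nat.mul_self_inj.1 (Sigma.mk.inj h).1
  subst hl
  have e : r = bitsOf (Finset.univ.filter fun v : Fin r.length => r[(v : ℕ)] = true) := by
    refine List.ext_getElem (by simp [bitsOf]) fun i h1 h2 => ?_
    simp [bitsOf]
  refine ⟨_, e, fun x => ?_⟩
  have h' := h
  rw [fvsRep_eq (N := r.length) r rfl
    (↑(Finset.univ.filter fun v : Fin r.length => r[(v : ℕ)] = true)) (by intro v; simp)] at h'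
  exact fvsConcept_apply h' x

/-- Bits of three copies of a row, followed by further bits. -/
theorem isOn_triple (a p : List Bool) (v : ℕ) :
    IsOn (a ++ a ++ a ++ p) v ↔
      (v < 3 * a.length ∧ IsOn a (v % a.length)) ∨
        (3 * a.length ≤ v ∧ IsOn p (v - 3 * a.length)) := by
  unfold IsOn
  have hmod : ∀ i, i < a.length → i % a.length = i := fun i h => Nat.mod_eq_of_lt h
  rcases lt_or_ge v (3 * a.length) with h | h
  · simp only [h, true_and, not_le.2 h, false_and, or_false]
    rw [List.getElem?_append_left (by simp; omega)]
    rcases lt_or_ge v a.length with h1 | h1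
    · rw [List.append_assoc, List.getElem?_append_left h1, hmod v h1]
    · rw [List.append_assoc, List.getElem?_append_right h1]
      rcases lt_or_ge v (2 * a.length) with h2 | h2
      · rw [List.getElem?_append_left (by omega), Nat.mod_eq_sub_mod h1, hmod _ (by omega)]
      · rw [List.getElem?_append_right (by omega), Nat.mod_eq_sub_mod h1,
          Nat.mod_eq_sub_mod (by omega), hmod _ (by omega)]
  · simp only [h, true_and, not_lt.2 h, false_and, false_or]
    rw [List.getElem?_append_right (by simp; omega)]
    congr! 2
    simp; omega

/-- The cycle of the `j`-th set of a family: three copies of every element, and the private vertex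
number `j` among `L + 1` further vertices. -/
def privateRow (L j : ℕ) (a : List Bool) : List Bool :=
  a ++ a ++ a ++ (List.replicate j false ++ true :: List.replicate (L - j) false)

theorem length_privateRow {L j : ℕ} (h : j ≤ L) (a : List Bool) :
    (privateRow L j a).length = 3 * a.length + L + 1 := by
  simp [privateRow]; omega

theorem isOn_privateRow {L j : ℕ} (a : List Bool) (v : ℕ) :
    IsOn (privateRow L j a) v ↔
      (v < 3 * a.length ∧ IsOn a (v % a.length)) ∨ v = 3 * a.length + j := by
  have h : ∀ i, IsOn (List.replicate j false ++ true :: List.replicate (L - j) false)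
    i ↔ i = j := by
    intro i
    unfold IsOn
    rcases lt_trichotomy i j with h | h | h
    · rw [List.getElem?_append_left (by simpa using h)]
      simp [h.ne, List.getElem?_replicate]
    · subst h
      simp
    · rw [List.getElem?_append_right (by simp; omega)]
      obtain ⟨d, rfl⟩ : ∃ d, i = j + d + 1 := ⟨i - j - 1, by omega⟩
      simp only [List.length_replicate, show j + d + 1 - j = d + 1 by omega,
        List.getElem?_cons_succ, List.getElem?_replicate]
      constructor
      · split <;> simp
      · omega
  rw [privateRow, isOn_triple, h]
  constructor
  · rintro (h | h)
    · exact Or.inl h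
    · right; omega
  · rintro (h | h)
    · exact Or.inl h
    · right; omega

theorem exists_isOn {a : List Bool} (h : true ∈ a) : ∃ i : Fin a.length, IsOn a (i : ℕ) :=
  ⟨⟨_, (isOn_findIdx h).1.lt⟩, (isOn_findIdx h).1⟩

/-- Three copies of a nonempty set have at least three elements, so that they form a genuine cycle
even if the set is a singleton. -/
theorem exists_three_isOn {a p : List Bool} (h : true ∈ a) :
    ∃ i j k, i < j ∧ j < k ∧ IsOn (a ++ a ++ a ++ p) i ∧ IsOn (a ++ a ++ a ++ p) j ∧
      IsOn (a ++ a ++ a ++ p) k := by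
  obtain ⟨i, hi⟩ := exists_isOn h
  have h1 := i.2
  have e0 : (i : ℕ) % a.length = i := Nat.mod_eq_of_lt h1
  refine ⟨i, i + a.length, i + a.length + a.length, by omega, by omega, ?_, ?_, ?_⟩ <;>
    refine (isOn_triple a p _).2 (Or.inl ⟨by omega, ?_⟩) <;> simp only [Nat.add_mod_right, e0] <;>
    exact hi

/-- The matrix of a cycle determines its vertices. -/
theorem cycMatrix_injective {N : ℕ} {w w' : List Bool} (hw : w.length = N)
    (h : cycMatrix N w = cycMatrix N w') (u : ℕ) (hu : IsOn w u) : IsOn w' u := by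
  have h1 := hu.lt
  have h2 : nextPos w u < N := hw ▸ nextPos_lt (List.mem_of_getElem? hu) u
  have hN : u * N + nextPos w u < N * N := by
    calc u * N + nextPos w u < u * N + N := by omega
      _ = (u + 1) * N := by ring
      _ ≤ N * N := Nat.mul_le_mul_right _ (by omega)
  have h3 := congrFun h ⟨u * N + nextPos w u, hN⟩
  have e1 : (u * N + nextPos w u) / N = u := by
    rw [mul_comm, Nat.mul_add_div (by omega), Nat.div_eq_of_lt h2, add_zero]
  have e2 : (u * N + nextPos w u) % N = nextPos w u := by
    rw [mul_comm, Nat.mul_add_mod, Nat.mod_eq_of_lt h2]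
  simp only [cycMatrix, e1, e2] at h3
  rw [decide_eq_true (p := w[u]? = some true ∧ True) ⟨hu, trivial⟩] at h3
  exact (of_decide_eq_true h3.symm).1

/-- The strings that describe the cycles of the members of a family. -/
def privateRows (rows : List (List Bool)) : List (List Bool) :=
  rows.mapIdx (privateRow (joinRows rows).length)

/-- The rows of the consistency checking instance. -/
def sampleRows (rows : List (List Bool)) : List (List Bool) :=
  ((privateRows rows).map fun w => true :: cycBits w).reverse

/-- Number of vertices in the consistency checking instance. -/
def vertexCount (n : ℕ) (rows : List (List Bool)) : ℕ := 3 * n + (joinRows rows).length + 1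

theorem length_le_joinRows (rows : List (List Bool)) : rows.length ≤ (joinRows rows).length := by
  induction rows with
  | nil => simp
  | cons r rows ih => simp [joinRows] at ih ⊢; omega

theorem mem_privateRows {rows : List (List Bool)} {w : List Bool} :
    w ∈ privateRows rows ↔
      ∃ j, ∃ h : j < rows.length, w = privateRow (joinRows rows).length j rows[j] := by
  rw [privateRows, List.mem_mapIdx]
  simp only [eq_comm]

theorem length_of_mem_privateRows {n : ℕ} {rows : List (List Bool)} (hr : IsFamily n rows)
    {w : List Bool} (hw : w ∈ privateRows rows) : w.length = vertexCount n rows := by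
  obtain ⟨j, h, rfl⟩ := mem_privateRows.1 hw
  rw [length_privateRow (h.le.trans (length_le_joinRows rows)), (hr _ (List.getElem_mem h)).1]
  rfl

/-- The samples of the consistency checking instance. -/
def samples (n : ℕ) (rows : List (List Bool)) :
    List ((Fin (vertexCount n rows * vertexCount n rows) → Bool) × Bool) :=
  ((privateRows rows).map fun w => (cycMatrix (vertexCount n rows) w, true)).reverse

theorem encodeSamples_samples {n : ℕ} {rows : List (List Bool)} (hr : IsFamily n rows) :
    encodeSamples (samples n rows) =
      encodeRows (vertexCount n rows * vertexCount n rows) (sampleRows rows) := by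
  unfold encodeSamples samples sampleRows
  rw [List.map_reverse, List.map_map]
  congr 2
  refine List.map_congr_left fun w hw => ?_
  simp [cycBits_eq (length_of_mem_privateRows hr hw)]

theorem nodup_samples {n : ℕ} {rows : List (List Bool)} (hr : IsFamily n rows) :
    ((samples n rows).map Prod.fst).Nodup := by
  unfold samples
  rw [List.map_reverse, List.map_map, List.nodup_reverse]
  rw [List.nodup_iff_injective_get]
  rintro ⟨i, hi⟩ ⟨j, hj⟩ h
  have hi' : i < rows.length := by simpa [privateRows] using hi
  have hj' : j < rows.length := by simpa [privateRows] using hj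
  simp only [List.get_eq_getElem, List.getElem_map, Function.comp] at h
  have hl := length_of_mem_privateRows hr (List.getElem_mem (l := privateRows rows) (n := i)
    (by simpa [privateRows] using hi'))
  have h1 := cycMatrix_injective hl h
  simp only [privateRows, List.getElem_mapIdx, isOn_privateRow,
    (hr _ (List.getElem_mem hi')).1, (hr _ (List.getElem_mem hj')).1] at h1
  have h2 := h1 (3 * n + i) (Or.inr rfl)
  simp only [Fin.mk.injEq]
  omega

/-- A vertex set that is a feedback vertex set of all cycles yields a hitting set: a copy of an
element stands for that element, a private vertex for an arbitrary element of its set. -/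
theorem hasHittingSet_of_forall_isFVS {n : ℕ} {rows : List (List Bool)} (hr : IsFamily n rows)
    (S : Finset (Fin (vertexCount n rows)))
    (hS : ∀ w ∈ privateRows rows, IsFeedbackVertexSet
      (graphOf (vertexCount n rows) (cycMatrix (vertexCount n rows) w)) (S : Set (Fin _))) :
    HasHittingSet n rows S.card := by
  rcases rows.eq_nil_or_concat with rfl | ⟨rows', a, e⟩
  · exact ⟨∅, by simp, by simp⟩
  have hn : 0 < n := by
    obtain ⟨h1, h2⟩ := hr a (by simp [e])
    rw [← h1]; exact List.length_pos_of_mem h2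
  have hex : ∀ j : ℕ, ∃ i : Fin n, ∀ h : j < rows.length, IsOn rows[j] (i : ℕ) := by
    intro j
    by_cases h : j < rows.length
    · obtain ⟨h1, h2⟩ := hr _ (List.getElem_mem h)
      obtain ⟨i, hi⟩ := exists_isOn h2
      exact ⟨⟨i, h1 ▸ i.2⟩, fun _ => hi⟩
    · exact ⟨⟨0, hn⟩, fun h' => absurd h' h⟩
  choose elt helt using hex
  let φ : Fin (vertexCount n rows) → Fin n := fun v =>
    if (v : ℕ) < 3 * n then ⟨v % n, Nat.mod_lt _ hn⟩ else elt (v - 3 * n)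
  refine ⟨S.image φ, Finset.card_image_le, fun r hr' => ?_⟩
  obtain ⟨j, hj, rfl⟩ := List.getElem_of_mem hr'
  have hlen := (hr _ hr').1
  have hw := mem_privateRows.2 ⟨j, hj, rfl⟩
  obtain ⟨i1, i2, i3, h1, h2, o1, o2, o3⟩ := exists_three_isOn (p := List.replicate j false ++
    true :: List.replicate ((joinRows rows).length - j) false) (hr _ hr').2
  obtain ⟨v, hvS, hv⟩ := hit_of_isFVS (length_of_mem_privateRows hr hw) h1 h2 o1 o2 o3 _ (hS _ hw)
  refine ⟨φ v, Finset.mem_image_of_mem φ hvS, ?_⟩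
  rw [isOn_privateRow, hlen] at hv
  rcases hv with ⟨h3, h4⟩ | h3
  · simp only [φ, h3, if_true]
    exact h4
  · simp only [φ, h3, show ¬ (3 * n + j < 3 * n) by omega, if_false,
      show 3 * n + j - 3 * n = j by omega]
    exact helt j hj

/-- The reduction is correct. -/
theorem mem_consistency_iff {n : ℕ} {rows : List (List Bool)} (hr : IsFamily n rows) (k : ℕ) :
    (encodeRows (vertexCount n rows * vertexCount n rows) (sampleRows rows), k) ∈
      consistency learningFVS ↔ HasHittingSet n rows k := by
  rw [← encodeSamples_samples hr]
  constructor
  · rintro ⟨n', X, -, hX, r, c, hk, hrep, hc⟩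
    simp only [encodeSamples] at hX
    obtain ⟨rfl, hX⟩ := encodeRows_inj (fun m => m + 1)
      (by intro r h; obtain ⟨a, -, rfl⟩ := List.mem_map.1 h; simp)
      (by intro r h; obtain ⟨a, -, rfl⟩ := List.mem_map.1 h; simp) hX
    obtain ⟨S, rfl, hS⟩ := exists_of_fvsRep_eq hrep
    have hk : (bitsOf S).count true ≤ k := hk
    rw [count_bitsOf] at hk
    obtain ⟨H, h1, h2⟩ := hasHittingSet_of_forall_isFVS hr S fun w hw => by
      have : (true :: List.ofFn (cycMatrix (vertexCount n rows) w)) ∈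
          (samples n rows).map fun a => a.2 :: List.ofFn a.1 :=
        List.mem_map.2 ⟨(cycMatrix (vertexCount n rows) w, true),
          List.mem_reverse.2 (List.mem_map.2 ⟨w, hw, rfl⟩), rfl⟩
      rw [hX] at this
      obtain ⟨a, ha, e⟩ := List.mem_map.1 this
      rw [List.cons.injEq] at e
      rw [← hS, ← List.ofFn_injective e.2, hc a ha, e.1]
    exact ⟨H, h1.trans hk, h2⟩
  · rintro ⟨H, h1, h2⟩
    have hn : n ≤ vertexCount n rows := by unfold vertexCount; omega
    let S : Finset (Fin (vertexCount n rows)) := H.map (Fin.castLEEmb hn)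
    refine ⟨_, samples n rows, nodup_samples hr, rfl, bitsOf S, _, ?_, fvsRep_bitsOf S, ?_⟩
    · change (bitsOf S).count true ≤ k
      rw [count_bitsOf, Finset.card_map]
      exact h1
    · intro a ha
      obtain ⟨w, hw, rfl⟩ := List.mem_map.1 (List.mem_reverse.1 ha)
      obtain ⟨j, hj, rfl⟩ := mem_privateRows.1 hw
      obtain ⟨i, hi, hon⟩ := h2 _ (List.getElem_mem hj)
      simp only [decide_eq_true_eq]
      refine isFVS_of_hit _ (Fin.castLE hn i) ?_ ?_
      · exact Finset.mem_coe.2 (Finset.mem_map.2 ⟨i, hi, rfl⟩)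
      · rw [isOn_privateRow, (hr _ (List.getElem_mem hj)).1]
        left
        simp only [Fin.val_castLE]
        refine ⟨by omega, ?_⟩
        rwa [Nat.mod_eq_of_lt i.2]

theorem mem_positiveSamples {n : ℕ} {rows : List (List Bool)} (hr : IsFamily n rows) (k : ℕ) :
    (encodeRows (vertexCount n rows * vertexCount n rows) (sampleRows rows), k) ∈
      positiveSamples := by
  rw [← encodeSamples_samples hr]
  refine ⟨_, samples n rows, nodup_samples hr, rfl, fun a ha => ?_⟩
  obtain ⟨w, hw, rfl⟩ := List.mem_map.1 (List.mem_reverse.1 ha)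
  rfl

/-! ### The reduction from Hitting Set -/

namespace Prog

/-- Remove one row (with its announcing bit) from stack 12; the number of bits of a row is the
height of stack 2. -/
def dropRow : Prog := .seq (.pop 12) (.seq (copy 2 10 11) (forBits 10 (.pop 12) (.pop 12)))

/-- Move one row from stack 12 to stack 5, in reversed order.  Missing bits are taken to be
`false`. -/
def readRow : Prog :=
  .seq (.pop 12) (.seq (copy 2 10 11)
    (forBits 10
      (.branch 12 (.push 5 false) (.seq (.pop 12) (.push 5 false)) (.seq (.pop 12) (.push 5 true)))
      (.branch 12 (.push 5 false) (.seq (.pop 12) (.push 5 false))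
        (.seq (.pop 12) (.push 5 true)))))

/-- Put three copies of the row on stack 5 on stack 6. -/
def tripleRow : Prog :=
  .seq (copy 5 6 11) (.seq (copy 5 6 11) (.seq (copy 5 6 11) (clear 5)))

/-- Append the sample that belongs to the next row on stack 12 to the output on stack 15.  Stacks
13 and 14 hold as many bits `false` as there are private vertices before and behind the one of this
row. -/
def sampleRow : Prog :=
  .seq readRow (.seq tripleRow (.seq (copy 13 6 11) (.seq (.push 6 true) (.seq (copy 14 6 11)
    (.seq cycle (.seq (move 9 11) (.seq (move 11 15) (.seq (.push 15 true) (.seq (.push 15 true)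
      (.seq (.push 13 false) (.pop 14)))))))))))

/-- Put the number of vertices, in unary, on stack 16. -/
def countVertices : Prog :=
  .seq (pushEach 2 16 true 11) (.seq (pushEach 2 16 true 11) (.seq (pushEach 2 16 true 11)
    (.seq (pushEach 3 16 true 11) (.push 16 true))))

/-- Put the product of the heights of stacks 16 and 10, in unary, on stack 15, and empty stack
10. -/
def squareVertices : Prog := forBits 10 (pushEach 16 15 true 11) (pushEach 16 15 true 11)

/-- The reduction from Hitting Set to consistency checking. -/
def reduction : Prog :=
  .seq decode (.seq (pushEach 3 14 false 11) (.seq (.push 15 false) (.seq (copy 3 12 11)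
    (.seq (.loop 12 sampleRow) (.seq countVertices (.seq (.push 15 false) (.seq (copy 16 10 11)
      (.seq squareVertices (.seq (move 15 12) (move 12 0))))))))))

end Prog

theorem Runs.dropRow (a0 a1 a3 a4 a5 a6 a7 a8 a9 S : List Bool) (rest : List (List Bool)) (n : ℕ) :
    Runs .dropRow (stk (a0::a1::unary n::a3::a4::a5::a6::a7::a8::a9::[]::[]::S::rest))
      (stk (a0::a1::unary n::a3::a4::a5::a6::a7::a8::a9::[]::[]::S.drop (n + 1)::rest))
      (13 * n + 10) := by
  have hg : ∀ (i : ℕ) (l : List Bool), (List.tail)^[i] l = l.drop i := by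
    intro i
    induction i with
    | zero => intro l; rfl
    | succ i ih => intro l; rw [Function.iterate_succ_apply, ih]; cases l <;> simp
  have h1 := Runs.forBits_iterate (x := 10) (p := .pop 12) (fun l (S : List Bool) =>
    stk (a0::a1::unary n::a3::a4::a5::a6::a7::a8::a9::l::[]::S::rest)) List.tail 1
    (fun _ _ => rfl) (fun _ _ _ => update_stk (by simp) _) (unary n ++ []) S.tail
    (fun l₂ i _ => Runs.pop_stk 12 (by simp))
  refine (((Runs.pop_stk 12 (by simp)).seq ((Runs.copy_stk (x := 2) (y := 10) (t := 11) (by decide)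
    (by decide) (by decide) (by simp) rfl).seq h1)).mono ?_).congr ?_
  · simp [unary]; omega
  · rw [hg]; simp [unary]

theorem Runs.readBit (a0 a1 a2 a3 a4 a5 a6 a7 a8 a9 a10 S : List Bool) (rest : List (List Bool)) :
    Runs (.branch 12 (.push 5 false) (.seq (.pop 12) (.push 5 false))
        (.seq (.pop 12) (.push 5 true)))
      (stk (a0::a1::a2::a3::a4::a5::a6::a7::a8::a9::a10::[]::S::rest))
      (stk (a0::a1::a2::a3::a4::(S.headD false :: a5)::a6::a7::a8::a9::a10::[]::S.tail::
        rest)) 3 := by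
  match S with
  | [] => exact (Runs.branch_nil rfl (Runs.push_stk 5 false (by simp))).mono (by omega)
  | false :: S =>
    exact Runs.branch_false rfl ((Runs.pop_stk 12 (by simp)).seq (Runs.push_stk 5 false (by simp)))
  | true :: S =>
    exact Runs.branch_true rfl ((Runs.pop_stk 12 (by simp)).seq (Runs.push_stk 5 true (by simp)))

/-- Missing bits are read as `false`, so a row behind the last one is the empty set. -/
theorem Runs.readRow (a0 a1 a3 a4 a6 a7 a8 a9 S : List Bool) (rest : List (List Bool)) (n : ℕ) :
    Runs .readRow (stk (a0::a1::unary n::a3::a4::[]::a6::a7::a8::a9::[]::[]::S::rest))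
      (stk (a0::a1::unary n::a3::a4::(List.takeD n S.tail false).reverse::a6::a7::a8::a9::[]::[]::
        S.drop (n + 1)::rest))
      (20 * n + 10) := by
  let g : List Bool × List Bool → List Bool × List Bool := fun a =>
    (a.2.headD false :: a.1, a.2.tail)
  have hg : ∀ (i : ℕ) (r l : List Bool),
      g^[i] (r, l) = ((List.takeD i l false).reverse ++ r, l.drop i) := by
    intro i
    induction i with
    | zero => intro r l; rfl
    | succ i ih =>
      intro r l
      rw [Function.iterate_succ_apply, ih]
      cases l <;> simp [List.takeD]
  have h1 := Runs.forBits_iterate (x := 10) (p := .branch 12 (.push 5 false)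
    (.seq (.pop 12) (.push 5 false)) (.seq (.pop 12) (.push 5 true)))
    (fun l (a : List Bool × List Bool) =>
    stk (a0::a1::unary n::a3::a4::a.1::a6::a7::a8::a9::l::[]::a.2::rest)) g 3
    (fun _ _ => rfl) (fun _ _ _ => update_stk (by simp) _) (unary n ++ []) ([], S.tail)
    (fun l₂ i _ => Runs.readBit _ _ _ _ _ _ _ _ _ _ _ _ _)
  refine (((Runs.pop_stk 12 (by simp)).seq ((Runs.copy_stk (x := 2) (y := 10) (t := 11) (by decide)
    (by decide) (by decide) (by simp) rfl).seq h1)).mono ?_).congr ?_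
  · simp [unary]; omega
  · rw [hg]; simp [unary]

theorem Runs.tripleRow (a0 a1 a2 a3 a4 a5 a6 a7 a8 a9 a10 : List Bool) (rest : List (List Bool)) :
    Runs .tripleRow (stk (a0::a1::a2::a3::a4::a5::a6::a7::a8::a9::a10::[]::rest))
      (stk (a0::a1::a2::a3::a4::[]::(a5 ++ (a5 ++ (a5 ++ a6)))::a7::a8::a9::a10::[]::rest))
      (29 * a5.length + 7) := by
  have h := fun a6 => Runs.copy_stk
    (L := (a0::a1::a2::a3::a4::a5::a6::a7::a8::a9::a10::[]::rest)) (x := 5) (y := 6) (t := 11)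
    (by decide) (by decide) (by decide) (by simp) rfl
  refine ((h _).seq ((h _).seq ((h _).seq (Runs.clear_stk 5 (by simp))))).mono ?_
  simp
  omega

/-- The stacks of the reduction after `j` rows have been processed; `S` holds the remaining
rows. -/
def reduceStk (k : List Bool) (n : ℕ) (rw S : List Bool) (j L : ℕ) (res : List Bool) : Stacks :=
  stk ([]::k::unary n::rw::[]::[]::[]::[]::[]::[]::[]::[]::S::List.replicate j false::
    List.replicate (L - j) false::res::[[]])

/-- One round of the reduction: the next row `a` has number `j`, and its sample is put in front of
the result; this is why `sampleRows` lists the samples in reversed order. -/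
theorem Runs.sampleRow (k : List Bool) (n : ℕ) (rw S : List Bool) (j L : ℕ) (res a : List Bool)
    (ha : a.length = n) (hj : j < L) :
    Runs .sampleRow (reduceStk k n rw (true :: a ++ S) j L res)
      (reduceStk k n rw S (j + 1) L (true :: true :: cycBits (privateRow L j a) ++ res))
      (200 * (3 * n + L + 2) ^ 2) := by
  have hw : (privateRow L j a).length = 3 * n + L + 1 := by
    rw [length_privateRow hj.le, ha]
  have e1 : List.takeD n (true :: a ++ S).tail false = a := by
    subst ha
    rw [List.cons_append, List.tail_cons, List.takeD_eq_take _ (by simp), List.take_left]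
  have e2 : (true :: a ++ S).drop (n + 1) = S := by subst ha; simp
  have e3 : (privateRow L j a).reverse = List.replicate (L - j) false ++
      (true :: (List.replicate j false ++ (a.reverse ++ (a.reverse ++ (a.reverse ++ []))))) := by
    simp [privateRow]
  have h1 := Runs.readRow [] k rw [] [] [] [] [] (true :: a ++ S)
    [List.replicate j false, List.replicate (L - j) false, res, []] n
  rw [e1, e2] at h1
  have h2 := Runs.cycle [] k (unary n) rw [] [] [] [S, List.replicate j false,
    List.replicate (L - j) false, res, []] (privateRow L j a)
  rw [e3] at h2
  refine ((h1.seq ((Runs.tripleRow _ _ _ _ _ _ _ _ _ _ _ _).seq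
    ((Runs.copy_stk (x := 13) (y := 6) (t := 11) (by decide) (by decide) (by decide)
      (by simp) rfl).seq
    ((Runs.push_stk 6 true (by simp)).seq
    ((Runs.copy_stk (x := 14) (y := 6) (t := 11) (by decide) (by decide) (by decide)
      (by simp) rfl).seq
    (h2.seq
    ((Runs.move_stk (x := 9) (y := 11) (by decide) (by simp) (by simp)).seq
    ((Runs.move_stk (x := 11) (y := 15) (by decide) (by simp) (by simp)).seq
    ((Runs.push_stk 15 true (by simp)).seq
    ((Runs.push_stk 15 true (by simp)).seq
    ((Runs.push_stk 13 false (by simp)).seq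
    (Runs.pop_stk 14 (by simp))))))))))))).mono ?_).congr ?_
  · have hc := length_cycBits (privateRow L j a)
    rw [hw] at hc
    simp [hw, hc, ha]
    have : j ≤ L := hj.le
    have : L - j ≤ L := Nat.sub_le _ _
    nlinarith
  · obtain ⟨d, rfl⟩ : ∃ d, L = j + 1 + d := ⟨L - (j + 1), by omega⟩
    have e4 : j + 1 + d - j = d + 1 := by omega
    have e5 : j + 1 + d - (j + 1) = d := by omega
    simp [reduceStk, e4, e5, List.replicate_succ]

theorem Runs.loop_sampleRow (k : List Bool) (n : ℕ) (rw : List Bool) (L : ℕ)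
    (rows : List (List Bool)) :
    ∀ (j : ℕ) (res : List Bool), (∀ r ∈ rows, r.length = n) → j + rows.length ≤ L →
    Runs (.loop 12 .sampleRow) (reduceStk k n rw (joinRows rows) j L res)
      (reduceStk k n rw [] (j + rows.length) L
        (joinRows ((rows.mapIdx fun i a => true :: cycBits
          (privateRow L (j + i) a)).reverse) ++ res))
      ((200 * (3 * n + L + 2) ^ 2 + 1) * rows.length + 1) := by
  induction rows with
  | nil => intro j res _ _; exact (Runs.loop_nil rfl).mono (by simp)
  | cons a rows ih =>
    intro j res hr hj
    simp only [List.length_cons] at hj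
    have h1 := Runs.sampleRow k n rw (joinRows rows) j L res a (hr a (by simp)) (by omega)
    have h2 := ih (j + 1) (true :: true :: cycBits (privateRow L j a) ++ res)
      (fun r h => hr r (by simp [h])) (by omega)
    have e : joinRows (a :: rows) = true :: a ++ joinRows rows := by simp [joinRows]
    rw [e]
    refine ((Runs.loop_cons (by simp [reduceStk, stk]) h1 h2).mono ?_).congr ?_
    · simp only [List.length_cons]
      ring_nf
      omega
    · congr 1
      · simp only [List.length_cons]; omega
      · simp only [List.mapIdx_cons, List.reverse_cons, add_zero, add_assoc, add_comm 1]
        simp [joinRows]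

theorem stk_append_nil (L : List (List Bool)) (m : ℕ) :
    stk (L ++ List.replicate m []) = stk L := by
  funext i
  unfold stk
  rcases lt_or_ge i L.length with h | h
  · rw [List.getD_append _ _ _ _ h]
  · rw [List.getD_append_right _ _ _ _ h, List.getD_eq_default L _ h]
    rcases lt_or_ge (i - L.length) m with h' | h'
    · rw [List.getD_replicate _ h']
    · rw [List.getD_eq_default _ _ (by simpa using h')]

theorem haltsWithin_of_runs {p : Prog} {O : Oracle} {inputs : List (List Bool)} {σ : Stacks}
    {B T : ℕ} {Q : State → Prop} (h : Runs p (stk inputs) σ B) (hB : B ≤ T)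
    (hQ : ∀ t q, Q ⟨σ, t, q⟩) : p.HaltsWithin O inputs T Q := by
  obtain ⟨t, ht, h⟩ := h
  intro o ho
  unfold Prog.run at ho
  rw [initial_eq_stk, h O T 0 0 (by omega), PMF.support_pure, Set.mem_singleton_iff] at ho
  exact ⟨_, ho, by simp only; omega, hQ _ _⟩

theorem joinRows_sampleRows (rows : List (List Bool)) :
    sampleRows rows = (rows.mapIdx fun i a => true :: cycBits (privateRow (joinRows rows).length
      (0 + i) a)).reverse := by
  rw [sampleRows, privateRows]
  congr 1
  refine List.ext_getElem (by simp) fun i h1 h2 => ?_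
  simp

theorem Runs.squareVertices (a0 a1 a2 a3 a4 a5 a6 a7 a8 a9 a12 a13 a14 res : List Bool)
    (rest : List (List Bool)) (N : ℕ) :
    Runs .squareVertices
      (stk (a0::a1::a2::a3::a4::a5::a6::a7::a8::a9::unary N::[]::a12::a13::a14::res::unary N::rest))
      (stk (a0::a1::a2::a3::a4::a5::a6::a7::a8::a9::[]::[]::a12::a13::a14::(unary (N * N) ++ res)::
        unary N::rest)) ((9 * N + 5) * N + 1) := by
  have hg : ∀ i, (fun l : List Bool => unary N ++ l)^[i] res = unary (N * i) ++ res := by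
    intro i
    induction i with
    | zero => simp [unary]
    | succ i ih =>
      rw [Function.iterate_succ_apply', ih, ← List.append_assoc]
      congr 1
      simp only [unary, List.replicate_append_replicate]
      congr 1
      ring
  have h := Runs.forBits_iterate (x := 10) (p := .pushEach 16 15 true 11)
    (fun l (r : List Bool) => stk (a0::a1::a2::a3::a4::a5::a6::a7::a8::a9::l::[]::a12::a13::a14::r::
      unary N::rest)) (fun l => unary N ++ l) (9 * N + 2)
    (fun _ _ => rfl) (fun _ _ _ => update_stk (by simp) _) (unary N) res
    (fun l₂ i _ => ((Runs.pushEach_stk true (by decide) (by decide) (by decide) (by simp) rfl).mono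
      (by simp [unary])).congr (by simp [unary]))
  rw [hg] at h
  simpa [Prog.squareVertices, unary] using h

/-- The reduction keeps the parameter, except that inputs which are no families of nonempty sets are
replaced by a no-instance with parameter `0`. -/
theorem Runs.reduction (x : List Bool) (k : ℕ) :
    ∃ σ x' k', Runs .reduction (stk [x, unary k]) σ (400000 * (x.length + k + 1) ^ 3) ∧
      σ 0 = x' ∧ σ 1 = unary k' ∧ ((x, k) ∈ hittingSet ↔ (x', k') ∈ consistency learningFVS) ∧
      k' ≤ k ∧ (x', k') ∈ positiveSamples := by
  obtain ⟨n, rows, k', hr, hk, hn, hL, hiff, hdec⟩ := Runs.decode [] [] [] [[], [], [], []] x k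
  have hstart : stk [x, unary k] = stk [x, unary k, [], [], [], [], [], [], [], [], [], [], [],
      [], [], [], []] := (stk_append_nil [x, unary k] 15).symm
  set L := (joinRows rows).length with hLdef
  set N := vertexCount n rows with hN
  have hN' : N = 3 * n + L + 1 := rfl
  have hrows : rows.length ≤ L := length_le_joinRows rows
  have h1 := Runs.loop_sampleRow (unary k') n (joinRows rows) L rows 0 [false]
    (fun r h => (hr r h).1) (by omega)
  rw [← joinRows_sampleRows] at h1
  have hNu : unary N = true :: (List.replicate L true ++ (List.replicate n true ++
      (List.replicate n true ++ (List.replicate n true ++ [])))) := by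
    simp only [unary, List.append_nil, List.replicate_append_replicate, ← List.replicate_succ]
    congr 1; omega
  have hsq := Runs.squareVertices [] (unary k') (unary n) (joinRows rows) [] [] [] [] [] [] []
    (List.replicate rows.length false) (List.replicate (L - rows.length) false)
    (false :: (joinRows (sampleRows rows) ++ [false])) [] N
  refine ⟨stk [encodeRows (N * N) (sampleRows rows), unary k', unary n, joinRows rows, [], [], [],
        [], [], [], [], [], [], List.replicate rows.length false,
        List.replicate (L - rows.length) false, [], unary N],
    encodeRows (N * N) (sampleRows rows), k', ?_, rfl, rfl,
    hiff.trans (mem_consistency_iff hr k').symm, hk, mem_positiveSamples hr k'⟩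
  · rw [hstart]
    refine ((hdec.seq
      ((Runs.pushEach_stk (x := 3) (y := 14) (t := 11) false (by decide) (by decide) (by decide)
        (by simp) rfl).seq
      ((Runs.push_stk 15 false (by simp)).seq
      (((Runs.copy_stk (x := 3) (y := 12) (t := 11) (by decide) (by decide) (by decide) (by simp)
        rfl).congr (τ := reduceStk (unary k') n (joinRows rows) (joinRows rows) 0 L [false])
        (by simp [reduceStk, hLdef])).seq
      (h1.seq
      (((Runs.pushEach_stk (x := 2) (y := 16) (t := 11) true (by decide) (by decide) (by decide)
        (by simp) rfl).seq
      ((Runs.pushEach_stk (x := 2) (y := 16) (t := 11) true (by decide) (by decide) (by decide)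
        (by simp) rfl).seq
      ((Runs.pushEach_stk (x := 2) (y := 16) (t := 11) true (by decide) (by decide) (by decide)
        (by simp) rfl).seq
      ((Runs.pushEach_stk (x := 3) (y := 16) (t := 11) true (by decide) (by decide) (by decide)
        (by simp) rfl).seq
      (Runs.push_stk 16 true (by simp)))))).seq
      ((Runs.push_stk 15 false (by simp)).seq
      (((Runs.copy_stk (x := 16) (y := 10) (t := 11) (by decide) (by decide) (by decide) (by simp)
        rfl).congr (τ := stk [[], unary k', unary n, joinRows rows, [], [], [], [], [], [],
          unary N, [], [], List.replicate rows.length false, List.replicate (L - rows.length) false,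
          false :: (joinRows (sampleRows rows) ++ [false]), unary N])
        (by rw [hNu]; simp [unary, hLdef])).seq
      (hsq.seq
      ((Runs.move_stk (x := 15) (y := 12) (by decide) (by simp) (by simp)).seq
      (Runs.move_stk (x := 12) (y := 0) (by decide) (by simp) (by simp)))))))))))).mono ?_).congr
      ?_
    · have hres : (joinRows (sampleRows rows)).length = rows.length * (N * N + 2) := by
        rw [joinRows, length_flatMap_const _ _ (N * N + 2)]
        · simp [sampleRows, privateRows]
        · intro r h
          obtain ⟨w, hw, rfl⟩ := List.mem_map.1 (List.mem_reverse.1 h)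
          simp [length_cycBits, length_of_mem_privateRows hr hw, hN]
      have hd : L - rows.length ≤ L := Nat.sub_le _ _
      simp [hres, unary, ← hLdef]
      obtain ⟨X, hX⟩ : ∃ X, X = x.length + k + 1 := ⟨_, rfl⟩
      rw [← hX]
      have b1 : 3 * n + L + 2 ≤ 7 * X := by omega
      have b2 : rows.length ≤ 2 * X := by omega
      have b3 : N ≤ 7 * X := by omega
      have b4 : N * N ≤ 49 * X ^ 2 := (Nat.mul_le_mul b3 b3).trans (by nlinarith)
      have b5 : rows.length * (N * N + 2) ≤ 2 * X * (49 * X ^ 2 + 2) := by gcongr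
      have b6 : (200 * (3 * n + L + 2) ^ 2 + 1) * rows.length ≤ (200 * (7 * X) ^ 2 + 1)
        * (2 * X) := by
        gcongr
      have b7 : 1 ≤ X := by omega
      have b8 : X ≤ X ^ 2 := by nlinarith
      have b9 : X ^ 2 ≤ X ^ 3 := by nlinarith
      have b10 : (9 * N + 5) * N = 9 * (N * N) + 5 * N := by ring
      have b11 : n ≤ X := by omega
      have b12 : L ≤ 2 * X := by omega
      generalize (200 * (3 * n + L + 2) ^ 2 + 1) * rows.length = P at b6 ⊢
      generalize rows.length * (N * N + 2) = Q at b5 ⊢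
      rw [b10]
      generalize N * N = R at b4 b5 ⊢
      nlinarith
    · simp [encodeRows, joinRows]

/-- There is a vertex for each of three copies of an element, and a private vertex for each set,
which makes the samples pairwise distinct even if the family has repetitions. -/
theorem reducesInto_consistency :
    ReducesInto hittingSet (consistency learningFVS) positiveSamples := by
  -- the parameter does not grow, and the running time is cubic
  refine ⟨.reduction, fun _ => 400000, id, 3, ?_, Computable.const _, Computable.id, fun x k => ?_⟩
  · simp [Prog.reduction, Prog.decode, Prog.IsDeterministic, Prog.forBits, Prog.scanFalse,
      Prog.scanTrue, Prog.replaceInstance, Prog.keepInstance, Prog.pushEach, Prog.copy, Prog.move,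
      Prog.moveTwo, Prog.clear, Prog.sampleRow, Prog.readRow, Prog.tripleRow, Prog.cycle,
      Prog.cyclePass, Prog.countVertices, Prog.squareVertices]
  · obtain ⟨σ, x', k', h, h0, h1, h2, h3, h4⟩ := Runs.reduction x k
    exact haltsWithin_of_runs h le_rfl fun t q => ⟨x', k', h0, h1, h2, h3, h4⟩

/-! ### Programs for computable functions -/

open Turing.ToPartrec (Code)

/-- A list of numbers on a stack: every number in unary, followed by a bit `false`. -/
def encodeList (v : List ℕ) : List Bool := v.flatMap fun n => List.replicate n true ++ [false]

/-- The height of a stack that holds a list of numbers. -/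
def encodeLen (v : List ℕ) : ℕ := v.foldl (fun a n => a + (n + 1)) 0

theorem length_encodeList (v : List ℕ) : (encodeList v).length = encodeLen v := by
  have h : ∀ (v : List ℕ) (a : ℕ),
      v.foldl (fun a n => a + (n + 1)) a = a + (encodeList v).length := by
    intro v
    induction v with
    | nil => intro a; simp [encodeList]
    | cons n v ih =>
      intro a
      rw [List.foldl_cons, ih]
      simp [encodeList]
      ring
  rw [encodeLen, h, zero_add]

/-- One round of a loop with body `g`, which stops if the first entry of the value of `g` is zero;
the second component adds up the numbers of steps. -/
def timedStep (g : List ℕ →. List ℕ × ℕ) :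
    List ℕ × ℕ →. (List ℕ × ℕ) ⊕ (List ℕ × ℕ) := fun a =>
  (g a.1).map fun b => cond (decide (b.1.headI = 0))
    (Sum.inl (b.1.tail, a.2 + b.2 + (20 * encodeLen b.1 + 20)))
    (Sum.inr (b.1.tail, a.2 + b.2 + (20 * encodeLen b.1 + 20)))

/-- Evaluation of a code, together with a bound for the number of steps of its compilation into a
program. -/
def timedEval : Code → List ℕ →. List ℕ × ℕ
  | .zero' => fun v => Part.some (0 :: v, 1)
  | .succ => fun v => Part.some ([v.headI.succ], 20 * encodeLen v + 20)
  | .tail => fun v => Part.some (v.tail, 20 * encodeLen v + 20)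
  | .cons f fs => fun v => (timedEval f v).bind fun a => (timedEval fs v).map fun b =>
      (a.1.headI :: b.1,
        a.2 + b.2 + (40 * encodeLen v + 40 * encodeLen a.1 + 40 * encodeLen b.1 + 40))
  | .comp f g => fun v => (timedEval g v).bind fun a => (timedEval f a.1).map fun b =>
      (b.1, a.2 + b.2)
  | .case f g => fun v =>
      (cond (decide (v.headI = 0)) (timedEval f v.tail)
        (timedEval g ((v.headI - 1) :: v.tail))).map fun b => (b.1, b.2 + 2)
  | .fix f => fun v =>
      (PFun.fix (timedStep (timedEval f)) (v, 0)).map fun b =>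
        (b.1, b.2 + (20 * encodeLen v + 20 * encodeLen b.1 + 20))

theorem computable_headI : Computable (fun v : List ℕ => v.headI) := by
  have : (fun v : List ℕ => v.headI) = fun v => v.head?.getD 0 := by
    funext v; cases v <;> rfl
  rw [this]
  exact (Primrec.option_getD.comp Primrec.list_head? (Primrec.const 0)).to_comp

theorem computable_tail : Computable (fun v : List ℕ => v.tail) := Primrec.list_tail.to_comp

theorem computable_encodeLen : Computable encodeLen := by
  have : Primrec fun v : List ℕ => (id v).foldl (fun a n => (fun _ (p : ℕ × ℕ) =>
      p.1 + (p.2 + 1) : List ℕ → ℕ × ℕ → ℕ) v (a, n)) ((fun _ => 0 : List ℕ → ℕ) v) :=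
    Primrec.list_foldl Primrec.id (Primrec.const 0)
      (Primrec.nat_add.comp (Primrec.fst.comp Primrec.snd)
        (Primrec.succ.comp (Primrec.snd.comp Primrec.snd))).to₂
  exact this.to_comp

theorem computable_add {α : Type*} [Primcodable α] {f g : α → ℕ} (hf : Computable f)
    (hg : Computable g) : Computable fun a => f a + g a :=
  (Primrec.nat_add.to_comp).comp hf hg

theorem computable_mul {α : Type*} [Primcodable α] {f g : α → ℕ} (hf : Computable f)
    (hg : Computable g) : Computable fun a => f a * g a :=
  (Primrec.nat_mul.to_comp).comp hf hg

theorem computable_isZero_headI {α : Type*} [Primcodable α] {f : α → List ℕ} (hf : Computable f) :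
    Computable fun a => decide ((f a).headI = 0) := by
  have : Primrec fun n : ℕ => decide (n = 0) :=
    (Primrec.eq.comp Primrec.id (Primrec.const 0)).decide
  exact this.to_comp.comp (computable_headI.comp hf)

theorem computable_timeTerm {α : Type*} [Primcodable α] {f : α → List ℕ} (hf : Computable f)
    (c : ℕ) : Computable fun a => c * encodeLen (f a) :=
  computable_mul (Computable.const c) (computable_encodeLen.comp hf)

/-- The bound for the number of steps is itself computable. -/
theorem partrec_timedEval (c : Code) : Partrec (timedEval c) := by
  induction c with
  | zero' =>
    exact (Computable.pair (Computable.list_cons.comp (Computable.const 0) Computable.id)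
      (Computable.const 1)).partrec
  | succ =>
    exact (Computable.pair (Computable.list_cons.comp (Computable.succ.comp computable_headI)
      (Computable.const [])) (computable_add (computable_timeTerm Computable.id 20)
        (Computable.const 20))).partrec
  | tail =>
    exact (Computable.pair computable_tail (computable_add (computable_timeTerm Computable.id 20)
        (Computable.const 20))).partrec
  | cons f fs ihf ihfs =>
    refine Partrec.bind ihf (Partrec.map (ihfs.comp Computable.fst) ?_)
    have hv : Computable fun p : (List ℕ × List ℕ × ℕ) × List ℕ × ℕ => p.1.1 :=
      Computable.fst.comp Computable.fst
    have ha : Computable fun p : (List ℕ × List ℕ × ℕ) × List ℕ × ℕ => p.1.2 :=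
      Computable.snd.comp Computable.fst
    have hb : Computable fun p : (List ℕ × List ℕ × ℕ) × List ℕ × ℕ => p.2 := Computable.snd
    exact Computable.pair
      (Computable.list_cons.comp (computable_headI.comp (Computable.fst.comp ha))
        (Computable.fst.comp hb))
      (computable_add (computable_add (Computable.snd.comp ha) (Computable.snd.comp hb))
        (computable_add (computable_add (computable_add (computable_timeTerm hv 40)
          (computable_timeTerm (Computable.fst.comp ha) 40))
          (computable_timeTerm (Computable.fst.comp hb) 40)) (Computable.const 40)))
  | comp f g ihf ihg =>
    refine Partrec.bind ihg (Partrec.map (ihf.comp (Computable.fst.comp Computable.snd)) ?_)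
    exact Computable.pair (Computable.fst.comp Computable.snd)
      (computable_add (Computable.snd.comp (Computable.snd.comp Computable.fst))
        (Computable.snd.comp Computable.snd))
  | case f g ihf ihg =>
    refine Partrec.map (Partrec.cond (computable_isZero_headI Computable.id)
      (ihf.comp computable_tail) (ihg.comp (Computable.list_cons.comp
        (Computable.pred.comp computable_headI) computable_tail))) ?_
    exact Computable.pair (Computable.fst.comp Computable.snd)
      (computable_add (Computable.snd.comp Computable.snd) (Computable.const 2))
  | fix f ih =>
    have hb : Computable fun p : (List ℕ × ℕ) × List ℕ × ℕ =>
        (p.2.1.tail, p.1.2 + p.2.2 + (20 * encodeLen p.2.1 + 20)) :=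
      Computable.pair (computable_tail.comp (Computable.fst.comp Computable.snd))
        (computable_add (computable_add (Computable.snd.comp Computable.fst)
          (Computable.snd.comp Computable.snd))
          (computable_add (computable_timeTerm (Computable.fst.comp Computable.snd) 20)
            (Computable.const 20)))
    have h1 : Partrec (timedStep (timedEval f)) :=
      Partrec.map (ih.comp Computable.fst)
        (Computable.cond (computable_isZero_headI (Computable.fst.comp Computable.snd))
          (Computable.sumInl.comp hb) (Computable.sumInr.comp hb))
    refine Partrec.map ((Partrec.fix h1).comp
      (Computable.pair Computable.id (Computable.const 0))) ?_
    exact Computable.pair (Computable.fst.comp Computable.snd)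
      (computable_add (Computable.snd.comp Computable.snd)
        (computable_add (computable_add (computable_timeTerm Computable.fst 20)
          (computable_timeTerm (Computable.fst.comp Computable.snd) 20)) (Computable.const 20)))

/-- The bound for the number of steps is defined whenever the value is. -/
theorem exists_mem_timedEval (c : Code) :
    ∀ v v', v' ∈ c.eval v → ∃ t, (v', t) ∈ timedEval c v := by
  induction c with
  | zero' => intro v v' h; exact ⟨1, by simpa [timedEval] using h⟩
  | succ => intro v v' h; exact ⟨20 * encodeLen v + 20, by simpa [timedEval] using h⟩
  | tail => intro v v' h; exact ⟨20 * encodeLen v + 20, by simpa [timedEval] using h⟩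
  | cons f fs ihf ihfs =>
    intro v v' h
    simp only [Code.cons_eval, Part.bind_eq_bind, Part.pure_eq_some, Part.mem_bind_iff,
      Part.mem_some_iff] at h
    obtain ⟨a, ha, b, hb, rfl⟩ := h
    obtain ⟨t, ht⟩ := ihf v a ha
    obtain ⟨u, hu⟩ := ihfs v b hb
    refine ⟨t + u + (40 * encodeLen v + 40 * encodeLen a + 40 * encodeLen b + 40), ?_⟩
    simp only [timedEval, Part.mem_bind_iff, Part.mem_map_iff]
    exact ⟨(a, t), ht, (b, u), hu, rfl⟩
  | comp f g ihf ihg =>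
    intro v v' h
    simp only [Code.comp_eval] at h
    obtain ⟨a, ha, hb⟩ := Part.mem_bind_iff.1 h
    obtain ⟨t, ht⟩ := ihg v a ha
    obtain ⟨u, hu⟩ := ihf a v' hb
    refine ⟨t + u, ?_⟩
    simp only [timedEval, Part.mem_bind_iff, Part.mem_map_iff]
    exact ⟨(a, t), ht, (v', u), hu, rfl⟩
  | case f g ihf ihg =>
    intro v v' h
    simp only [Code.case_eval] at h
    match hv : v.headI with
    | 0 =>
      rw [hv] at h
      obtain ⟨t, ht⟩ := ihf _ _ h
      refine ⟨t + 2, ?_⟩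
      simp only [timedEval, hv, Part.mem_map_iff]
      exact ⟨_, ht, rfl⟩
    | n + 1 =>
      rw [hv] at h
      obtain ⟨t, ht⟩ := ihg _ _ h
      refine ⟨t + 2, ?_⟩
      simp only [timedEval, hv, Part.mem_map_iff]
      exact ⟨_, ht, rfl⟩
  | fix f ih =>
    intro v v' h
    simp only [Code.fix_eval] at h
    suffices ∀ acc, ∃ t, (v', t) ∈ PFun.fix (timedStep (timedEval f)) (v, acc) by
      obtain ⟨t, ht⟩ := this 0
      refine ⟨t + (20 * encodeLen v + 20 * encodeLen v' + 20), ?_⟩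
      simp only [timedEval, Part.mem_map_iff]
      exact ⟨_, ht, rfl⟩
    refine PFun.fixInduction' (C := fun v => ∀ acc, ∃ t, (v', t) ∈
        PFun.fix (timedStep (timedEval f)) (v, acc)) h ?_ ?_
    · intro w hw acc
      obtain ⟨b, hb, e⟩ := (Part.mem_map_iff _).1 hw
      split at e
      · rename_i h0
        obtain ⟨t, ht⟩ := ih _ _ hb
        refine ⟨acc + t + (20 * encodeLen b + 20),
          PFun.mem_fix_iff.2 (Or.inl ((Part.mem_map_iff _).2 ⟨(b, t), ht, ?_⟩))⟩
        simp only [h0, decide_true, cond_true]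
        rw [Sum.inl.inj e]
      · cases e
    · intro w w' _ hw hih acc
      obtain ⟨b, hb, e⟩ := (Part.mem_map_iff _).1 hw
      split at e
      · cases e
      · rename_i h0
        obtain ⟨t, ht⟩ := ih _ _ hb
        obtain ⟨u, hu⟩ := hih (acc + t + (20 * encodeLen b + 20))
        refine ⟨u, PFun.mem_fix_iff.2
          (Or.inr ⟨_, (Part.mem_map_iff _).2 ⟨(b, t), ht, ?_⟩, hu⟩)⟩
        simp only [h0, decide_false, cond_false]
        rw [Sum.inr.inj e]

/-- The stacks of `σ`, those from number `d` on being replaced by the ones in a list. -/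
def frame (σ : Stacks) (d : ℕ) (L : List (List Bool)) : Stacks :=
  fun i => if i < d then σ i else L.getD (i - d) []

theorem update_frame {σ : Stacks} {d x : ℕ} {L : List (List Bool)} (hx : x < L.length)
    (v : List Bool) : Function.update (frame σ d L) (d + x) v = frame σ d (L.set x v) := by
  funext i
  by_cases h : i = d + x
  · subst h
    simp [frame, hx]
  · by_cases h' : i < d
    · simp [frame, h, h']
    · have : x ≠ i - d := by omega
      simp [frame, h, h', this]

theorem frame_apply (σ : Stacks) (d x : ℕ) (L : List (List Bool)) :
    frame σ d L (d + x) = L.getD x [] := by simp [frame]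

theorem frame_self (σ : Stacks) (d : ℕ) (L : List (List Bool)) :
    frame σ d L d = L.getD 0 [] := by simp [frame]

theorem frame_zero (σ : Stacks) (L : List (List Bool)) : frame σ 0 L = stk L := by
  funext i; simp [frame, stk]

theorem frame_append (σ : Stacks) (d : ℕ) (L L' : List (List Bool)) :
    frame σ d (L ++ L') = frame (frame σ d L) (d + L.length) L' := by
  funext i
  simp only [frame]
  by_cases h : i < d
  · simp [h, show i < d + L.length by omega]
  · by_cases h' : i - d < L.length
    · simp [h, show i < d + L.length by omega, List.getElem?_append_left h']
    · simp [h, show ¬ i < d + L.length by omega,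
        List.getElem?_append_right (show L.length ≤ i - d by omega), Nat.sub_sub]

theorem frame_append_nil (σ : Stacks) (d : ℕ) (L : List (List Bool)) (m : ℕ) :
    frame σ d (L ++ List.replicate m []) = frame σ d L := by
  funext i
  have := congrFun (stk_append_nil L m) (i - d)
  simp only [stk] at this
  simp only [frame, this]

namespace Runs

variable {σ : Stacks} {d : ℕ} {L : List (List Bool)}

theorem push_frame (x : ℕ) (b : Bool) (hx : x < L.length) :
    Runs (.push (d + x) b) (frame σ d L) (frame σ d (L.set x (b :: L.getD x []))) 1 := by
  rw [← update_frame hx, ← frame_apply σ d]; exact Runs.push _ b _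

theorem pop_frame (x : ℕ) (hx : x < L.length) :
    Runs (.pop (d + x)) (frame σ d L) (frame σ d (L.set x (L.getD x []).tail)) 1 := by
  rw [← update_frame hx, ← frame_apply σ d]; exact Runs.pop _ _

theorem clear_frame (x : ℕ) (hx : x < L.length) :
    Runs (.clear (d + x)) (frame σ d L) (frame σ d (L.set x []))
      (2 * (L.getD x []).length + 1) := by
  rw [← update_frame hx, ← frame_apply σ d]; exact Runs.clear _ _

theorem move_frame {x y : ℕ} (h : x ≠ y) (hx : x < L.length) (hy : y < L.length) :
    Runs (.move (d + x) (d + y)) (frame σ d L)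
      (frame σ d ((L.set y ((L.getD x []).reverse ++ L.getD y [])).set x []))
      (4 * (L.getD x []).length + 1) := by
  rw [← update_frame (by simpa using hx), ← update_frame hy, ← frame_apply σ d,
    ← frame_apply σ d y]
  exact Runs.move (by omega) _

theorem copy_frame {x y t : ℕ} (hxy : x ≠ y) (hxt : x ≠ t) (hyt : y ≠ t)
    (hy : y < L.length) (ht : L.getD t [] = []) :
    Runs (.copy (d + x) (d + y) (d + t)) (frame σ d L)
      (frame σ d (L.set y (L.getD x [] ++ L.getD y []))) (9 * (L.getD x []).length + 2) := by
  rw [← update_frame hy, ← frame_apply σ d, ← frame_apply σ d y]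
  exact Runs.copy (by omega) (by omega) (by omega) _ (by rw [frame_apply, ht])

end Runs

namespace Prog

/-- Move the first number of the list on stack `d` to stack `d + 1`, using stack `d + 2`. -/
def takeNum (d : ℕ) : Prog :=
  .seq (.push (d + 2) true) (.loop (d + 2) (.branch (d + 0) (.pop (d + 2))
    (.seq (.pop (d + 0)) (.pop (d + 2))) (.seq (.pop (d + 0)) (.push (d + 1) true))))

/-- Remove the first number of the list on stack `d + 1`, and the bit on stack `d` if this number
is zero. -/
def testNum (d : ℕ) : Prog := .branch (d + 1) (.pop (d + 0))
  (.seq (.pop (d + 1)) (.pop (d + 0))) (.seq (takeNum (d + 1)) (clear (d + 2)))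

/-- The program that replaces the list of numbers on stack `d` by the value of a code, using
stacks above `d` that are initially empty. -/
def compile : Code → ℕ → Prog
  | .zero', d => .push (d + 0) false
  | .succ, d => .seq (takeNum d) (.seq (clear (d + 0)) (.seq (.push (d + 0) false)
      (.seq (move (d + 1) (d + 0)) (.push (d + 0) true))))
  | .tail, d => .seq (takeNum d) (clear (d + 1))
  | .cons f fs, d =>
      .seq (copy (d + 0) (d + 1) (d + 2)) (.seq (compile f (d + 1))
      (.seq (takeNum (d + 1)) (.seq (clear (d + 1)) (.seq (move (d + 2) (d + 1))
      (.seq (copy (d + 0) (d + 2) (d + 3)) (.seq (clear (d + 0)) (.seq (compile fs (d + 2))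
      (.seq (move (d + 2) (d + 3)) (.seq (move (d + 3) (d + 0)) (.seq (.push (d + 0) false)
        (move (d + 1) (d + 0))))))))))))
  | .comp f g, d => .seq (compile g d) (compile f d)
  | .case f g, d => .branch (d + 0) (compile f d) (.seq (.pop (d + 0)) (compile f d))
      (.seq (.pop (d + 0)) (compile g d))
  | .fix f, d =>
      .seq (copy (d + 0) (d + 1) (d + 2)) (.seq (clear (d + 0)) (.seq (.push (d + 0) true)
      (.seq (.loop (d + 0) (.seq (compile f (d + 1)) (testNum d)))
      (.seq (move (d + 1) (d + 2)) (move (d + 2) (d + 0))))))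

end Prog

theorem encodeList_cons (a : ℕ) (v : List ℕ) :
    encodeList (a :: v) = List.replicate a true ++ false :: encodeList v := by
  simp [encodeList]

theorem encodeLen_cons (a : ℕ) (v : List ℕ) : encodeLen (a :: v) = a + 1 + encodeLen v := by
  rw [← length_encodeList, ← length_encodeList, encodeList_cons]
  simp; ring

theorem headI_le_encodeLen (v : List ℕ) : v.headI ≤ encodeLen v := by
  cases v with
  | nil => simp
  | cons a v => rw [encodeLen_cons]; simp; omega

theorem Runs.takeNum (σ : Stacks) (d : ℕ) (v : List ℕ) :
    Runs (.takeNum d) (frame σ d [encodeList v, [], []])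
      (frame σ d [encodeList v.tail, List.replicate v.headI true, []]) (6 * v.headI + 7) := by
  have key : ∀ (a : ℕ) (l e : List Bool) , Runs (.loop (d + 2) (.branch (d + 0) (.pop (d + 2))
      (.seq (.pop (d + 0)) (.pop (d + 2))) (.seq (.pop (d + 0)) (.push (d + 1) true))))
      (frame σ d [List.replicate a true ++ false :: l, e, [true]])
      (frame σ d [l, List.replicate a true ++ e, []]) (6 * a + 5) := by
    intro a
    induction a with
    | zero =>
      intro l e
      refine (Runs.loop_cons (by simp [frame_apply]) (Runs.branch_false (l := l)
        (by simp [frame_self]) ((Runs.pop_frame 0 (by simp)).seq (Runs.pop_frame 2 (by simp))))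
        (Runs.loop_nil (by simp [frame_apply]))).mono (by omega)
    | succ a ih =>
      intro l e
      refine ((Runs.loop_cons (by simp [frame_apply]) (Runs.branch_true
        (l := List.replicate a true ++ false :: l) (by simp [frame_self, List.replicate_succ])
        ((Runs.pop_frame 0 (by simp)).seq (Runs.push_frame 1 true (by simp))))
        (ih l (true :: e))).mono (by omega)).congr ?_
      simp [List.replicate_succ']
  refine ((Runs.push_frame 2 true (by simp)).seq
    (B₂ := 6 * v.headI + 6) ?_).mono (by omega)
  cases v with
  | nil =>
    exact (Runs.loop_cons (by simp [frame_apply]) (Runs.branch_nil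
        (by simp [frame_self, encodeList]) (Runs.pop_frame 2 (by simp)))
        (Runs.loop_nil (by simp [frame_apply]))).mono (by omega)
  | cons a v =>
    rw [encodeList_cons]
    refine ((key a (encodeList v) []).mono (by simp)).congr ?_
    rw [List.append_nil]
    rfl

/-- A program for the stacks from number `d + k` on, run below other contents of the stacks from
number `d` on. -/
theorem Runs.under {p : Prog} {d t : ℕ} {u u' : List Bool} (σ : Stacks) (pre : List (List Bool))
    (m : ℕ) (h : ∀ σ, Runs p (frame σ (d + pre.length) [u]) (frame σ (d + pre.length) [u']) t) :
    Runs p (frame σ d (pre ++ ([u] ++ List.replicate m [])))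
      (frame σ d (pre ++ ([u'] ++ List.replicate m []))) t := by
  simp only [frame_append σ d pre, frame_append_nil]
  exact h _

theorem timedStep_le {f : Code} {v : List ℕ} {t : ℕ} : ∀ {a : List ℕ × ℕ},
    (v, t) ∈ PFun.fix (timedStep (timedEval f)) a → a.2 ≤ t := by
  intro a h
  refine PFun.fixInduction' (C := fun a => a.2 ≤ t) h ?_ ?_
  · intro w hw
    obtain ⟨b, hb, e⟩ := (Part.mem_map_iff _).1 hw
    cases h0 : decide (b.1.headI = 0) <;> rw [h0] at e
    · cases e
    · have := congrArg Prod.snd (Sum.inl.inj e)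
      simp only at this
      omega
  · intro w w' _ hw hih
    obtain ⟨b, hb, e⟩ := (Part.mem_map_iff _).1 hw
    cases h0 : decide (b.1.headI = 0) <;> rw [h0] at e
    · rw [← Sum.inr.inj e] at hih
      simp only at hih
      omega
    · cases e

theorem Runs.testNum_zero (σ : Stacks) (d : ℕ) (c : List ℕ) (h0 : c.headI = 0) :
    Runs (.testNum d) (frame σ d [[true], encodeList c, [], []])
      (frame σ d [[], encodeList c.tail, [], []]) 3 := by
  match c with
  | [] =>
    exact (Runs.branch_nil (by simp [frame_apply, encodeList])
      (Runs.pop_frame 0 (by simp))).mono (by omega)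
  | 0 :: c =>
    rw [encodeList_cons]
    exact (Runs.branch_false (l := encodeList c) (by simp [frame_apply])
      ((Runs.pop_frame 1 (by simp)).seq (Runs.pop_frame 0 (by simp)))).mono (by omega)
  | (_ + 1) :: _ => simp at h0

theorem Runs.testNum_ne_zero (σ : Stacks) (d : ℕ) (c : List ℕ) (h0 : c.headI ≠ 0) :
    Runs (.testNum d) (frame σ d [[true], encodeList c, [], []])
      (frame σ d [[true], encodeList c.tail, [], []]) (8 * c.headI + 9) := by
  have ht : Runs (.takeNum (d + 1)) (frame σ d [[true], encodeList c, [], []])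
      (frame σ d [[true], encodeList c.tail, List.replicate c.headI true, []])
      (6 * c.headI + 7) := by
    have := Runs.takeNum (frame σ d [[true]]) (d + 1) c
    rwa [show d + 1 = d + [[true]].length from rfl, ← frame_append σ d [[true]],
      ← frame_append σ d [[true]]] at this
  match c with
  | [] => simp at h0
  | 0 :: c => simp at h0
  | (n + 1) :: c =>
    refine (Runs.branch_true (l := encodeList (n :: c))
      (by simp [frame_apply, encodeList_cons, List.replicate_succ])
      (ht.seq (Runs.clear_frame 2 (by simp)))).mono (by simp; omega)

/-- The loop of a compiled fixed point; `a.2` is the time that was spent before the round that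
starts with the list `a.1`. -/
theorem Runs.loop_testNum {f : Code} {p : Prog} {σ : Stacks} {d : ℕ}
    (hf : ∀ v v' t, (v', t) ∈ timedEval f v →
      Runs p (frame σ d [[true], encodeList v, [], []])
        (frame σ d [[true], encodeList v', [], []]) t)
    {a : List ℕ × ℕ} {b : List ℕ} {t₁ : ℕ}
    (ha : (b, t₁) ∈ PFun.fix (timedStep (timedEval f)) a) :
    Runs (.loop (d + 0) (.seq p (.testNum d))) (frame σ d [[true], encodeList a.1, [], []])
      (frame σ d [[], encodeList b, [], []]) (t₁ - a.2 + 1) := by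
  refine PFun.fixInduction' (C := fun a => Runs (.loop (d + 0) (.seq p (.testNum d)))
    (frame σ d [[true], encodeList a.1, [], []])
    (frame σ d [[], encodeList b, [], []]) (t₁ - a.2 + 1)) ha ?_ ?_
  · intro w hw
    obtain ⟨⟨c, u⟩, hc, e⟩ := (Part.mem_map_iff _).1 hw
    cases h0 : decide (c.headI = 0) <;> simp only [h0] at e
    · cases e
    · cases e
      exact ((Runs.loop_cons (by simp [frame_self]) ((hf _ _ _ hc).seq
        (Runs.testNum_zero σ d c (by simpa using h0)))
        (Runs.loop_nil (by simp [frame_self])))).mono (by omega)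
  · intro w w' hw' hw hih
    obtain ⟨⟨c, u⟩, hc, e⟩ := (Part.mem_map_iff _).1 hw
    have hle := timedStep_le hw'
    cases h0 : decide (c.headI = 0) <;> simp only [h0] at e
    · cases e
      have h1 := headI_le_encodeLen c
      exact ((Runs.loop_cons (by simp [frame_self]) ((hf _ _ _ hc).seq
        (Runs.testNum_ne_zero σ d c (by simpa using h0))) hih)).mono
          (by simp only at hle ⊢; omega)
    · cases e

/-- The value is computed within the number of steps that `timedEval` predicts. -/
theorem Runs.compile (c : Code) : ∀ (d : ℕ) (σ : Stacks) (v v' : List ℕ) (t : ℕ),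
    (v', t) ∈ timedEval c v →
    Runs (.compile c d) (frame σ d [encodeList v]) (frame σ d [encodeList v']) t := by
  induction c with
  | zero' =>
    intro d σ v v' t h
    simp only [timedEval, Part.mem_some_iff, Prod.mk.injEq] at h
    obtain ⟨rfl, rfl⟩ := h
    exact (Runs.push_frame 0 false (by simp)).congr (by simp [encodeList_cons])
  | succ =>
    intro d σ v v' t h
    simp only [timedEval, Part.mem_some_iff, Prod.mk.injEq] at h
    obtain ⟨rfl, rfl⟩ := h
    have h1 := headI_le_encodeLen v
    rw [← frame_append_nil σ d [encodeList v] 2, ← frame_append_nil σ d [encodeList _] 2]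
    refine ((Runs.takeNum σ d v).seq ((Runs.clear_frame 0 (by simp)).seq
      ((Runs.push_frame 0 false (by simp)).seq
      ((Runs.move_frame (x := 1) (y := 0) (by simp) (by simp) (by simp)).seq
        (Runs.push_frame 0 true (by simp)))))).mono ?_ |>.congr ?_
    · have : (encodeList v.tail).length ≤ encodeLen v := by
        rw [length_encodeList]; cases v <;> simp [encodeLen_cons]
      simp
      omega
    · simp [encodeList, List.replicate_succ]
  | tail =>
    intro d σ v v' t h
    simp only [timedEval, Part.mem_some_iff, Prod.mk.injEq] at h
    obtain ⟨rfl, rfl⟩ := h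
    have h1 := headI_le_encodeLen v
    rw [← frame_append_nil σ d [encodeList v] 2, ← frame_append_nil σ d [encodeList _] 2]
    refine ((Runs.takeNum σ d v).seq (Runs.clear_frame 1 (by simp))).mono ?_ |>.congr ?_
    · simp
      omega
    · simp
  | cons f fs ihf ihfs =>
    intro d σ v v' t h
    simp only [timedEval, Part.mem_bind_iff, Part.mem_map_iff, Prod.mk.injEq] at h
    obtain ⟨⟨a, t₁⟩, ha, ⟨b, t₂⟩, hb, rfl, rfl⟩ := h
    have h1 := headI_le_encodeLen a
    have hf : Runs (.compile f (d + 1)) (frame σ d [encodeList v, encodeList v ++ [], [], []])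
        (frame σ d [encodeList v, encodeList a, [], []]) t₁ := by
      rw [List.append_nil]
      exact Runs.under σ [encodeList v] 2 fun σ => ihf (d + 1) σ _ _ _ ha
    have hfs : Runs (.compile fs (d + 2)) (frame σ d
        [[], (List.replicate a.headI true).reverse ++ [], encodeList v ++ [], []])
        (frame σ d [[], List.replicate a.headI true, encodeList b, []]) t₂ := by
      rw [List.append_nil, List.append_nil, List.reverse_replicate]
      exact Runs.under σ [[], List.replicate a.headI true] 1 fun σ => ihfs (d + 2) σ _ _ _ hb
    have ht : Runs (.takeNum (d + 1)) (frame σ d [encodeList v, encodeList a, [], []])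
        (frame σ d [encodeList v, encodeList a.tail, List.replicate a.headI true, []])
        (6 * a.headI + 7) := by
      have := Runs.takeNum (frame σ d [encodeList v]) (d + 1) a
      rwa [show d + 1 = d + [encodeList v].length from rfl, ← frame_append σ d [encodeList v],
        ← frame_append σ d [encodeList v]] at this
    rw [← frame_append_nil σ d [encodeList v] 3, ← frame_append_nil σ d [encodeList _] 3]
    refine ((Runs.copy_frame (x := 0) (y := 1) (t := 2) (by simp) (by simp) (by simp) (by simp)
      (by simp)).seq (hf.seq (ht.seq
      ((Runs.clear_frame 1 (by simp)).seq
      ((Runs.move_frame (x := 2) (y := 1) (by simp) (by simp) (by simp)).seq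
      ((Runs.copy_frame (x := 0) (y := 2) (t := 3) (by simp) (by simp) (by simp) (by simp)
      (by simp)).seq ((Runs.clear_frame 0 (by simp)).seq (hfs.seq
      ((Runs.move_frame (x := 2) (y := 3) (by simp) (by simp) (by simp)).seq
      ((Runs.move_frame (x := 3) (y := 0) (by simp) (by simp) (by simp)).seq
      ((Runs.push_frame 0 false (by simp)).seq
      (Runs.move_frame (x := 1) (y := 0) (by simp) (by simp) (by simp))))))))))))).mono ?_
      |>.congr ?_
    · have : (encodeList a.tail).length ≤ encodeLen a := by
        rw [length_encodeList]; cases a <;> simp [encodeLen_cons]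
      simp [length_encodeList] at this ⊢
      omega
    · simp [encodeList_cons]
  | comp f g ihf ihg =>
    intro d σ v v' t h
    simp only [timedEval, Part.mem_bind_iff, Part.mem_map_iff, Prod.mk.injEq] at h
    obtain ⟨⟨a, t₁⟩, ha, ⟨b, t₂⟩, hb, rfl, rfl⟩ := h
    exact (ihg d σ _ _ _ ha).seq (ihf d σ _ _ _ hb)
  | case f g ihf ihg =>
    intro d σ v v' t h
    simp only [timedEval, Part.mem_map_iff, Prod.mk.injEq] at h
    obtain ⟨⟨b, t₁⟩, hb, rfl, rfl⟩ := h
    have hpop := Runs.pop_frame (σ := σ) (d := d) (L := [encodeList v]) 0 (by simp)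
    match v with
    | [] =>
      exact (Runs.branch_nil (by simp [frame_self, encodeList]) (ihf d σ _ _ _ hb)).mono
        (by omega)
    | 0 :: v =>
      refine (Runs.branch_false (l := encodeList v) (by simp [frame_self, encodeList_cons])
        (hpop.seq (B₂ := t₁) ?_)).mono (by omega)
      simpa [encodeList_cons] using ihf d σ _ _ _ hb
    | (a + 1) :: v =>
      refine (Runs.branch_true (l := encodeList (a :: v))
        (by simp [frame_self, encodeList_cons, List.replicate_succ])
        (hpop.seq (B₂ := t₁) ?_)).mono (by omega)
      simpa [encodeList_cons, List.replicate_succ] using ihg d σ _ _ _ hb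
  | fix f ih =>
    intro d σ v v' t h
    simp only [timedEval, Part.mem_map_iff, Prod.mk.injEq] at h
    obtain ⟨⟨b, t₁⟩, hb, rfl, rfl⟩ := h
    have h2 := Runs.loop_testNum (p := .compile f (d + 1)) (σ := σ) (fun v v' t h =>
        Runs.under σ [[true]] 2 fun σ => ih (d + 1) σ _ _ _ h) hb
    rw [← frame_append_nil σ d [encodeList v] 3, ← frame_append_nil σ d [encodeList _] 3]
    refine ((Runs.copy_frame (x := 0) (y := 1) (t := 2) (by simp) (by simp) (by simp) (by simp)
      (by simp)).seq ((Runs.clear_frame 0 (by simp)).seq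
      ((Runs.push_frame 0 true (by simp)).seq
        (Runs.seq (B₁ := t₁ + 1) (σ₂ := frame σ d [[], encodeList b, [], []])
      (by simpa using h2)
      ((Runs.move_frame (x := 1) (y := 2) (by simp) (by simp) (by simp)).seq
      (Runs.move_frame (x := 2) (y := 0) (by simp) (by simp) (by simp))))))).mono ?_ |>.congr ?_
    · simp [length_encodeList]
      omega
    · simp

/-- Every computable function has, for every `d`, a program that replaces the number on stack `d` by
its value, in a computable number of steps, without coins or samples. -/
theorem exists_runs_of_computable {g : ℕ → ℕ} (hg : Computable g) :
    ∃ (p : ℕ → Prog) (t : ℕ → ℕ), Computable t ∧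
      ∀ d σ k, Runs (p d) (frame σ d [encodeList [k]]) (frame σ d [encodeList [g k]]) (t k) := by
  obtain ⟨c, hc⟩ := Code.exists_code (Nat.Partrec'.part_iff₁.2 hg)
  have h1 : ∀ k, ∃ t, ([g k], t) ∈ timedEval c [k] := by
    intro k
    apply exists_mem_timedEval
    have := hc (k ::ᵥ List.Vector.nil)
    change c.eval [k] = _ at this
    rw [this]
    simp
  choose t ht using h1
  refine ⟨Prog.compile c, t, ?_, fun d σ k => Runs.compile c d σ _ _ _ (ht k)⟩
  have h2 : Partrec fun k : ℕ => (timedEval c [k]).map Prod.snd :=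
    Partrec.map ((partrec_timedEval c).comp
      (Computable.list_cons.comp Computable.id (Computable.const [])))
      (Computable.snd.comp Computable.snd)
  exact h2.of_eq fun k => Part.eq_some_iff.2 ((Part.mem_map_iff _).2 ⟨_, ht k, rfl⟩)

/-! ### Locality of programs and monotonicity of time -/

/-- All stacks that occur in a program have a smaller number. -/
def Prog.bound : Prog → ℕ
  | .push x _ => x + 1
  | .pop x => x + 1
  | .toss x => x + 1
  | .query x y => max (x + 1) (y + 1)
  | .seq p q => max p.bound q.bound
  | .branch x p q r => max (x + 1) (max p.bound (max q.bound r.bound))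
  | .loop x p => max (x + 1) p.bound

/-- The state that continues a computation on other stacks, at another time: stacks from number `B`
on are those of `τ`, and the counters are advanced by `a` and `c`. -/
def State.shift (B : ℕ) (τ : Stacks) (a c : ℕ) (s : State) : State :=
  ⟨fun i => if i < B then s.stack i else τ i, s.time + a, s.queries + c⟩

theorem State.shift_tick (B : ℕ) (τ : Stacks) (a c : ℕ) (s : State) :
    (s.shift B τ a c).tick = s.tick.shift B τ a c := by
  simp [State.shift, State.tick]; omega

theorem State.shift_set {B x : ℕ} (hx : x < B) (τ : Stacks) (a c : ℕ) (s : State)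
    (l : List Bool) : (s.shift B τ a c).set x l = (s.set x l).shift B τ a c := by
  simp only [State.shift, State.set, State.mk.injEq, and_true]
  funext i
  by_cases h : i = x
  · subst h; simp [hx]
  · simp [h]

theorem State.shift_stack {B x : ℕ} (hx : x < B) (τ : Stacks) (a c : ℕ) (s : State) :
    (s.shift B τ a c).stack x = s.stack x := by simp [State.shift, hx]

theorem runLoop_shift {B x : ℕ} (hx : x < B) (τ : Stacks) (a c : ℕ)
    (b : State → PMF (Option State))
    (hb : ∀ s, b (s.shift B τ a c) = (b s).map (Option.map (State.shift B τ a c))) :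
    ∀ n s, runLoop x b n (s.shift B τ a c) =
      (runLoop x b n s).map (Option.map (State.shift B τ a c)) := by
  intro n
  induction n with
  | zero => intro s; simp [runLoop, PMF.pure_map]
  | succ n ih =>
    intro s
    unfold runLoop
    rw [State.shift_stack hx, State.shift_tick]
    cases s.stack x with
    | nil => simp [PMF.pure_map]
    | cons u l =>
      simp only
      rw [hb, PMF.bind_map, PMF.map_bind]
      congr 1
      funext o
      cases o with
      | none => simp [PMF.pure_map]
      | some s' => simp [ih]

/-- A program does not see the stacks that do not occur in it, nor the counters. -/
theorem Prog.eval_shift (O : Oracle) (F B : ℕ) (τ : Stacks) (a c : ℕ) :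
    ∀ (p : Prog), p.bound ≤ B → ∀ s : State, p.eval O F (s.shift B τ a c) =
      (p.eval O F s).map (Option.map (State.shift B τ a c)) := by
  intro p
  induction p with
  | push x b =>
    intro h s
    have hx : x < B := h
    simp [Prog.eval, PMF.pure_map, State.shift_tick, State.shift_set hx, State.shift_stack hx]
  | pop x =>
    intro h s
    have hx : x < B := h
    simp [Prog.eval, PMF.pure_map, State.shift_tick, State.shift_set hx, State.shift_stack hx]
  | toss x =>
    intro h s
    have hx : x < B := h
    simp only [Prog.eval, PMF.map_comp]
    congr 1
    funext b
    simp [State.shift_tick, State.shift_set hx, State.shift_stack hx]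
  | query x y =>
    intro h s
    have hx : x < B := (le_max_left _ _).trans h
    have hy : y < B := (le_max_right _ _).trans h
    simp only [Prog.eval, PMF.map_comp]
    congr 1
    funext b
    simp only [State.shift_tick, State.shift_set hx, State.shift_stack hx, State.shift_stack hy,
      State.shift_set hy, Function.comp, Option.map_some]
    congr 1
    simp only [State.shift, State.mk.injEq, true_and]
    omega
  | seq p q ihp ihq =>
    intro h s
    simp only [Prog.bound, max_le_iff] at h
    simp only [Prog.eval]
    rw [ihp h.1, PMF.bind_map, PMF.map_bind]
    congr 1
    funext o
    cases o with
    | none => simp [PMF.pure_map]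
    | some s' => simp [ihq h.2]
  | branch x p q r ihp ihq ihr =>
    intro h s
    simp only [Prog.bound, max_le_iff] at h
    simp only [Prog.eval]
    rw [State.shift_stack (show x < B from h.1), State.shift_tick]
    match s.stack x with
    | [] => exact ihp h.2.1 _
    | false :: _ => exact ihq h.2.2.1 _
    | true :: _ => exact ihr h.2.2.2 _
  | loop x p ih =>
    intro h s
    simp only [Prog.bound, max_le_iff] at h
    exact runLoop_shift h.1 τ a c _ (fun s => ih h.2 s) F s

theorem runLoop_time_le {x : ℕ} {b : State → PMF (Option State)}
    (hb : ∀ s s', some s' ∈ (b s).support → s.time ≤ s'.time) :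
    ∀ n s s', some s' ∈ (runLoop x b n s).support → s.time + 1 ≤ s'.time := by
  intro n
  induction n with
  | zero => intro s s' h; simp [runLoop] at h
  | succ n ih =>
    intro s s' h
    unfold runLoop at h
    cases hs : s.stack x with
    | nil => rw [hs] at h; simp at h; simp [h, State.tick]
    | cons u l =>
      rw [hs] at h
      simp only [PMF.mem_support_bind_iff] at h
      obtain ⟨o, ho, h⟩ := h
      cases o with
      | none => simp at h
      | some s₁ =>
        have h1 := hb _ _ ho
        have h2 := ih _ _ h
        simp only [State.tick] at h1
        omega

/-- Time does not run backwards. -/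
theorem Prog.time_le (O : Oracle) (F : ℕ) : ∀ (p : Prog) (s s' : State),
    some s' ∈ (p.eval O F s).support → s.time ≤ s'.time := by
  intro p
  induction p with
  | push x b => intro s s' h; simp [Prog.eval] at h; simp [h, State.tick, State.set]
  | pop x => intro s s' h; simp [Prog.eval] at h; simp [h, State.tick, State.set]
  | toss x =>
    intro s s' h
    simp only [Prog.eval, PMF.mem_support_map_iff, Option.some.injEq] at h
    obtain ⟨b, _, rfl⟩ := h
    simp [State.tick, State.set]
  | query x y =>
    intro s s' h
    simp only [Prog.eval, PMF.mem_support_map_iff, Option.some.injEq] at h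
    obtain ⟨b, _, rfl⟩ := h
    simp [State.tick, State.set]
  | seq p q ihp ihq =>
    intro s s' h
    simp only [Prog.eval, PMF.mem_support_bind_iff] at h
    obtain ⟨o, ho, h⟩ := h
    cases o with
    | none => simp at h
    | some s₁ => exact (ihp _ _ ho).trans (ihq _ _ h)
  | branch x p q r ihp ihq ihr =>
    intro s s' h
    simp only [Prog.eval] at h
    have : s.tick.time ≤ s'.time := by
      match s.stack x, h with
      | [], h => exact ihp _ _ h
      | false :: _, h => exact ihq _ _ h
      | true :: _, h => exact ihr _ _ h
    exact (Nat.le_succ _).trans this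
  | loop x p ih =>
    intro s s' h
    exact (Nat.le_succ _).trans (runLoop_time_le ih F s s' h)

/-! ### Deterministic programs -/

/-- The computation `b` started with stacks `σ` is cut off, or it stops in a definite state and has
made no stack higher than the number of its steps permits. -/
def Definite (b : Oracle → State → PMF (Option State)) (σ : Stacks) : Prop :=
  (∃ σ' t, (∀ x, (σ' x).length ≤ (σ x).length + t) ∧
    ∀ O time q, b O ⟨σ, time, q⟩ = PMF.pure (some ⟨σ', time + t, q⟩)) ∨
  ∀ O time q, b O ⟨σ, time, q⟩ = PMF.pure none

theorem definite_runLoop {x : ℕ} {b : Oracle → State → PMF (Option State)}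
    (hb : ∀ σ, Definite b σ) : ∀ n σ, Definite (fun O => runLoop x (b O) n) σ := by
  intro n
  induction n with
  | zero => intro σ; exact Or.inr fun _ _ _ => rfl
  | succ n ih =>
    intro σ
    cases hs : σ x with
    | nil =>
      exact Or.inl ⟨σ, 1, fun _ => Nat.le_succ _, fun _ _ _ => by simp [runLoop, hs, State.tick]⟩
    | cons u l =>
      rcases hb σ with ⟨σ₁, t₁, hl₁, h₁⟩ | h₁
      · rcases ih σ₁ with ⟨σ₂, t₂, hl₂, h₂⟩ | h₂
        · refine Or.inl ⟨σ₂, t₁ + t₂ + 1, fun x => ?_, fun O time q => ?_⟩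
          · have := hl₁ x
            have := hl₂ x
            omega
          · simp only [runLoop, hs, State.tick, h₁, PMF.pure_bind, h₂]
            congr 3
            omega
        · exact Or.inr fun O time q => by
            simp only [runLoop, hs, State.tick, h₁, PMF.pure_bind, h₂]
      · exact Or.inr fun O time q => by
          simp only [runLoop, hs, State.tick, h₁, PMF.pure_bind]

/-- Without coins and oracle queries there is exactly one computation, and it does not depend on the
oracle. -/
theorem Prog.IsDeterministic.definite (F : ℕ) : ∀ {p : Prog}, p.IsDeterministic →
    ∀ σ, Definite (fun O => p.eval O F) σ := by
  intro p
  have hset : ∀ (σ : Stacks) (x : ℕ) (l : List Bool), l.length ≤ (σ x).length + 1 →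
      ∀ y, (Function.update σ x l y).length ≤ (σ y).length + 1 := by
    intro σ x l h y
    by_cases hy : y = x
    · subst hy; simpa using h
    · simp [hy]
  induction p with
  | push x b =>
    exact fun _ σ => Or.inl ⟨_, 1, hset σ x (b :: σ x) (by simp), fun _ _ _ => rfl⟩
  | pop x =>
    exact fun _ σ => Or.inl ⟨_, 1, hset σ x (σ x).tail (by simp; omega), fun _ _ _ => rfl⟩
  | toss x => exact fun h => h.elim
  | query x y => exact fun h => h.elim
  | seq p q ihp ihq =>
    intro h σ
    rcases ihp h.1 σ with ⟨σ₁, t₁, hl₁, h₁⟩ | h₁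
    · rcases ihq h.2 σ₁ with ⟨σ₂, t₂, hl₂, h₂⟩ | h₂
      · refine Or.inl ⟨σ₂, t₁ + t₂, fun x => ?_, fun O time q => ?_⟩
        · have := hl₁ x
          have := hl₂ x
          omega
        · simp only [Prog.eval, h₁, PMF.pure_bind, h₂, add_assoc]
      · exact Or.inr fun O time q => by simp only [Prog.eval, h₁, PMF.pure_bind, h₂]
    · exact Or.inr fun O time q => by simp only [Prog.eval, h₁, PMF.pure_bind]
  | branch x p q r ihp ihq ihr =>
    intro h σ
    have key : ∀ p' : Prog, (∀ O time q', (Prog.branch x p q r).eval O F ⟨σ, time, q'⟩ =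
        p'.eval O F ⟨σ, time + 1, q'⟩) → Definite (fun O => p'.eval O F) σ →
        Definite (fun O => (Prog.branch x p q r).eval O F) σ := by
      rintro p' he (⟨σ₁, t₁, hl₁, h₁⟩ | h₁)
      · refine Or.inl ⟨σ₁, t₁ + 1, fun x => (hl₁ x).trans (by omega), fun O time q => ?_⟩
        refine ((he O time q).trans (h₁ O _ q)).trans ?_
        rw [add_assoc, add_comm 1]
      · exact Or.inr fun O time q => (he O time q).trans (h₁ O _ q)
    match hs : σ x with
    | [] => exact key p (fun _ _ _ => by simp [Prog.eval, hs, State.tick]) (ihp h.1 σ)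
    | false :: _ => exact key q (fun _ _ _ => by simp [Prog.eval, hs, State.tick]) (ihq h.2.1 σ)
    | true :: _ => exact key r (fun _ _ _ => by simp [Prog.eval, hs, State.tick]) (ihr h.2.2 σ)
  | loop x p ih => exact fun h σ => definite_runLoop (ih h) F σ

/-- The final stacks of a deterministic program that halts on given inputs. -/
theorem Prog.IsDeterministic.exists_runs {p : Prog} (hp : p.IsDeterministic)
    {inputs : List (List Bool)} {T : ℕ} {Q : State → Prop}
    (h : p.HaltsWithin noOracle inputs T Q) :
    ∃ (σ : Stacks) (t : ℕ), Runs p (stk inputs) σ T ∧ Q ⟨σ, t, 0⟩ ∧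
      (∀ x, (σ x).length ≤ (stk inputs x).length + T) ∧ ∀ x, p.bound ≤ x → σ x = stk inputs x := by
  unfold Prog.HaltsWithin Prog.run at h
  rw [initial_eq_stk] at h
  rcases hp.definite T (stk inputs) with ⟨σ, t, hl, h₁⟩ | h₁
  · simp only at h₁
    rw [h₁] at h
    obtain ⟨s, hs, ht, hQ⟩ := h _ (by rw [PMF.support_pure]; exact Set.mem_singleton _)
    cases hs
    simp only [zero_add] at ht
    refine ⟨σ, 0 + t, ⟨t, ht, fun O F time q hF => ?_⟩, hQ, fun x => (hl x).trans (by omega),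
      fun x hx => ?_⟩
    · rw [Prog.eval_mono O hF _ _ (by rw [h₁]; simp), h₁]
    · have h2 := Prog.eval_shift noOracle T p.bound (stk inputs) 0 0 p le_rfl ⟨stk inputs, 0, 0⟩
      have h3 : State.shift p.bound (stk inputs) 0 0 ⟨stk inputs, 0, 0⟩ = ⟨stk inputs, 0, 0⟩ := by
        simp [State.shift]
      rw [h3, h₁, PMF.pure_map] at h2
      have h4 : (some ⟨σ, 0 + t, 0⟩ : Option State) ∈ (PMF.pure (Option.map
          (State.shift p.bound (stk inputs) 0 0) (some ⟨σ, 0 + t, 0⟩))).support := by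
        rw [← h2]; simp
      simp only [PMF.support_pure, Set.mem_singleton_iff, Option.map_some, Option.some.injEq,
        State.shift, State.mk.injEq] at h4
      have := congrFun h4.1 x
      simpa [Nat.not_lt.2 hx] using this
  · simp only at h₁
    rw [h₁] at h
    obtain ⟨s, hs, -⟩ := h none (by simp)
    cases hs

/-- A program run on other stacks besides its own. -/
theorem Runs.shift {p : Prog} {σ σ' : Stacks} {t : ℕ} (h : Runs p σ σ' t) (B : ℕ)
    (hp : p.bound ≤ B) (τ : Stacks) :
    Runs p (fun i => if i < B then σ i else τ i) (fun i => if i < B then σ' i else τ i) t := by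
  obtain ⟨u, hu, h⟩ := h
  refine ⟨u, hu, fun O F time q hF => ?_⟩
  have h1 := Prog.eval_shift O F B τ 0 0 p hp ⟨σ, time, q⟩
  rw [h O F time q hF, PMF.pure_map] at h1
  exact h1

/-! ### Bounds of the form `f(k) · poly` -/

/-- The functions of the length `n` of the input and the parameter `k` that are at most
`f(k) · poly(n, k)` for a computable non-decreasing `f`. -/
def FPTBound (b : ℕ → ℕ → ℕ) : Prop :=
  ∃ (f : ℕ → ℕ) (c : ℕ), Computable f ∧ Monotone f ∧ ∀ n k, b n k ≤ f k * (n + k + 1) ^ c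

/-- Every computable function is bounded by a computable non-decreasing one. -/
theorem exists_monotone_bound {f : ℕ → ℕ} (hf : Computable f) :
    ∃ g : ℕ → ℕ, Computable g ∧ Monotone g ∧ ∀ k, f k ≤ g k := by
  refine ⟨fun k => ∑ i ∈ Finset.range (k + 1), f i, ?_, ?_, fun k => ?_⟩
  · have h : Computable fun k => Nat.rec (motive := fun _ => ℕ) (f 0)
        (fun n r => r + f (n + 1)) k := by
      have hs : Computable₂ fun (_ : ℕ) (p : ℕ × ℕ) => p.2 + f (p.1 + 1) :=
        (computable_add (Computable.snd.comp Computable.snd)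
          (hf.comp (Computable.succ.comp (Computable.fst.comp Computable.snd)))).to₂
      exact Computable.nat_rec Computable.id (Computable.const (f 0)) hs
    refine h.of_eq fun k => ?_
    induction k with
    | zero => simp
    | succ k ih => rw [Finset.sum_range_succ, ← ih]
  · intro a b hab
    exact Finset.sum_le_sum_of_subset (Finset.range_subset_range.2 (by omega))
  · exact Finset.single_le_sum (f := f) (fun _ _ => Nat.zero_le _) (by simp)

namespace FPTBound

theorem param {g : ℕ → ℕ} (hg : Computable g) : FPTBound fun _ k => g k := by
  obtain ⟨f, hf, hm, h⟩ := exists_monotone_bound hg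
  exact ⟨f, 0, hf, hm, fun n k => by simpa using h k⟩

theorem const (a : ℕ) : FPTBound fun _ _ => a := param (Computable.const a)

theorem size : FPTBound fun n k => n + k + 1 :=
  ⟨fun _ => 1, 1, Computable.const 1, monotone_const, fun n k => by simp⟩

theorem add {b b' : ℕ → ℕ → ℕ} (h : FPTBound b) (h' : FPTBound b') :
    FPTBound fun n k => b n k + b' n k := by
  obtain ⟨f, c, hf, hm, h⟩ := h
  obtain ⟨f', c', hf', hm', h'⟩ := h'
  refine ⟨fun k => f k + f' k, c + c', computable_add hf hf', hm.add hm', fun n k => ?_⟩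
  have h1 : (n + k + 1) ^ c ≤ (n + k + 1) ^ (c + c') := Nat.pow_le_pow_right (by omega) (by omega)
  have h2 : (n + k + 1) ^ c' ≤ (n + k + 1) ^ (c + c') := Nat.pow_le_pow_right (by omega) (by omega)
  rw [add_mul]
  exact add_le_add ((h n k).trans (Nat.mul_le_mul_left _ h1))
    ((h' n k).trans (Nat.mul_le_mul_left _ h2))

theorem mul {b b' : ℕ → ℕ → ℕ} (h : FPTBound b) (h' : FPTBound b') :
    FPTBound fun n k => b n k * b' n k := by
  obtain ⟨f, c, hf, hm, h⟩ := h
  obtain ⟨f', c', hf', hm', h'⟩ := h'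
  refine ⟨fun k => f k * f' k, c + c', computable_mul hf hf', hm.mul' hm', fun n k => ?_⟩
  calc b n k * b' n k ≤ (f k * (n + k + 1) ^ c) * (f' k * (n + k + 1) ^ c') :=
        Nat.mul_le_mul (h n k) (h' n k)
    _ = _ := by rw [pow_add]; ring

theorem pow {b : ℕ → ℕ → ℕ} (h : FPTBound b) (c : ℕ) : FPTBound fun n k => b n k ^ c := by
  induction c with
  | zero => simpa using const 1
  | succ c ih => simpa [pow_succ] using ih.mul h

end FPTBound

/-! ### Closure of the classes under reductions -/

theorem Prog.HaltsWithin.mono {p : Prog} {O : Oracle} {inputs : List (List Bool)} {T T' : ℕ}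
    {Q Q' : State → Prop} (h : p.HaltsWithin O inputs T Q) (hT : T ≤ T')
    (hQ : ∀ s, Q s → Q' s) : p.HaltsWithin O inputs T' Q' := by
  unfold Prog.HaltsWithin Prog.run at *
  intro o ho
  rw [Prog.eval_mono O hT _ _ (fun hn => by obtain ⟨s, hs, -⟩ := h none hn; cases hs)] at ho
  obtain ⟨s, rfl, h1, h2⟩ := h o ho
  exact ⟨s, rfl, h1.trans hT, hQ s h2⟩

theorem Prog.prob_mono {p : Prog} {O : Oracle} {inputs : List (List Bool)} {T T' : ℕ}
    {Q : State → Prop} (h : p.HaltsWithin O inputs T Q) (hT : T ≤ T') (P : State → Prop) :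
    p.prob O inputs T P ≤ p.prob O inputs T' P := by
  unfold Prog.HaltsWithin Prog.run at h
  unfold Prog.prob Prog.run
  rw [Prog.eval_mono O hT _ _ (fun hn => by obtain ⟨s, hs, -⟩ := h none hn; cases hs)]
  refine MeasureTheory.measure_mono ?_
  rintro o ⟨s, rfl, h1, h2⟩
  exact ⟨s, rfl, h1.trans hT, h2⟩

/-- The computation of `q` after a deterministic part that prepares its input. -/
theorem Prog.eval_seq_of_runs {p q : Prog} {O : Oracle} {inputs inputs' : List (List Bool)}
    {B T : ℕ} {Q : State → Prop} (hp : Runs p (stk inputs) (stk inputs') B)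
    (hq : q.HaltsWithin O inputs' T Q) :
    ∃ t ≤ B, (Prog.seq p q).run O inputs (B + T) =
      (q.run O inputs' T).map (Option.map (State.shift (q.bound + 1) (stk inputs') t 0)) := by
  obtain ⟨t, ht, hp⟩ := hp
  refine ⟨t, ht, ?_⟩
  unfold Prog.HaltsWithin at hq
  unfold Prog.run at *
  rw [initial_eq_stk] at *
  simp only [Prog.eval]
  rw [hp O _ 0 0 (by omega), PMF.pure_bind]
  simp only
  have h1 := Prog.eval_shift O (B + T) (q.bound + 1) (stk inputs') t 0 q (by omega)
    ⟨stk inputs', 0, 0⟩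
  have h2 : State.shift (q.bound + 1) (stk inputs') t 0 ⟨stk inputs', 0, 0⟩ =
      ⟨stk inputs', 0 + t, 0⟩ := by
    simp [State.shift]
  rw [h2] at h1
  rw [h1, Prog.eval_mono O (show T ≤ B + T by omega) _ _
    (fun hn => by obtain ⟨s, hs, -⟩ := hq none hn; cases hs)]
  rfl

theorem State.accepts_shift {B : ℕ} (hB : 0 < B) (τ : Stacks) (a c : ℕ) (s : State) :
    (s.shift B τ a c).Accepts ↔ s.Accepts := by
  simp [State.Accepts, State.shift, hB]

/-- Empty the stacks with numbers `2, …, b + 1`. -/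
def Prog.clearFrom : ℕ → Prog
  | 0 => .skip 0
  | b + 1 => .seq (Prog.clearFrom b) (.clear (b + 2))

theorem Runs.clearFrom {σ : Stacks} {M : ℕ} (hM : ∀ x, (σ x).length ≤ M) (b : ℕ) :
    Runs (.clearFrom b) σ (fun i => if 2 ≤ i ∧ i < b + 2 then [] else σ i)
      (b * (2 * M + 1) + 2) := by
  induction b with
  | zero =>
    refine ((Runs.skip 0 σ).mono (by omega)).congr ?_
    funext i
    rw [if_neg (by omega)]
  | succ b ih =>
    refine ((ih.seq (Runs.clear (b + 2) _)).mono ?_).congr ?_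
    · have := hM (b + 2)
      simp only [show ¬ (2 ≤ b + 2 ∧ b + 2 < b + 2) by omega, if_false]
      rw [add_mul, one_mul]
      omega
    · funext i
      by_cases h : i = b + 2
      · subst h; simp
      · simp only [Function.update_of_ne h]
        by_cases h' : 2 ≤ i ∧ i < b + 2
        · rw [if_pos h', if_pos (by omega)]
        · rw [if_neg h', if_neg (by omega)]

theorem length_stk_instanceInputs (x : List Bool) (k i : ℕ) :
    (stk (instanceInputs x k) i).length ≤ x.length + k := by
  match i with
  | 0 => simp [stk, instanceInputs]
  | 1 => simp [stk, instanceInputs, unary]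
  | i + 2 => simp [stk, instanceInputs]

/-- The stacks of the final state of a deterministic program, after clearing all stacks but the
first two. -/
theorem Runs.seq_clearFrom {p : Prog} {x x' : List Bool} {k k' T : ℕ} {σ : Stacks}
    (h : Runs p (stk (instanceInputs x k)) σ T) (h0 : σ 0 = x') (h1 : σ 1 = unary k')
    (hl : ∀ i, (σ i).length ≤ (stk (instanceInputs x k) i).length + T)
    (hb : ∀ i, p.bound ≤ i → σ i = stk (instanceInputs x k) i) :
    Runs (.seq p (.clearFrom p.bound)) (stk (instanceInputs x k)) (stk (instanceInputs x' k'))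
      (T + (p.bound * (2 * (x.length + k + T) + 1) + 2)) := by
  refine (h.seq (Runs.clearFrom (M := x.length + k + T) (fun i => ?_) p.bound)).congr ?_
  · have := hl i
    have := length_stk_instanceInputs x k i
    omega
  · funext i
    match i with
    | 0 => simp [stk, instanceInputs, h0]
    | 1 => simp [stk, instanceInputs, h1]
    | i + 2 =>
      by_cases hi : i + 2 < p.bound + 2
      · rw [if_pos ⟨by omega, hi⟩]; simp [stk, instanceInputs]
      · rw [if_neg (by omega), hb _ (by omega)]; simp [stk, instanceInputs]

/-- The reduction, a tidying phase that leaves nothing but the new instance on the stacks, and the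
algorithm for `L'` are run one after the other. -/
theorem mem_randFPT_of_reduces {L L' : ParamProblem} (h : Reduces L L') (hL : L' ∈ RandFPT) :
    L ∈ RandFPT := by
  obtain ⟨ρ, f, g, c, hdet, hf, hg, hρ⟩ := h
  obtain ⟨q, f', c', hf', hm', hq⟩ := hL
  obtain ⟨f, hf, hfm, hff⟩ := exists_monotone_bound hf
  obtain ⟨g, hg, hgm, hgg⟩ := exists_monotone_bound hg
  have hbT : FPTBound fun n k => f k * (n + k + 1) ^ c := ⟨f, c, hf, hfm, fun _ _ => le_rfl⟩
  have hb : FPTBound fun n k =>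
      (f k * (n + k + 1) ^ c + (ρ.bound * (2 * ((n + k + 1) + f k * (n + k + 1) ^ c) + 1) + 2)) +
        f' (g k) * ((n + k + 1) + f k * (n + k + 1) ^ c + g k + 1) ^ c' :=
    ((hbT.add (((FPTBound.const _).mul (((FPTBound.const 2).mul
      (FPTBound.size.add hbT)).add (FPTBound.const 1))).add (FPTBound.const 2))).add
      ((FPTBound.param (hf'.comp hg)).mul ((((FPTBound.size.add hbT).add
        (FPTBound.param hg)).add (FPTBound.const 1)).pow c')))
  obtain ⟨F, C, hF, hFm, hFC⟩ := hb
  refine ⟨.seq (.seq ρ (.clearFrom ρ.bound)) q, F, C, hF, hFm, fun x k => ?_⟩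
  obtain ⟨σ, t, hr, ⟨x', k', h0, h1, hiff, hk', -⟩, hl, hbd⟩ := hdet.exists_runs
    ((hρ x k).mono (Nat.mul_le_mul_right _ (hff k)) fun s h => h)
  simp only at h0 h1
  have hr' := hr.seq_clearFrom h0 h1 hl hbd
  obtain ⟨hq1, hq2⟩ := hq x' k'
  have hx' : x'.length ≤ (x.length + k + 1) + f k * (x.length + k + 1) ^ c := by
    have := hl 0
    rw [h0] at this
    simp [stk, instanceInputs] at this
    omega
  have hT : (f k * (x.length + k + 1) ^ c +
      (ρ.bound * (2 * (x.length + k + f k * (x.length + k + 1) ^ c) + 1) + 2)) +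
      f' k' * (x'.length + k' + 1) ^ c' ≤ F k * (x.length + k + 1) ^ C := by
    refine le_trans ?_ (hFC x.length k)
    have := hk'.trans (hgg k)
    simp only
    gcongr ?_ + ?_ * (?_ + ?_ + 1) ^ c'
    · exact Nat.add_le_add_left (Nat.add_le_add_right (Nat.mul_le_mul_left _ (by omega)) _) _
    · exact hm' this
  obtain ⟨u, hu, he⟩ := Prog.eval_seq_of_runs (O := noOracle) hr' hq1
  have hh : (Prog.seq (.seq ρ (.clearFrom ρ.bound)) q).HaltsWithin noOracle (instanceInputs x k)
      ((f k * (x.length + k + 1) ^ c +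
      (ρ.bound * (2 * (x.length + k + f k * (x.length + k + 1) ^ c) + 1) + 2)) +
      f' k' * (x'.length + k' + 1) ^ c') fun s => s.Accepts → (x, k) ∈ L := by
    intro o ho
    rw [he, PMF.mem_support_map_iff] at ho
    obtain ⟨o', ho', rfl⟩ := ho
    obtain ⟨s, rfl, hs, hs'⟩ := hq1 o' ho'
    refine ⟨_, rfl, ?_, fun ha => hiff.2 (hs' ?_)⟩
    · simp only [State.shift]; omega
    · rwa [State.accepts_shift (by omega)] at ha
  refine ⟨hh.mono hT fun _ h => h, fun hx => ?_⟩
  refine (hq2 (hiff.1 hx)).trans (le_trans ?_ (Prog.prob_mono hh hT State.Accepts))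
  unfold Prog.prob
  rw [he, PMF.toOuterMeasure_map_apply]
  refine MeasureTheory.measure_mono ?_
  rintro o ⟨s, rfl, h1, h2⟩
  refine ⟨_, rfl, ?_, ?_⟩
  · simp only [State.shift]; omega
  · rwa [State.accepts_shift (by omega)]

theorem encodeRows_nil_mem_hittingSet : (encodeRows 0 [], 0) ∈ hittingSet :=
  ⟨0, [], rfl, ∅, by simp, by simp⟩

theorem nil_notMem_hittingSet : (([] : List Bool), 0) ∉ hittingSet := by
  rintro ⟨n, F, h, -⟩
  simp [encodeRows] at h

/-- A decision procedure turns into a reduction to Hitting Set, by producing a trivial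
instance. -/
theorem fpt_subset_w2 : FPT ⊆ W2 := by
  rintro L ⟨p, f, c, hdet, hf, hfm, hp⟩
  let fin : Prog := .branch 0 (.clear 1) (.seq (.clear 0) (.clear 1))
    (.seq (.clear 0) (.seq (.clear 1) (.seq (.push 0 false) (.push 0 false))))
  have hbT : FPTBound fun n k => f k * (n + k + 1) ^ c := ⟨f, c, hf, hfm, fun _ _ => le_rfl⟩
  obtain ⟨F, C, hF, hFm, hFC⟩ := hbT.add (((FPTBound.const 4).mul
    (FPTBound.size.add hbT)).add (FPTBound.const 6))
  refine ⟨.seq p fin, F, fun _ => 0, C,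
    ⟨hdet, by simp [fin, Prog.IsDeterministic, Prog.clear]⟩, hF, Computable.const 0,
    fun x k => ?_⟩
  obtain ⟨σ, t, hr, hQ, hl, -⟩ := hdet.exists_runs (hp x k)
  have hlen : ∀ i, (σ i).length ≤ x.length + k + f k * (x.length + k + 1) ^ c := fun i =>
    (hl i).trans (Nat.add_le_add_right (length_stk_instanceInputs x k i) _)
  have key : ∃ (σ' : Stacks) (x' : List Bool), Runs fin σ σ'
      (2 * (σ 0).length + 2 * (σ 1).length + 6) ∧ σ' 0 = x' ∧ σ' 1 = [] ∧
      ((x, k) ∈ L ↔ (x', 0) ∈ hittingSet) := by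
    match h : σ 0 with
    | [] =>
      refine ⟨_, [], (Runs.branch_nil h (Runs.clear 1 σ)).mono (by simp), by simp [h],
        by simp, ?_⟩
      rw [← hQ]
      simp [State.Accepts, h, nil_notMem_hittingSet]
    | false :: l =>
      refine ⟨_, [], (Runs.branch_false h ((Runs.clear 0 σ).seq (Runs.clear 1 _))).mono
        (by simp [h]; omega), by simp, by simp, ?_⟩
      rw [← hQ]
      simp [State.Accepts, h, nil_notMem_hittingSet]
    | true :: l =>
      refine ⟨_, [false, false], (Runs.branch_true h ((Runs.clear 0 σ).seq ((Runs.clear 1 _).seq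
        ((Runs.push 0 false _).seq (Runs.push 0 false _))))).mono
        (by simp [h]; omega), by simp, by simp, ?_⟩
      rw [← hQ]
      simp only [State.Accepts, h, List.head?_cons, true_iff]
      exact encodeRows_nil_mem_hittingSet
  obtain ⟨σ', x', hr', h0, h1, hiff⟩ := key
  refine haltsWithin_of_runs (hr.seq hr') (le_trans ?_ (hFC x.length k)) fun t q =>
    ⟨x', 0, h0, by simpa [unary] using h1, hiff, le_rfl, trivial⟩
  have := hlen 0
  have := hlen 1
  simp only
  omega

/-! ### Comparison of random computations -/

/-- Expectation of a function with values in `[0, ∞]`. -/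
noncomputable def ev {α : Type*} (μ : PMF α) (φ : α → ENNReal) : ENNReal := ∑' a, μ a * φ a

theorem ev_pure {α : Type*} (a : α) (φ : α → ENNReal) : ev (PMF.pure a) φ = φ a := by
  unfold ev
  rw [tsum_eq_single a]
  · simp
  · intro b hb; simp [PMF.pure_apply, hb]

theorem ev_bind {α β : Type*} (μ : PMF α) (f : α → PMF β) (φ : β → ENNReal) :
    ev (μ.bind f) φ = ev μ fun a => ev (f a) φ := by
  unfold ev
  simp only [PMF.bind_apply, ← ENNReal.tsum_mul_right, ← ENNReal.tsum_mul_left]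
  rw [ENNReal.tsum_comm]
  simp only [mul_assoc]

theorem ev_map {α β : Type*} (μ : PMF α) (f : α → β) (φ : β → ENNReal) :
    ev (μ.map f) φ = ev μ fun a => φ (f a) := by
  rw [← PMF.bind_pure_comp, ev_bind]
  simp [ev_pure]

theorem ev_mono {α : Type*} {μ : PMF α} {φ ψ : α → ENNReal} (h : ∀ a ∈ μ.support, φ a ≤ ψ a) :
    ev μ φ ≤ ev μ ψ := by
  refine ENNReal.tsum_le_tsum fun a => ?_
  by_cases ha : a ∈ μ.support
  · exact mul_le_mul_right (h a ha) _
  · rw [PMF.mem_support_iff, not_not] at ha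
    simp [ha]

theorem ev_indicator {α : Type*} (μ : PMF α) (S : Set α) :
    ev μ (S.indicator 1) = μ.toOuterMeasure S := by
  rw [PMF.toOuterMeasure_apply]
  refine tsum_congr fun a => ?_
  by_cases h : a ∈ S <;> simp [h]

/-- Whatever has some probability under `μ` has at least this probability under `ν`, if outcomes of
`μ` are replaced by outcomes of `ν` that are related to them.  (This holds if and only if there is a
coupling of `μ` and `ν` that is concentrated on related pairs.) -/
def Dominated {α β : Type*} (R : α → β → Prop) (μ : PMF α) (ν : PMF β) : Prop :=
  ∀ (φ : α → ENNReal) (ψ : β → ENNReal),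
    (∀ a ∈ μ.support, ∀ b ∈ ν.support, R a b → φ a ≤ ψ b) → ev μ φ ≤ ev ν ψ

namespace Dominated

variable {α β γ δ : Type*} {R : α → β → Prop} {R' : γ → δ → Prop}

theorem pure {a : α} {b : β} (h : R a b) : Dominated R (PMF.pure a) (PMF.pure b) := by
  intro φ ψ hφ
  rw [ev_pure, ev_pure]
  exact hφ a (by simp) b (by simp) h

theorem bind {μ : PMF α} {ν : PMF β} {f : α → PMF γ} {g : β → PMF δ} (h : Dominated R μ ν)
    (hf : ∀ a ∈ μ.support, ∀ b ∈ ν.support, R a b → Dominated R' (f a) (g b)) :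
    Dominated R' (μ.bind f) (ν.bind g) := by
  intro φ ψ hφ
  rw [ev_bind, ev_bind]
  refine h _ _ fun a ha b hb hab => hf a ha b hb hab φ ψ fun c hc d hd => hφ c ?_ d ?_
  · exact (PMF.mem_support_bind_iff _ _ _).2 ⟨a, ha, hc⟩
  · exact (PMF.mem_support_bind_iff _ _ _).2 ⟨b, hb, hd⟩

theorem map {μ : PMF α} {f : α → γ} {g : α → δ} (h : ∀ a, R' (f a) (g a)) :
    Dominated R' (μ.map f) (μ.map g) := by
  intro φ ψ hφ
  rw [ev_map, ev_map]
  refine ev_mono fun a ha => hφ _ ?_ _ ?_ (h a)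
  · exact (PMF.mem_support_map_iff _ _ _).2 ⟨a, ha, rfl⟩
  · exact (PMF.mem_support_map_iff _ _ _).2 ⟨a, ha, rfl⟩

end Dominated

/-! ### Simulation of a learning algorithm under a clock -/

/-- The stacks of a simulation: below 30 there are the stacks `L` of the simulating program and,
with number 20, a clock showing `n`; above there are the stacks `σ` of the simulated program. -/
def joint (L : Stacks) (n : ℕ) (σ : Stacks) : Stacks :=
  fun i => if i < 30 then (if i = 20 then unary n else L i) else σ (i - 30)

section joint

variable (L : Stacks) (n : ℕ) (σ : Stacks)

theorem joint_clock : joint L n σ 20 = unary n := rfl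

theorem joint_low {x : ℕ} (hx : x < 30) (hx' : x ≠ 20) : joint L n σ x = L x := by
  simp [joint, hx, hx']

theorem joint_high (x : ℕ) : joint L n σ (x + 30) = σ x := by simp [joint]

theorem update_joint_clock (m : ℕ) :
    Function.update (joint L n σ) 20 (unary m) = joint L m σ := by
  funext i
  by_cases h : i = 20
  · subst h; simp [joint]
  · simp [joint, h]

theorem update_joint_low {x : ℕ} (hx : x < 30) (hx' : x ≠ 20) (l : List Bool) :
    Function.update (joint L n σ) x l = joint (Function.update L x l) n σ := by
  funext i
  by_cases h : i = x
  · subst h; simp [joint, hx, hx']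
  · simp [joint, h]

theorem update_joint_high (x : ℕ) (l : List Bool) :
    Function.update (joint L n σ) (x + 30) l = joint L n (Function.update σ x l) := by
  funext i
  by_cases h : i = x + 30
  · subst h; simp [joint]
  · by_cases h' : i < 30
    · simp [joint, h, h']
    · have : i - 30 ≠ x := by omega
      simp [joint, h, h', this]

theorem joint_inj {L : Stacks} {n m : ℕ} {σ τ : Stacks} (h : joint L n σ = joint L m τ) :
    n = m ∧ σ = τ := by
  refine ⟨?_, funext fun i => ?_⟩
  · have := congrArg List.length (congrFun h 20)
    simpa [joint, unary] using this
  · have := congrFun h (i + 30)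
    simpa [joint] using this

theorem Runs.pop_clock : Runs (.pop 20) (joint L n σ) (joint L (n - 1) σ) 1 := by
  refine (Runs.pop 20 _).congr ?_
  rw [joint_clock, ← update_joint_clock L n σ (n - 1)]
  simp [unary]

end joint

/-- Push a bit on stack 21 if neither stack `x` of the simulated program nor the clock is empty,
after one tick of the clock. -/
def Prog.test (x : ℕ) : Prog :=
  .seq (.pop 20) (.branch 20 (.skip 21) (.skip 21)
    (.branch (x + 30) (.skip 21) (.push 21 true) (.push 21 true)))

/-- The simulation of a program, where `smp` leaves a positive sample point on stack 9.  Each step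
takes one tick off the clock, and no loop goes on when the clock has run down. -/
def Prog.simulate (smp : Prog) : Prog → Prog
  | .push x b => .seq (.pop 20) (.push (x + 30) b)
  | .pop x => .seq (.pop 20) (.pop (x + 30))
  | .toss x => .seq (.pop 20) (.toss (x + 30))
  | .query x y => .seq (.pop 20) (.seq smp (.seq (.move 9 11) (.seq (.move 11 (x + 30))
      (.push (y + 30) true))))
  | .seq p q => .seq (simulate smp p) (simulate smp q)
  | .branch x p q r => .seq (.pop 20)
      (.branch (x + 30) (simulate smp p) (simulate smp q) (simulate smp r))
  | .loop x p => .seq (.test x) (.loop 21 (.seq (.pop 21) (.seq (simulate smp p) (.test x))))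

/-- A factor in the running time of the simulation: number of steps per tick of the clock and per
step of the sampling program. -/
def simCost : Prog → ℕ
  | .push _ _ => 2
  | .pop _ => 2
  | .toss _ => 2
  | .query _ _ => 10
  | .seq p q => simCost p + simCost q
  | .branch _ p q r => simCost p + simCost q + simCost r + 2
  | .loop _ p => 2 * simCost p + 14

/-- The computation is never cut off, and stops by time `T`. -/
def Halts (T : ℕ) (μ : PMF (Option State)) : Prop :=
  ∀ o ∈ μ.support, ∃ s, o = some s ∧ s.time ≤ T

/-- If a composed computation is never cut off, neither are its two parts. -/
theorem Halts.of_bind {T : ℕ} {μ : PMF (Option State)} {k : Option State → PMF (Option State)}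
    (h : Halts T (μ.bind k)) (h0 : k none = PMF.pure none)
    (hk : ∀ s s', some s' ∈ (k (some s)).support → s.time ≤ s'.time) :
    Halts T μ ∧ ∀ o ∈ μ.support, Halts T (k o) := by
  have hsup : ∀ o ∈ μ.support, Halts T (k o) := fun o ho o' ho' =>
    h o' ((PMF.mem_support_bind_iff _ _ _).2 ⟨o, ho, ho'⟩)
  refine ⟨fun o ho => ?_, hsup⟩
  cases o with
  | none =>
    obtain ⟨s', hs', -⟩ := hsup none ho none (by rw [h0]; simp)
    cases hs'
  | some s₁ =>
    obtain ⟨o', ho'⟩ := (k (some s₁)).support_nonempty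
    obtain ⟨s', rfl, hs'⟩ := hsup _ ho o' ho'
    exact ⟨s₁, rfl, (hk _ _ ho').trans hs'⟩

/-- The stacks after a test.  The test takes one tick off the clock, so the loop goes on only if the
clock shows at least `2` before. -/
def afterTest (L : Stacks) (n : ℕ) (σ : Stacks) (x : ℕ) : Stacks :=
  if 2 ≤ n ∧ σ x ≠ [] then Function.update (joint L (n - 1) σ) 21 [true] else joint L (n - 1) σ

theorem Runs.test {L : Stacks} (hL : L 21 = []) (n : ℕ) (σ : Stacks) (x : ℕ) :
    Runs (.test x) (joint L n σ) (afterTest L n σ x) 5 := by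
  have h1 := Runs.pop_clock L n σ
  match n with
  | 0 =>
    exact ((h1.seq (Runs.branch_nil (by simp [joint_clock, unary]) (Runs.skip 21 _))).mono
      (by omega)).congr (by simp [afterTest])
  | 1 =>
    exact ((h1.seq (Runs.branch_nil (by simp [joint_clock, unary]) (Runs.skip 21 _))).mono
      (by omega)).congr (by simp [afterTest])
  | n + 2 =>
    have hp := Runs.push 21 true (joint L (n + 1) σ)
    rw [joint_low L _ σ (x := 21) (by omega) (by omega), hL] at hp
    have h2 : Runs (.branch (x + 30) (.skip 21) (.push 21 true) (.push 21 true))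
        (joint L (n + 1) σ) (afterTest L (n + 2) σ x) 3 := by
      match h : σ x with
      | [] =>
        exact (Runs.branch_nil (by rw [joint_high, h]) (Runs.skip 21 _)).congr
          (by simp [afterTest, h])
      | false :: l =>
        exact ((Runs.branch_false (by rw [joint_high, h]) hp).mono (by omega)).congr
          (by simp [afterTest, h])
      | true :: l =>
        exact ((Runs.branch_true (by rw [joint_high, h]) hp).mono (by omega)).congr
          (by simp [afterTest, h])
    exact (h1.seq (Runs.branch_true (l := unary n)
      (by simp [joint_clock, unary, List.replicate_succ]) h2)).mono (by omega)

/-- The sampling program `smp` of a simulation, in which the stacks 9, 11 and 21 are free, produces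
the point `X w`, for `w` distributed according to `μ`, in at most `Q` steps, and touches no other
stack. -/
structure Sampler (L : Stacks) (smp : Prog) (μ : PMF (List Bool)) (X : List Bool → List Bool)
    (Q : ℕ) : Prop where
  nine : L 9 = []
  eleven : L 11 = []
  flag : L 21 = []
  length_le : ∀ w, (X w).length ≤ Q
  eval : ∀ n σ F, Q ≤ F → ∃ u : List Bool → ℕ, (∀ w, u w ≤ Q) ∧
    ∀ time q, smp.eval noOracle F ⟨joint L n σ, time, q⟩ =
      μ.map fun w => some ⟨joint (Function.update L 9 (X w)) n σ, time + u w, q⟩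

/-- Outcomes of the simulated program and of the simulation that correspond to each other: the
former has the stacks `L` available, and enough time is left on the clock. -/
def Matches (L : Stacks) (T : ℕ) (o o' : Option State) : Prop :=
  ∃ s s' n, o = some s ∧ o' = some s' ∧ s'.stack = joint L n s.stack ∧ T + 1 ≤ n + s.time

/-- The simulation `ν` of a computation from a state with clock `n` at time `time` stops in
at most `b` steps per tick of the clock, and keeps the stacks of the simulating program. -/
def Safe (L : Stacks) (n time b : ℕ) (ν : PMF (Option State)) : Prop :=
  ∀ o ∈ ν.support, ∃ m ≤ n, ∃ σ t q, o = some ⟨joint L m σ, t, q⟩ ∧ t ≤ time + b * (n - m + 1)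

/-- The simulation of a program is safe, and correct if the program halts before the clock has run
down. -/
def Simulated (L : Stacks) (O : Oracle) (p p' : Prog) (K : ℕ) : Prop :=
  ∀ F n σ time q, K * (n + 1) ≤ F →
    Safe L n time K (p'.eval noOracle F ⟨joint L n σ, time, q⟩) ∧
    ∀ T s, s.stack = σ → T + 1 ≤ n + s.time → Halts T (p.eval O T s) →
      Dominated (Matches L T) (p.eval O T s) (p'.eval noOracle F ⟨joint L n σ, time, q⟩)

theorem Simulated.mono {L : Stacks} {O : Oracle} {p p' : Prog} {K K' : ℕ}
    (h : Simulated L O p p' K) (hK : K ≤ K') : Simulated L O p p' K' := by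
  intro F n σ time q hF
  obtain ⟨h1, h2⟩ := h F n σ time q ((Nat.mul_le_mul_right _ hK).trans hF)
  refine ⟨fun o ho => ?_, h2⟩
  obtain ⟨m, hm, σ', t, q', rfl, ht⟩ := h1 o ho
  exact ⟨m, hm, σ', t, q', rfl, ht.trans (Nat.add_le_add_left (Nat.mul_le_mul_right _ hK) _)⟩

/-- A single step of the simulated program. -/
theorem Simulated.of_map {L : Stacks} {O : Oracle} {p p' : Prog} {K : ℕ} {α : Type} (μ : PMF α)
    (f : α → Stacks → Stacks)
    (hp : ∀ T s, ∃ q : ℕ, p.eval O T s = μ.map fun a => some ⟨f a s.stack, s.time + 1, q⟩)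
    (hp' : ∀ F n σ time q, K ≤ F → ∃ u : α → ℕ, (∀ a, u a ≤ K) ∧
      p'.eval noOracle F ⟨joint L n σ, time, q⟩ =
        μ.map fun a => some ⟨joint L (n - 1) (f a σ), time + u a, q⟩) :
    Simulated L O p p' K := by
  intro F n σ time q hF
  obtain ⟨u, hu, he⟩ := hp' F n σ time q (le_trans (Nat.le_mul_of_pos_right _ (by omega)) hF)
  rw [he]
  refine ⟨fun o ho => ?_, fun T s hs hT _ => ?_⟩
  · obtain ⟨a, -, rfl⟩ := (PMF.mem_support_map_iff _ _ _).1 ho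
    refine ⟨n - 1, by omega, _, _, _, rfl, Nat.add_le_add_left ((hu a).trans ?_) _⟩
    exact Nat.le_mul_of_pos_right _ (by omega)
  · obtain ⟨c, hc⟩ := hp T s
    rw [hc]
    refine Dominated.map fun a => ⟨_, _, n - 1, rfl, rfl, ?_, ?_⟩
    · simp only [hs]
    · simp only; omega

theorem Simulated.of_runs {L : Stacks} {O : Oracle} {p p' : Prog} {K : ℕ} (f : Stacks → Stacks)
    (hp : ∀ T s, ∃ q : ℕ, p.eval O T s = PMF.pure (some ⟨f s.stack, s.time + 1, q⟩))
    (hp' : ∀ n σ, Runs p' (joint L n σ) (joint L (n - 1) (f σ)) K) :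
    Simulated L O p p' K := by
  refine Simulated.of_map (PMF.pure ()) (fun _ => f) (fun T s => ?_) fun F n σ time q hF => ?_
  · obtain ⟨c, hc⟩ := hp T s
    exact ⟨c, by rw [hc, PMF.pure_map]⟩
  · obtain ⟨t, ht, h⟩ := hp' n σ
    exact ⟨fun _ => t, fun _ => ht, by rw [h noOracle F time q hF, PMF.pure_map]⟩

theorem Simulated.seq {L : Stacks} {O : Oracle} {p q p' q' : Prog} {K K' : ℕ}
    (hp : Simulated L O p p' K) (hq : Simulated L O q q' K') :
    Simulated L O (.seq p q) (.seq p' q') (K + K') := by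
  intro F n σ time c hF
  rw [add_mul] at hF
  obtain ⟨h1, h2⟩ := hp F n σ time c (by omega)
  have hF' : ∀ m ≤ n, K' * (m + 1) ≤ F := fun m hm =>
    (Nat.mul_le_mul_left _ (by omega)).trans (by omega : K' * (n + 1) ≤ F)
  refine ⟨fun o ho => ?_, fun T s hs hT hh => ?_⟩
  · simp only [Prog.eval, PMF.mem_support_bind_iff] at ho
    obtain ⟨o₁, ho₁, ho⟩ := ho
    obtain ⟨m, hm, σ₁, t₁, c₁, rfl, ht₁⟩ := h1 o₁ ho₁
    obtain ⟨m', hm', σ₂, t₂, c₂, rfl, ht₂⟩ := (hq F m σ₁ t₁ c₁ (hF' m hm)).1 o ho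
    refine ⟨m', hm'.trans hm, σ₂, t₂, c₂, rfl, ?_⟩
    have e1 : K * (n - m + 1) ≤ K * (n - m' + 1) := Nat.mul_le_mul_left _ (by omega)
    have e2 : K' * (m - m' + 1) ≤ K' * (n - m' + 1) := Nat.mul_le_mul_left _ (by omega)
    rw [add_mul]
    omega
  · simp only [Prog.eval] at hh ⊢
    obtain ⟨hh1, hh2⟩ := hh.of_bind rfl fun s s' h => Prog.time_le O T q s s' h
    refine Dominated.bind (h2 T s hs hT hh1) ?_
    · rintro o ho o' ho' ⟨s₁, s₁', m, rfl, rfl, hst, hT'⟩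
      obtain ⟨m', hm', σ₁, t₁, c₁, he, -⟩ := h1 _ ho'
      cases he
      simp only at hst ⊢
      obtain ⟨rfl, rfl⟩ := joint_inj hst
      exact (hq F m' _ t₁ c₁ (hF' m' hm')).2 T s₁ rfl hT' (hh2 _ ho)

theorem Simulated.branch {L : Stacks} {O : Oracle} {x : ℕ} {p q r p' q' r' : Prog} {K : ℕ}
    (hp : Simulated L O p p' K) (hq : Simulated L O q q' K) (hr : Simulated L O r r' K) :
    Simulated L O (.branch x p q r) (.seq (.pop 20) (.branch (x + 30) p' q' r')) (K + 2) := by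
  intro F n σ time c hF
  have key : ∀ P P' : Prog, Simulated L O P P' K →
      (∀ T s, s.stack = σ → (Prog.branch x p q r).eval O T s = P.eval O T s.tick) →
      (Prog.seq (.pop 20) (.branch (x + 30) p' q' r')).eval noOracle F ⟨joint L n σ, time, c⟩ =
        P'.eval noOracle F ⟨joint L (n - 1) σ, time + 1 + 1, c⟩ →
      Safe L n time (K + 2) ((Prog.seq (.pop 20) (.branch (x + 30) p' q' r')).eval noOracle F
        ⟨joint L n σ, time, c⟩) ∧
      ∀ T s, s.stack = σ → T + 1 ≤ n + s.time → Halts T ((Prog.branch x p q r).eval O T s) →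
        Dominated (Matches L T) ((Prog.branch x p q r).eval O T s)
          ((Prog.seq (.pop 20) (.branch (x + 30) p' q' r')).eval noOracle F
            ⟨joint L n σ, time, c⟩) := by
    intro P P' h he he'
    rw [he']
    obtain ⟨h1, h2⟩ := h F (n - 1) σ (time + 1 + 1) c
      (le_trans (Nat.mul_le_mul (by omega) (by omega)) hF)
    refine ⟨fun o ho => ?_, fun T s hs hT hh => ?_⟩
    · obtain ⟨m, hm, σ₁, t₁, c₁, rfl, ht⟩ := h1 o ho
      refine ⟨m, by omega, σ₁, t₁, c₁, rfl, ht.trans ?_⟩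
      have e1 : K * (n - 1 - m + 1) ≤ K * (n - m + 1) := Nat.mul_le_mul_left _ (by omega)
      rw [add_mul]
      omega
    · rw [he T s hs] at hh ⊢
      exact h2 T s.tick hs (by simp only [State.tick]; omega) hh
  have hpop : (Prog.pop 20).eval noOracle F ⟨joint L n σ, time, c⟩ =
      PMF.pure (some ⟨joint L (n - 1) σ, time + 1, c⟩) := by
    simp only [Prog.eval, State.set, State.tick, joint_clock]
    rw [← update_joint_clock L n σ (n - 1)]
    simp [unary]
  have he' : (Prog.seq (.pop 20) (.branch (x + 30) p' q' r')).eval noOracle F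
      ⟨joint L n σ, time, c⟩ = (Prog.branch (x + 30) p' q' r').eval noOracle F
        ⟨joint L (n - 1) σ, time + 1, c⟩ := by
    conv_lhs => unfold Prog.eval
    rw [hpop, PMF.pure_bind]
  match h : σ x with
  | [] =>
    refine key p p' hp (fun T s hs => by simp [Prog.eval, hs, h]) ?_
    rw [he']; simp [Prog.eval, joint_high, h, State.tick]
  | false :: l =>
    refine key q q' hq (fun T s hs => by simp [Prog.eval, hs, h]) ?_
    rw [he']; simp [Prog.eval, joint_high, h, State.tick]
  | true :: l =>
    refine key r r' hr (fun T s hs => by simp [Prog.eval, hs, h]) ?_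
    rw [he']; simp [Prog.eval, joint_high, h, State.tick]

theorem runLoop_nil {x : ℕ} {b : State → PMF (Option State)} {j : ℕ} {s : State}
    (h : s.stack x = []) : runLoop x b (j + 1) s = PMF.pure (some s.tick) := by
  unfold runLoop
  rw [h]

theorem runLoop_cons {x : ℕ} {b : State → PMF (Option State)} {j : ℕ} {s : State}
    (h : s.stack x ≠ []) : runLoop x b (j + 1) s = (b s.tick).bind fun o =>
      match o with
      | none => PMF.pure none
      | some s' => runLoop x b j s' := by
  obtain ⟨a, l, h⟩ := List.exists_cons_of_ne_nil h
  conv_lhs => unfold runLoop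
  rw [h]

/-- One round of the simulation of a loop. -/
theorem runLoop_simulate {L : Stacks} (hL : L 21 = []) {x : ℕ} {p' : Prog} {F j n time c : ℕ}
    {σ : Stacks} (h : 2 ≤ n ∧ σ x ≠ []) :
    runLoop 21 ((Prog.seq (.pop 21) (.seq p' (.test x))).eval noOracle F) (j + 1)
        ⟨afterTest L n σ x, time, c⟩ =
      (p'.eval noOracle F ⟨joint L (n - 1) σ, time + 2, c⟩).bind fun o =>
        match o with
        | none => PMF.pure none
        | some s' => ((Prog.test x).eval noOracle F s').bind fun o' =>
          match o' with
          | none => PMF.pure none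
          | some s'' => runLoop 21 ((Prog.seq (.pop 21) (.seq p' (.test x))).eval noOracle F) j
              s'' := by
  rw [runLoop_cons (by simp [afterTest, h])]
  have : (Prog.seq (.pop 21) (.seq p' (.test x))).eval noOracle F
      (State.tick ⟨afterTest L n σ x, time, c⟩) =
      (p'.eval noOracle F ⟨joint L (n - 1) σ, time + 2, c⟩).bind fun o =>
        match o with
        | none => PMF.pure none
        | some s' => (Prog.test x).eval noOracle F s' := by
    have e : Function.update (Function.update (joint L (n - 1) σ) 21 [true]) 21 [] =
        joint L (n - 1) σ := by
      rw [Function.update_idem, ← hL, ← joint_low L (n - 1) σ (x := 21) (by omega) (by omega),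
        Function.update_eq_self]
    conv_lhs => unfold Prog.eval
    have e2 : (Prog.pop 21).eval noOracle F (State.tick ⟨afterTest L n σ x, time, c⟩) =
        PMF.pure (some ⟨joint L (n - 1) σ, time + 2, c⟩) := by
      simp only [Prog.eval, State.set, State.tick, afterTest, if_pos h]
      rw [Function.update_self, List.tail_cons, e]
    rw [e2, PMF.pure_bind]
    simp only [Prog.eval]
  rw [this, PMF.bind_bind]
  congr 1
  funext o
  cases o with
  | none => simp only [PMF.pure_bind]
  | some s' => rfl

/-- The loop of a simulated loop, by induction on the clock, which advances in every round by the
test. The bound for the number of rounds is therefore `n + 1`, whatever the simulated program does.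
-/
theorem Simulated.loop_afterTest {L : Stacks} {O : Oracle} {x : ℕ} {p p' : Prog} {K : ℕ}
    (hL : L 21 = []) (hp : Simulated L O p p' K) {F : ℕ} (hF5 : 5 ≤ F) :
    ∀ n σ time c j, K * (n + 1) ≤ F → n + 1 ≤ j →
      (∀ o ∈ (runLoop 21 ((Prog.seq (.pop 21) (.seq p' (.test x))).eval noOracle F) j
          ⟨afterTest L n σ x, time, c⟩).support, ∃ m ≤ n - 1, ∃ σ' t q,
          o = some ⟨joint L m σ', t, q⟩ ∧ t ≤ time + (2 * K + 8) * (n - 1 - m) + 1) ∧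
      ∀ T s i, s.stack = σ → T + 1 ≤ n + s.time → Halts T (runLoop x (p.eval O T) i s) →
        Dominated (Matches L T) (runLoop x (p.eval O T) i s)
          (runLoop 21 ((Prog.seq (.pop 21) (.seq p' (.test x))).eval noOracle F) j
            ⟨afterTest L n σ x, time, c⟩) := by
  intro n
  induction n using Nat.strong_induction_on with
  | _ n ih =>
  intro σ time c j hF hj
  obtain ⟨j, rfl⟩ : ∃ i, j = i + 1 := ⟨j - 1, by omega⟩
  by_cases h : 2 ≤ n ∧ σ x ≠ []
  · rw [runLoop_simulate hL h]
    obtain ⟨h1, h2⟩ := hp F (n - 1) σ (time + 2) c (le_trans (Nat.mul_le_mul_left _ (by omega)) hF)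
    have htest : ∀ m σ₁ t c₁, ∃ u ≤ 5, (Prog.test x).eval noOracle F ⟨joint L m σ₁, t, c₁⟩ =
        PMF.pure (some ⟨afterTest L m σ₁ x, t + u, c₁⟩) := by
      intro m σ₁ t c₁
      obtain ⟨u, hu, he⟩ := Runs.test hL m σ₁ x
      exact ⟨u, hu, he _ _ _ _ hF5⟩
    refine ⟨fun o ho => ?_, fun T s i hs hT hh => ?_⟩
    · obtain ⟨o₁, ho₁, ho⟩ := (PMF.mem_support_bind_iff _ _ _).1 ho
      obtain ⟨m, hm, σ₁, t₁, c₁, rfl, ht₁⟩ := h1 o₁ ho₁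
      obtain ⟨u, hu, he⟩ := htest m σ₁ t₁ c₁
      simp only at ho
      rw [he, PMF.pure_bind] at ho
      obtain ⟨m', hm', σ₂, t₂, c₂, rfl, ht₂⟩ := (ih m (by omega) σ₁ (t₁ + u) c₁ j
        (le_trans (Nat.mul_le_mul_left _ (by omega)) hF) (by omega)).1 o ho
      refine ⟨m', by omega, σ₂, t₂, c₂, rfl, ?_⟩
      rcases Nat.eq_zero_or_pos m with rfl | hm0
      · obtain rfl : m' = 0 := by omega
        obtain ⟨a, rfl⟩ : ∃ a, n = a + 2 := ⟨n - 2, by omega⟩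
        have e1 : K * (a + 2 - 1 - 0 + 1) = K * a + 2 * K := by
          rw [show a + 2 - 1 - 0 + 1 = a + 2 by omega]; ring
        have e2 : (2 * K + 8) * (a + 2 - 1 - 0) = 2 * (K * a) + 8 * a + 2 * K + 8 := by
          rw [show a + 2 - 1 - 0 = a + 1 by omega]; ring
        simp only [Nat.zero_sub, Nat.mul_zero] at ht₂
        omega
      · obtain ⟨a, rfl⟩ : ∃ a, n = m + 1 + a := ⟨n - 1 - m, by omega⟩
        obtain ⟨b, rfl⟩ : ∃ b, m = m' + 1 + b := ⟨m - 1 - m', by omega⟩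
        rw [show m' + 1 + b + 1 + a - 1 - (m' + 1 + b) + 1 = a + 1 by omega] at ht₁
        rw [show m' + 1 + b - 1 - m' = b by omega] at ht₂
        rw [show m' + 1 + b + 1 + a - 1 - m' = a + 1 + b by omega]
        have e1 : (2 * K + 8) * (a + 1 + b) =
            2 * (K * (a + 1)) + 8 * a + 8 + (2 * K + 8) * b := by ring
        omega
    · cases i with
      | zero =>
        obtain ⟨s', hs', -⟩ := hh none (by simp [runLoop])
        cases hs'
      | succ i =>
        rw [runLoop_cons (by rw [hs]; exact h.2)] at hh ⊢
        obtain ⟨hh1, hh2⟩ := hh.of_bind rfl fun s s' h =>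
          (Nat.le_succ _).trans (runLoop_time_le (Prog.time_le O T p) i s s' h)
        refine Dominated.bind (h2 T s.tick hs (by simp only [State.tick]; omega) hh1) ?_
        rintro o ho o' ho' ⟨s₁, s₁', m, rfl, rfl, hst, hT'⟩
        obtain ⟨m', hm', σ₁, t₁, c₁, he, -⟩ := h1 _ ho'
        cases he
        simp only at hst ⊢
        obtain ⟨rfl, rfl⟩ := joint_inj hst
        obtain ⟨u, hu, he⟩ := htest m' s₁.stack t₁ c₁
        rw [he, PMF.pure_bind]
        exact (ih m' (by omega) _ _ c₁ j (le_trans (Nat.mul_le_mul_left _ (by omega)) hF)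
          (by omega)).2 T s₁ i rfl hT' (hh2 _ ho)
  · have e : afterTest L n σ x = joint L (n - 1) σ := if_neg h
    rw [e, runLoop_nil (by simp only; rw [joint_low L _ _ (by omega) (by omega), hL])]
    refine ⟨fun o ho => ?_, fun T s i hs hT hh => ?_⟩
    · rw [PMF.support_pure, Set.mem_singleton_iff] at ho
      exact ⟨n - 1, le_rfl, σ, time + 1, c, ho, by omega⟩
    · cases i with
      | zero =>
        obtain ⟨s', hs', -⟩ := hh none (by simp [runLoop])
        cases hs'
      | succ i =>
        by_cases hx : s.stack x = []
        · rw [runLoop_nil hx]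
          exact Dominated.pure ⟨_, _, n - 1, rfl, rfl, by simp [State.tick, hs],
            by simp only [State.tick]; omega⟩
        · -- with the clock run down, the simulated program would be over time
          exfalso
          rw [hs] at hx
          obtain ⟨o, ho⟩ := (runLoop x (p.eval O T) (i + 1) s).support_nonempty
          obtain ⟨s', rfl, hs'⟩ := hh o ho
          have := runLoop_time_le (Prog.time_le O T p) (i + 1) s s' ho
          have : n < 2 := by
            by_contra h'
            exact h ⟨by omega, hx⟩
          omega

theorem Simulated.loop {L : Stacks} {O : Oracle} {x : ℕ} {p p' : Prog} {K : ℕ}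
    (hL : L 21 = []) (hp : Simulated L O p p' K) :
    Simulated L O (.loop x p) (.seq (.test x) (.loop 21 (.seq (.pop 21) (.seq p' (.test x)))))
      (2 * K + 14) := by
  intro F n σ time c hF
  have hF5 : 5 ≤ F := by
    have : (2 * K + 14) * 1 ≤ (2 * K + 14) * (n + 1) := Nat.mul_le_mul_left _ (by omega)
    omega
  have hFn : n + 1 ≤ F := le_trans (Nat.le_mul_of_pos_left _ (by omega)) hF
  obtain ⟨u, hu, he⟩ := Runs.test hL n σ x
  have e : (Prog.seq (.test x) (.loop 21 (.seq (.pop 21) (.seq p' (.test x))))).eval noOracle F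
      ⟨joint L n σ, time, c⟩ =
      runLoop 21 ((Prog.seq (.pop 21) (.seq p' (.test x))).eval noOracle F) F
        ⟨afterTest L n σ x, time + u, c⟩ := by
    conv_lhs => unfold Prog.eval
    rw [he _ _ _ _ hF5, PMF.pure_bind]
    simp only [Prog.eval]
  rw [e]
  obtain ⟨h1, h2⟩ := Simulated.loop_afterTest (x := x) hL hp hF5 n σ (time + u) c F
    (le_trans (Nat.mul_le_mul_right _ (by omega)) hF) hFn
  refine ⟨fun o ho => ?_, fun T s hs hT hh => h2 T s T hs hT hh⟩
  obtain ⟨m, hm, σ', t, q, rfl, ht⟩ := h1 o ho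
  refine ⟨m, by omega, σ', t, q, rfl, ht.trans ?_⟩
  have e1 : (2 * K + 8) * (n - 1 - m) ≤ (2 * K + 8) * (n - m) := Nat.mul_le_mul_left _ (by omega)
  have e2 : (2 * K + 14) * (n - m + 1) = (2 * K + 8) * (n - m) + 6 * (n - m) + 2 * K + 14 := by
    ring
  omega

/-- The simulation of a program is correct. -/
theorem Sampler.simulated {L : Stacks} {smp : Prog} {μ : PMF (List Bool)}
    {X : List Bool → List Bool} {Q : ℕ} (hS : Sampler L smp μ X Q) (p : Prog) :
    Simulated L (μ.map fun w => (X w, true)) p (.simulate smp p) (simCost p * (Q + 1)) := by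
  induction p with
  | push x b =>
    change Simulated _ _ _ (.seq (.pop 20) (.push (x + 30) b)) (2 * (Q + 1))
    refine (Simulated.of_runs (K := 2) (fun σ => Function.update σ x (b :: σ x))
      (fun T s => ⟨s.queries, rfl⟩) fun n σ => ?_).mono (by omega)
    refine ((Runs.pop_clock L n σ).seq (Runs.push _ _ _)).congr ?_
    rw [joint_high, update_joint_high]
  | pop x =>
    change Simulated _ _ _ (.seq (.pop 20) (.pop (x + 30))) (2 * (Q + 1))
    refine (Simulated.of_runs (K := 2) (fun σ => Function.update σ x (σ x).tail)
      (fun T s => ⟨s.queries, rfl⟩) fun n σ => ?_).mono (by omega)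
    refine ((Runs.pop_clock L n σ).seq (Runs.pop _ _)).congr ?_
    rw [joint_high, update_joint_high]
  | toss x =>
    change Simulated _ _ _ (.seq (.pop 20) (.toss (x + 30))) (2 * (Q + 1))
    refine (Simulated.of_map (K := 2) (PMF.uniformOfFintype Bool)
      (fun b σ => Function.update σ x (b :: σ x)) (fun T s => ⟨s.queries, rfl⟩)
      fun F n σ time q hF => ?_).mono (by omega)
    obtain ⟨t, ht, h⟩ := Runs.pop_clock L n σ
    refine ⟨fun _ => t + 1, fun _ => (by omega : t + 1 ≤ 2), ?_⟩
    conv_lhs => unfold Prog.eval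
    rw [h _ _ _ _ (by omega), PMF.pure_bind]
    simp only [Prog.eval, State.set, State.tick, joint_high, update_joint_high, add_assoc]
  | query x y =>
    change Simulated _ _ _ (.seq (.pop 20) (.seq smp (.seq (.move 9 11) (.seq (.move 11 (x + 30))
      (.push (y + 30) true))))) (10 * (Q + 1))
    refine (Simulated.of_map (K := 10 * (Q + 1)) μ
      (fun w σ => Function.update (Function.update σ x (X w ++ σ x)) y
        (true :: Function.update σ x (X w ++ σ x) y)) (fun T s => ⟨s.queries + 1, ?_⟩)
      fun F n σ time q hF => ?_).mono le_rfl
    · simp only [Prog.eval, PMF.map_comp]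
      rfl
    · obtain ⟨t, ht, h⟩ := Runs.pop_clock L n σ
      obtain ⟨u, hu, he⟩ := hS.eval (n - 1) σ F (by omega)
      have hr : ∀ w, Runs (.seq (.move 9 11) (.seq (.move 11 (x + 30)) (.push (y + 30) true)))
          (joint (Function.update L 9 (X w)) (n - 1) σ) (joint L (n - 1)
            (Function.update (Function.update σ x (X w ++ σ x)) y
              (true :: Function.update σ x (X w ++ σ x) y))) (8 * Q + 3) := by
        intro w
        have hl := hS.length_le w
        refine (((Runs.move (by omega) _).seq ((Runs.move (by omega) _).seq
          (Runs.push _ _ _))).mono ?_).congr ?_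
        · simp [joint, hS.eleven]
          omega
        · have e : Function.update (Function.update (Function.update (Function.update L 9 (X w))
              11 (X w).reverse) 9 []) 11 [] = L := by
            funext i
            by_cases h1 : i = 11
            · subst h1; simp [hS.eleven]
            · by_cases h2 : i = 9
              · subst h2; simp [hS.nine]
              · simp [h1, h2]
          simp [update_joint_low, update_joint_high, joint_high, joint_low, hS.eleven, e]
      choose v hv hve using hr
      refine ⟨fun w => t + u w + v w, fun w => ?_, ?_⟩
      · have := hu w
        have := hv w
        simp only
        omega
      · conv_lhs => unfold Prog.eval
        rw [h _ _ _ _ (by omega), PMF.pure_bind]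
        simp only
        conv_lhs => unfold Prog.eval
        rw [he, PMF.bind_map, ← PMF.bind_pure_comp]
        congr 1
        funext w
        simp only [Function.comp]
        rw [hve w _ _ _ _ (by omega)]
        simp only [add_assoc]
  | seq p q ihp ihq =>
    have h := (ihp.seq ihq).mono (K' := (simCost p + simCost q) * (Q + 1)) (by rw [add_mul])
    exact h
  | branch x p q r ihp ihq ihr =>
    have h1 := ihp.mono (K' := (simCost p + simCost q + simCost r) * (Q + 1))
      (Nat.mul_le_mul_right _ (by omega))
    have h2 := ihq.mono (K' := (simCost p + simCost q + simCost r) * (Q + 1))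
      (Nat.mul_le_mul_right _ (by omega))
    have h3 := ihr.mono (K' := (simCost p + simCost q + simCost r) * (Q + 1))
      (Nat.mul_le_mul_right _ (by omega))
    have h := (Simulated.branch (x := x) h1 h2 h3).mono
      (K' := (simCost p + simCost q + simCost r + 2) * (Q + 1)) (by ring_nf; omega)
    exact h
  | loop x p ih =>
    have h := (Simulated.loop (x := x) hS.flag ih).mono
      (K' := (2 * simCost p + 14) * (Q + 1)) (by ring_nf; omega)
    exact h

/-! ### Sampling a random member of a family -/

/-- The number with given binary digits, the most significant one first. -/
def valueOf (w : List Bool) : ℕ := w.foldl (fun v b => 2 * v + b.toNat) 0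

theorem valueOf_append_singleton (w : List Bool) (b : Bool) :
    valueOf (w ++ [b]) = 2 * valueOf w + b.toNat := by simp [valueOf]

theorem valueOf_lt (w : List Bool) : valueOf w < 2 ^ w.length := by
  induction w using List.reverseRecOn with
  | nil => simp [valueOf]
  | append_singleton w b ih =>
    rw [valueOf_append_singleton, List.length_append, List.length_singleton, pow_succ]
    have := Bool.toNat_le b
    omega

theorem exists_valueOf (b : ℕ) : ∀ j < 2 ^ b, ∃ w, w.length = b ∧ valueOf w = j := by
  induction b with
  | zero => intro j hj; exact ⟨[], rfl, by simp [valueOf] at hj ⊢; omega⟩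
  | succ b ih =>
    intro j hj
    rw [pow_succ] at hj
    obtain ⟨w, hw, hv⟩ := ih (j / 2) (by omega)
    refine ⟨w ++ [decide (j % 2 = 1)], by simp [hw], ?_⟩
    rw [valueOf_append_singleton, hv]
    rcases Nat.mod_two_eq_zero_or_one j with h | h <;> simp [h] <;> omega

/-- A string of `b` independent fair random bits. -/
noncomputable def coins : ℕ → PMF (List Bool)
  | 0 => PMF.pure []
  | b + 1 => (PMF.uniformOfFintype Bool).bind fun c => (coins b).map fun w => w ++ [c]

theorem length_of_mem_coins {b : ℕ} : ∀ {w : List Bool}, w ∈ (coins b).support →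
    w.length = b := by
  induction b with
  | zero => intro w h; simp [coins] at h; simp [h]
  | succ b ih =>
    intro w h
    simp only [coins, PMF.mem_support_bind_iff, PMF.mem_support_map_iff] at h
    obtain ⟨c, -, w', hw', rfl⟩ := h
    simp [ih hw']

theorem le_coins {b : ℕ} : ∀ {w : List Bool}, w.length = b → (2⁻¹ : ENNReal) ^ b ≤ coins b w := by
  induction b with
  | zero => intro w h; simp [coins, List.length_eq_zero_iff.1 h]
  | succ b ih =>
    intro w h
    rcases w.eq_nil_or_concat with rfl | ⟨w', c, rfl⟩
    · simp at h
    · rw [List.concat_eq_append] at h ⊢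
      simp only [coins, PMF.bind_apply]
      refine le_trans ?_ (ENNReal.le_tsum c)
      rw [pow_succ, mul_comm]
      refine mul_le_mul' (by simp) ((ih (by simpa using h)).trans ?_)
      rw [PMF.map_apply]
      refine le_trans ?_ (ENNReal.le_tsum w')
      simp

/-- For each bit of stack `x`, put a random bit on stack `y`. -/
def Prog.tossEach (x y : ℕ) : Prog := .loop x (.seq (.pop x) (.toss y))

/-- The loop of `Prog.tossEach` replaces the bits `l` of stack `x` by as many coins on stack `y`. -/
theorem eval_tossEach {x y : ℕ} (hxy : x ≠ y) (O : Oracle) (F : ℕ) :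
    ∀ (l : List Bool) (j : ℕ) (σ : Stacks) (time q : ℕ), σ x = l → l.length < j →
      runLoop x ((Prog.seq (.pop x) (.toss y)).eval O F) j ⟨σ, time, q⟩ =
        (coins l.length).map fun w =>
          some ⟨Function.update (Function.update σ y (w ++ σ y)) x [], time +
            (3 * l.length + 1), q⟩ := by
  intro l
  induction l with
  | nil =>
    intro j σ time q hl hj
    obtain ⟨j, rfl⟩ : ∃ i, j = i + 1 := ⟨j - 1, by omega⟩
    rw [runLoop_nil hl]
    simp only [List.length_nil, coins, PMF.pure_map, State.tick, List.nil_append,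
      Function.update_eq_self]
    rw [← hl, Function.update_eq_self]
  | cons a l ih =>
    intro j σ time q hl hj
    obtain ⟨j, rfl⟩ : ∃ i, j = i + 1 := ⟨j - 1, by omega⟩
    rw [List.length_cons] at hj
    rw [runLoop_cons (by simp [hl])]
    have hb : (Prog.seq (.pop x) (.toss y)).eval O F (State.tick ⟨σ, time, q⟩) =
        (PMF.uniformOfFintype Bool).map fun c =>
          some ⟨Function.update (Function.update σ x l) y (c :: σ y), time + 3, q⟩ := by
      simp [Prog.eval, State.tick, State.set, hl, hxy.symm]
    rw [hb, PMF.bind_map]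
    simp only [coins, PMF.map_bind, List.length_cons]
    congr 1
    funext c
    simp only [Function.comp]
    rw [ih j _ _ _ (by simp [hxy]) (by omega), PMF.map_comp]
    congr 1
    funext w
    simp only [Function.comp, Option.some.injEq, State.mk.injEq, and_true]
    refine ⟨?_, by ring⟩
    funext i
    by_cases h1 : i = x
    · subst h1; simp
    · by_cases h2 : i = y
      · subst h2; simp [h1]
      · simp [h1, h2]

namespace Prog

/-- Double the unary number on stack 15. -/
def double : Prog :=
  .seq (forBits 15 (.seq (.push 16 true) (.push 16 true)) (.seq (.push 16 true) (.push 16 true)))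
    (move 16 15)

/-- Replace the binary digits on stack 14 by their value, in unary, on stack 15. -/
def value : Prog := forBits 14 double (.seq double (.push 15 true))

/-- Leave on stack 9 the adjacency matrix of the cycle for the row whose number is given in binary
on stack 14; the vertices are three copies of each element, and some further vertices, for each of
which there is a bit on stack 4. -/
def rowSample : Prog :=
  .seq value (.seq (copy 3 12 11) (.seq (forBits 15 dropRow dropRow) (.seq readRow
    (.seq (clear 12) (.seq tripleRow (.seq (copy 4 6 11) cycle))))))

/-- Draw a random row and produce the sample for it on stack 9; stack 13 holds as many bits as are
needed for the number of a row. -/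
def drawSample : Prog := .seq (copy 13 10 11) (.seq (tossEach 10 14) rowSample)

end Prog

theorem Runs.double (a0 a1 a2 a3 a4 a5 a6 a7 a8 a9 a10 a11 a12 a13 a14 : List Bool)
    (rest : List (List Bool)) (v : ℕ) :
    Runs .double (stk (a0::a1::a2::a3::a4::a5::a6::a7::a8::a9::a10::a11::a12::a13::
      a14::unary v::[]::
        rest))
      (stk (a0::a1::a2::a3::a4::a5::a6::a7::a8::a9::a10::a11::a12::a13::a14::unary (2 * v)::[]::
        rest)) (13 * v + 2) := by
  have hg : ∀ i, (fun l : List Bool => true :: true :: l)^[i] [] = unary (2 * i) := by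
    intro i
    induction i with
    | zero => rfl
    | succ i ih =>
      rw [Function.iterate_succ_apply', ih]
      rfl
  have h := Runs.forBits_iterate (x := 15) (p := .seq (.push 16 true) (.push 16 true))
    (fun l (r : List Bool) => stk (a0::a1::a2::a3::a4::a5::a6::a7::a8::a9::a10::a11::a12::a13::a14::
      l::r::rest)) (fun l => true :: true :: l) 2
    (fun _ _ => rfl) (fun _ _ _ => update_stk (by simp) _) (unary v) []
    (fun l₂ i _ => (Runs.push_stk 16 true (by simp)).seq (Runs.push_stk 16 true (by simp)))
  rw [hg] at h
  refine ((h.seq (Runs.move_stk (x := 16) (y := 15) (by decide) (by simp) (by simp))).mono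
    ?_).congr ?_
  · simp [unary]; omega
  · simp [unary]

theorem Runs.value (a0 a1 a2 a3 a4 a5 a6 a7 a8 a9 a10 a11 a12 a13 w : List Bool)
    (rest : List (List Bool)) :
    Runs .value (stk (a0::a1::a2::a3::a4::a5::a6::a7::a8::a9::a10::a11::a12::a13::w::[]::[]::rest))
      (stk (a0::a1::a2::a3::a4::a5::a6::a7::a8::a9::a10::a11::a12::a13::[]::unary (valueOf w)::[]::
        rest)) ((13 * 2 ^ w.length + 6) * w.length + 1) := by
  have hv : ∀ l₁ l₂ : List Bool, w = l₁ ++ l₂ →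
      l₁.foldl (fun v b => 2 * v + b.toNat) 0 ≤ 2 ^ w.length := fun l₁ l₂ e =>
    (valueOf_lt l₁).le.trans (Nat.pow_le_pow_right (by omega) (by simp [e]))
  exact Runs.forBits_fold (x := 14) (p := .double) (q := .seq .double (.push 15 true))
    (fun l (v : ℕ) => stk
      (a0::a1::a2::a3::a4::a5::a6::a7::a8::a9::a10::a11::a12::a13::l::unary v::[]::
      rest)) (fun v b => 2 * v + b.toNat) (13 * 2 ^ w.length + 3)
    (fun _ _ => rfl) (fun _ _ _ => update_stk (by simp) _) w 0
    (fun l₁ l₂ e => (Runs.double _ _ _ _ _ _ _ _ _ _ _ _ _ _ _ _ _).mono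
      (by have := hv _ _ e; omega))
    (fun l₁ l₂ e => ((Runs.double _ _ _ _ _ _ _ _ _ _ _ _ _ _ _ _ _).seq
      (Runs.push_stk 15 true (by simp))).mono (by have := hv _ _ e; omega))

/-- The row with a given number, where there are only zeros behind the last row. -/
def rowAt (n : ℕ) (rw : List Bool) (j : ℕ) : List Bool :=
  List.takeD n (rw.drop (j * (n + 1))).tail false

/-- The vertices of the cycle for a set: three copies of each element, out of `3 n + k`
vertices. -/
def tripled (a : List Bool) (k : ℕ) : List Bool := a ++ a ++ a ++ List.replicate k false

theorem Runs.rowSample (a0 a1 rw a13 w : List Bool) (rest : List (List Bool)) (n k : ℕ) :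
    Runs .rowSample (stk (a0::a1::unary n::rw::List.replicate k
      false::[]::[]::[]::[]::[]::[]::[]::[]::
        a13::w::[]::[]::rest))
      (stk (a0::a1::unary n::rw::List.replicate k false::[]::[]::[]::[]::
        cycBits (tripled (rowAt n rw (valueOf w)) k)::[]::[]::[]::a13::[]::[]::[]::rest))
      ((13 * 2 ^ w.length + 6) * w.length + 2 ^ w.length * (13 * n + 13) + 60 *
        (3 * n + k + 1) ^ 2 +
        49 * n + 11 * rw.length + 9 * k + 30) := by
  have hg : ∀ i, (fun l : List Bool => l.drop (n + 1))^[i] rw = rw.drop (i * (n + 1)) := by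
    intro i
    induction i with
    | zero => simp
    | succ i ih =>
      rw [Function.iterate_succ_apply', ih, List.drop_drop]
      congr 1
      ring
  have h1 := Runs.forBits_iterate (x := 15) (p := .dropRow)
    (fun l (r : List Bool) => stk
      (a0::a1::unary n::rw::List.replicate k false::[]::[]::[]::[]::[]::[]::
      []::r::a13::[]::l::[]::rest)) (fun l => l.drop (n + 1)) (13 * n + 10)
    (fun _ _ => rfl) (fun _ _ _ => update_stk (by simp) _) (unary (valueOf w)) (rw ++ [])
    (fun l₂ i _ => Runs.dropRow _ _ _ _ _ _ _ _ _ _ _ _)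
  rw [List.append_nil, hg] at h1
  have hl : (tripled (rowAt n rw (valueOf w)) k).length = 3 * n + k := by
    simp [tripled, rowAt]; omega
  have h2 := Runs.cycle a0 a1 (unary n) rw (List.replicate k false) [] []
    ([] :: a13 :: [] :: [] :: [] :: rest) (tripled (rowAt n rw (valueOf w)) k)
  have e3 : (tripled (rowAt n rw (valueOf w)) k).reverse = List.replicate k false ++
      ((rowAt n rw (valueOf w)).reverse ++ ((rowAt n rw (valueOf w)).reverse ++
        ((rowAt n rw (valueOf w)).reverse ++ []))) := by
    simp [tripled]
  rw [e3, hl] at h2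
  have hlen : (unary (valueOf w)).length = valueOf w := by simp [unary]
  rw [hlen] at h1
  have h3 := Runs.copy_stk
    (L := a0::a1::unary n::rw::List.replicate k false::[]::[]::[]::[]::[]::[]::
      []::[]::a13::[]::unary (valueOf w)::[]::rest) (x := 3) (y := 12) (t := 11) (by decide)
      (by decide) (by decide) (by simp) rfl
  refine ((Runs.value _ _ _ _ _ _ _ _ _ _ _ _ _ _ _ _).seq (h3.seq
    (Runs.seq (σ₂ := stk (a0::a1::unary n::rw::List.replicate k false::[]::[]::[]::[]::[]::[]::
      []::rw.drop (valueOf w * (n + 1))::a13::[]::[]::[]::rest)) (by simpa using h1)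
    ((Runs.readRow _ _ _ _ _ _ _ _ _ _ _).seq ((Runs.clear_stk 12 (by simp)).seq
    ((Runs.tripleRow _ _ _ _ _ _ _ _ _ _ _ _).seq
    ((Runs.copy_stk (x := 4) (y := 6) (t := 11) (by decide) (by decide) (by decide)
      (by simp) rfl).seq h2))))))).mono ?_
  have hv := (valueOf_lt w).le
  have hv' := Nat.mul_le_mul_right (13 * n + 13) hv
  have e1 : (rowAt n rw (valueOf w)).length = n := by simp [rowAt]
  have e4 : (13 * n + 10 + 3) * valueOf w = valueOf w * (13 * n + 13) := by ring
  have e5 := Nat.sub_le rw.length (valueOf w * (n + 1) + (n + 1))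
  simp [e4]
  omega

/-- During the simulation the stacks 15 to 19 and those from 21 to 29 are empty. -/
theorem joint_stk {l : List (List Bool)} (hl : l.length = 15) (m : ℕ) (σ : Stacks) :
    joint (stk l) m σ = fun i => if i < 30 then stk (l ++ (List.replicate 5 [] ++ [unary m])) i
      else σ (i - 30) := by
  funext i
  unfold joint stk
  by_cases h : i < 30
  · simp only [h, if_true]
    by_cases h1 : i < 15
    · rw [if_neg (by omega), List.getD_append _ _ _ _ (by omega)]
    · rw [List.getD_append_right _ _ _ _ (by omega), hl]
      by_cases h2 : i < 20
      · rw [if_neg (by omega), List.getD_append _ _ _ _ (by simp; omega),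
          List.getD_replicate _ (by omega), List.getD_eq_default _ _ (by omega)]
      · rw [List.getD_append_right _ _ _ _ (by simp; omega)]
        by_cases h3 : i = 20
        · subst h3; rfl
        · rw [if_neg h3, List.getD_eq_default _ _ (by omega),
            List.getD_eq_default _ _ (by simp; omega)]
  · simp [h]

/-- A program for the stacks of the simulating program, run within the simulation. -/
theorem Runs.joint {p : Prog} (hp : p.bound ≤ 30) {l l' : List (List Bool)} {m t : ℕ}
    (hl : l.length = 15) (hl' : l'.length = 15)
    (h : Runs p (stk (l ++ (List.replicate 5 [] ++ [unary m])))
      (stk (l' ++ (List.replicate 5 [] ++ [unary m]))) t) (σ : Stacks) :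
    Runs p (joint (stk l) m σ) (joint (stk l') m σ) t := by
  rw [joint_stk hl, joint_stk hl']
  exact h.shift 30 hp _

/-- The stacks of the simulating program that are kept during the simulation: the parameter, the
number of elements, the rows, `k` bits for the vertices that belong to no element, and the number of
coins needed to choose a row. -/
def kept (n k b : ℕ) (rw : List Bool) : List (List Bool) :=
  [[], unary k, unary n, rw, List.replicate k false, [], [], [], [], [], [], [], [], unary b, []]

/-- A bound for the running time of `Prog.drawSample`. -/
def drawCost (n k b L : ℕ) : ℕ :=
  (13 * 2 ^ b + 6) * b + 2 ^ b * (13 * n + 13) + 60 * (3 * n + k + 1) ^ 2 + 49 * n + 11 * L +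
    9 * k + 12 * b + 40

/-- `Prog.drawSample` draws the cycle of a uniformly random row among the first `2 ^ b`, where the
rows behind the last one are empty. -/
theorem sampler_drawSample (n k b : ℕ) (rw : List Bool) :
    Sampler (stk (kept n k b rw)) .drawSample (coins b)
      (fun w => cycBits (tripled (rowAt n rw (valueOf w)) k)) (drawCost n k b rw.length) where
  nine := rfl
  eleven := rfl
  flag := rfl
  length_le w := by
    rw [length_cycBits]
    have h : (3 * n + k) * (3 * n + k) ≤ (3 * n + k + 1) ^ 2 := by nlinarith
    have e : (tripled (rowAt n rw (valueOf w)) k).length = 3 * n + k := by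
      simp [tripled, rowAt]; omega
    rw [e, drawCost]
    omega
  eval m σ F hF := by
    have h1 : Runs (.copy 13 10 11) (joint (stk (kept n k b rw)) m σ)
        (joint (stk ((kept n k b rw).set 10 (unary b))) m σ) (9 * b + 2) := by
      refine Runs.joint (by decide) rfl rfl ?_ σ
      exact ((Runs.copy_stk (x := 13) (y := 10) (t := 11) (by decide) (by decide) (by decide)
        (by simp [kept]) rfl).mono (by simp [kept, unary])).congr (by simp [kept])
    have h2 : ∀ w : List Bool, w.length = b → Runs .rowSample
        (joint (stk ((kept n k b rw).set 14 w)) m σ)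
        (joint (stk ((kept n k b rw).set 9 (cycBits (tripled (rowAt n rw (valueOf w)) k)))) m σ)
        (drawCost n k b rw.length - (12 * b + 10)) := by
      intro w hw
      refine Runs.joint (by decide) rfl rfl ?_ σ
      refine (Runs.rowSample [] (unary k) rw (unary b) w [[], [], [], unary m] n k).mono ?_
      rw [hw]
      unfold drawCost
      omega
    obtain ⟨t1, ht1, h1⟩ := h1
    have h2' : ∀ w : List Bool, ∃ t, w.length = b → t ≤ drawCost n k b rw.length - (12 * b + 10) ∧
        ∀ (O : Oracle) (F time q : ℕ), drawCost n k b rw.length - (12 * b + 10) ≤ F →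
        Prog.rowSample.eval O F ⟨joint (stk ((kept n k b rw).set 14 w)) m σ, time, q⟩ =
          PMF.pure (some ⟨joint (stk ((kept n k b rw).set 9
            (cycBits (tripled (rowAt n rw (valueOf w)) k)))) m σ, time + t, q⟩) := by
      intro w
      by_cases hw : w.length = b
      · obtain ⟨t, h⟩ := h2 w hw
        exact ⟨t, fun _ => h⟩
      · exact ⟨0, fun h => absurd h hw⟩
    choose t2 ht2 using h2'
    have hb : 12 * b + 40 ≤ drawCost n k b rw.length := by unfold drawCost; omega
    refine ⟨fun w => if w.length = b then t1 + (3 * b + 1) + t2 w else 0, fun w => ?_,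
      fun time q => ?_⟩
    · simp only
      split
      · rename_i hw
        have := (ht2 w hw).1
        omega
      · omega
    · unfold Prog.drawSample
      conv_lhs => unfold Prog.eval
      rw [h1 _ _ _ _ (by omega), PMF.pure_bind]
      simp only
      conv_lhs => unfold Prog.eval
      have h3 := eval_tossEach (x := 10) (y := 14) (by decide) noOracle F (unary b) F
        (joint (stk ((kept n k b rw).set 10 (unary b))) m σ) (time + t1) q
        (by rw [joint_low _ _ _ (by omega) (by omega)]; rfl) (by simp [unary]; omega)
      have h4 : (Prog.tossEach 10 14).eval noOracle F
          ⟨joint (stk ((kept n k b rw).set 10 (unary b))) m σ, time + t1, q⟩ = _ := h3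
      rw [h4, PMF.bind_map, ← PMF.bind_pure_comp]
      rw [show (unary b).length = b by simp [unary]]
      ext1 o
      simp only [PMF.bind_apply]
      refine tsum_congr fun w => ?_
      by_cases hw : w ∈ (coins b).support
      · have hwb := length_of_mem_coins hw
        have e : Function.update (Function.update
            (joint (stk ((kept n k b rw).set 10 (unary b))) m σ) 14
            (w ++ joint (stk ((kept n k b rw).set 10 (unary b))) m σ 14)) 10 [] =
            joint (stk ((kept n k b rw).set 14 w)) m σ := by
          rw [update_joint_low _ _ _ (by omega) (by omega),
            update_joint_low _ _ _ (by omega) (by omega), update_stk (by simp [kept]),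
            update_stk (by simp [kept]), joint_low _ _ _ (by omega) (by omega)]
          simp [kept, stk]
        simp only [Function.comp]
        rw [e, (ht2 w hwb).2 _ _ _ _ (by omega), if_pos hwb, update_stk (by simp [kept])]
        simp only [add_assoc]
      · rw [PMF.mem_support_iff, not_not] at hw
        simp [hw]

/-! ### Checking a hypothesis -/

/-- The sets with characteristic vectors `a`, `a`, `a`, one after the other, and `r` have a common
element. -/
def Hit (a r : List Bool) : Prop := ∃ i, IsOn (a ++ a ++ a) i ∧ IsOn r i

namespace Prog

/-- Put a bit on stack 17 if the number of bits `true` on stack 16 exceeds the number on stack 1. -/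
def checkCount : Prog :=
  .seq (copy 16 10 11) (forBits 10 (skip 11) (.branch 1 (.push 17 true) (.pop 1) (.pop 1)))

/-- Put bits on stack 18 if stacks 7 and 10 have a common position with the bit `true`. -/
def meet : Prog :=
  forBits 7 (.pop 10) (.branch 10 (.pop 10) (.pop 10) (.seq (.pop 10) (.push 18 true)))

/-- Put a bit on stack 17 if the next row on stack 12 is not hit by the string on stack 16. -/
def checkRow : Prog :=
  .seq readRow (.seq tripleRow (.seq (move 6 7) (.seq (copy 16 10 11) (.seq meet
    (.seq (.branch 18 (.push 17 true) (clear 18) (clear 18)) (clear 10))))))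

/-- Answer whether the string on stack 16 has at most as many bits `true` as stack 1, and hits all
rows. -/
def checkHits : Prog :=
  .seq checkCount (.seq (copy 3 12 11) (.seq (.loop 12 checkRow)
    (.branch 17 (.push 0 true) (.push 0 false) (.push 0 false))))

/-- Answer whether the hypothesis of the simulated learning algorithm has at most `k` bits `true`
and hits all rows. -/
def check : Prog := .seq (move 30 11) (.seq (move 11 16) checkHits)

end Prog

/-- The stacks during the check of the hypothesis `r`. -/
def checkStk (k n f : ℕ) (rw r S l cl a4 a13 : List Bool) : Stacks :=
  stk [[], unary k, unary n, rw, a4, [], [], [], [], [], l, [], S, a13, [], [], r, unary f, [], [],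
    cl]

theorem Runs.checkCount (k n : ℕ) (rw r cl a4 a13 : List Bool) :
    ∃ k' f, Runs .checkCount (checkStk k n 0 rw r [] [] cl a4 a13)
      (checkStk k' n f rw r [] [] cl a4 a13) (14 * r.length + 3) ∧ (f = 0 ↔ r.count true ≤ k) := by
  obtain ⟨⟨k', f⟩, ⟨h1, h2⟩, hr⟩ := Runs.forBits_inv (x := 10) (p := .skip 11)
    (q := .branch 1 (.push 17 true) (.pop 1) (.pop 1))
    (fun l (a : ℕ × ℕ) => checkStk a.1 n a.2 rw r [] l cl a4 a13)
    (fun l a => a.1 + r.count true = k + a.2 + l.count true ∧ (a.1 = 0 ∨ a.2 = 0)) 2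
    (fun _ _ => rfl) (fun _ _ _ => update_stk (by simp) _)
    (fun l a h => ⟨a, by simpa using h, Runs.skip 11 _⟩)
    (fun l a ⟨h1, h2⟩ => by
      obtain ⟨c, f⟩ := a
      rw [List.count_cons_self] at h1
      cases c with
      | zero =>
        exact ⟨(0, f + 1), by dsimp only at *; omega, (Runs.branch_nil rfl (Runs.push_stk 17 true
          (by simp))).congr rfl⟩
      | succ c =>
        exact ⟨(c, f), by dsimp only at *; omega, (Runs.branch_true (l := unary c) rfl (Runs.pop_stk 1
          (by simp))).congr rfl⟩) r (k, 0) (by simp)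
  refine ⟨k', f, (((Runs.copy_stk (x := 16) (y := 10) (t := 11) (by decide) (by decide) (by decide)
    (by simp) rfl).congr (τ := checkStk k n 0 rw r [] r cl a4 a13) (by simp [checkStk])).seq
    hr).mono ?_, ?_⟩
  · simp; omega
  · simp only [List.count_nil] at h1 h2; omega

theorem Runs.branch_ne_nil {x : ℕ} {p q : Prog} {σ σ' : Stacks} {B : ℕ} (hx : σ x ≠ [])
    (h : Runs q σ σ' B) : Runs (.branch x p q q) σ σ' (B + 1) := by
  match hx' : σ x with
  | [] => exact absurd hx' hx
  | false :: l => exact Runs.branch_false hx' h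
  | true :: l => exact Runs.branch_true hx' h

/-- The string `h` that is left on stack 18 records the common positions. -/
theorem Runs.meet (k n f : ℕ) (rw r S cl a4 a13 w : List Bool) :
    ∃ h : List Bool, (h = [] ↔ ¬ ∃ i, IsOn w i ∧ IsOn r i) ∧ h.length ≤ w.length ∧
      Runs .meet
        (stk [[], unary k, unary n, rw, a4, [], [], w, [], [], r, [], S, a13, [], [], r, unary f,
          [], [], cl])
        (stk [[], unary k, unary n, rw, a4, [], [], [], [], [], r.drop w.length, [], S, a13, [], [],
          r, unary f, h, [], cl]) (6 * w.length + 1) := by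
  let g : List Bool × List Bool → Bool → List Bool × List Bool := fun a b =>
    (a.1.tail, if b = true ∧ a.1.head? = some true then true :: a.2 else a.2)
  have hg : ∀ (w R h : List Bool), (w.foldl g (R, h)).1 = R.drop w.length ∧
      ((w.foldl g (R, h)).2 = [] ↔ h = [] ∧ ¬ ∃ i, IsOn w i ∧ IsOn R i) ∧
      (w.foldl g (R, h)).2.length ≤ h.length + w.length := by
    intro w
    induction w with
    | nil => intro R h; simp [IsOn]
    | cons b w ih =>
      intro R h
      obtain ⟨h1, h2, h3⟩ := ih R.tail
        (if b = true ∧ R.head? = some true then true :: h else h)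
      rw [List.foldl_cons]
      refine ⟨h1.trans (by cases R <;> simp), h2.trans ?_, h3.trans ?_⟩
      · have e : (∃ i, IsOn (b :: w) i ∧ IsOn R i) ↔
            (b = true ∧ R.head? = some true) ∨ ∃ i, IsOn w i ∧ IsOn R.tail i := by
          constructor
          · rintro ⟨i, hi, hi'⟩
            cases i with
            | zero => left; simpa [IsOn, List.head?_eq_getElem?] using And.intro hi hi'
            | succ i => right; exact ⟨i, by simpa [IsOn] using hi, by simpa [IsOn] using hi'⟩
          · rintro (⟨hi, hi'⟩ | ⟨i, hi, hi'⟩)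
            · exact ⟨0, by simpa [IsOn] using hi, by simpa [IsOn, List.head?_eq_getElem?] using hi'⟩
            · exact ⟨i + 1, by simpa [IsOn] using hi, by simpa [IsOn] using hi'⟩
        rw [e]
        by_cases hc : b = true ∧ R.head? = some true <;> simp [hc]
      · split
        · simp; omega
        · simp
  obtain ⟨h1, h2, h3⟩ := hg w r []
  have hr := Runs.forBits_fold (x := 7) (p := .pop 10)
    (q := .branch 10 (.pop 10) (.pop 10) (.seq (.pop 10) (.push 18 true)))
    (fun l (a : List Bool × List Bool) => stk [[], unary k, unary n, rw, a4, [], [], l, [], [], a.1,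
      [], S, a13, [], [], r, unary f, a.2, [], cl]) g 3 (fun _ _ => rfl)
    (fun _ _ _ => update_stk (by simp) _) w (r, [])
    (fun l₁ l₂ _ => ((Runs.pop_stk 10 (by simp)).mono (by omega)).congr rfl)
    (fun l₁ l₂ _ => by
      obtain ⟨R, h⟩ := l₁.foldl g (r, [])
      match R with
      | [] => exact ((Runs.branch_nil rfl (Runs.pop_stk 10 (by simp))).mono (by omega)).congr rfl
      | false :: R =>
        exact ((Runs.branch_false (l := R) rfl (Runs.pop_stk 10 (by simp))).mono (by omega)).congr
          rfl
      | true :: R =>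
        exact (Runs.branch_true (l := R) rfl ((Runs.pop_stk 10 (by simp)).seq
          (Runs.push_stk 18 true (by simp)))).congr rfl)
  refine ⟨(w.foldl g (r, [])).2, by simpa using h2, by simpa using h3, ?_⟩
  rw [← h1]
  exact hr

theorem Runs.checkRow (k n f : ℕ) (rw r S cl a4 a13 a : List Bool) (ha : a.length = n) :
    ∃ f', Runs .checkRow (checkStk k n f rw r (true :: a ++ S) [] cl a4 a13)
      (checkStk k n f' rw r S [] cl a4 a13) (86 * n + 11 * r.length + 30) ∧
      (f' = 0 ↔ f = 0 ∧ Hit a r) := by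
  subst ha
  obtain ⟨h, hh, hl, hm⟩ := Runs.meet k a.length f rw r S cl a4 a13 (a ++ a ++ a)
  have hfin : ∃ f', Runs (.branch 18 (.push 17 true) (.clear 18) (.clear 18))
      (stk [[], unary k, unary a.length, rw, a4, [], [], [], [], [], r.drop
        (a ++ a ++ a).length, [],
        S, a13, [], [], r, unary f, h, [], cl])
      (stk [[], unary k, unary a.length, rw, a4, [], [], [], [], [], r.drop
        (a ++ a ++ a).length, [],
        S, a13, [], [], r, unary f', [], [], cl]) (6 * a.length + 2) ∧
      (f' = 0 ↔ f = 0 ∧ Hit a r) := by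
    by_cases he : h = []
    · have h' := hh.1 he
      subst he
      exact ⟨f + 1, ((Runs.branch_nil rfl (Runs.push_stk 17 true (by simp))).mono
        (by omega)).congr rfl, by simp only [Hit, h']; simp⟩
    · have h' := not_not.1 (mt hh.2 he)
      have hc := Runs.clear_stk (L := [[], unary k, unary a.length, rw, a4, [], [], [], [], [],
        r.drop (a ++ a ++ a).length, [], S, a13, [], [], r, unary f, h, [], cl]) 18 (by simp)
      have hl' : (2 * (List.getD [[], unary k, unary a.length, rw, a4, [], [], [], [], [],
        r.drop (a ++ a ++ a).length, [], S, a13, [], [], r, unary f, h, [], cl] 18 []).length + 1)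
          + 1 ≤ 6 * a.length + 2 := by
        simp at hl ⊢; omega
      exact ⟨f, ((Runs.branch_ne_nil he hc).mono hl').congr rfl, by simp only [Hit, h']; simp⟩
  obtain ⟨f', hf, hf'⟩ := hfin
  refine ⟨f', ?_, hf'⟩
  have e1 : List.takeD a.length (true :: a ++ S).tail false = a := by
    rw [List.cons_append, List.tail_cons, List.takeD_eq_take _ (by simp), List.take_left]
  have e2 : (true :: a ++ S).drop (a.length + 1) = S := by simp
  have h1 := Runs.readRow [] (unary k) rw a4 [] [] [] [] (true :: a ++ S)
    [a13, [], [], r, unary f, [], [], cl] a.length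
  rw [e1, e2] at h1
  refine ((h1.seq ((Runs.tripleRow _ _ _ _ _ _ _ _ _ _ _ _).seq
    ((Runs.move_stk (x := 6) (y := 7) (by decide) (by simp) (by simp)).seq
    (((Runs.copy_stk (x := 16) (y := 10) (t := 11) (by decide) (by decide) (by decide)
      (by simp) rfl).congr (by simp)).seq (hm.seq (hf.seq (Runs.clear_stk 10 (by simp)))))))).mono
    ?_).congr ?_
  · simp; omega
  · simp [checkStk]

theorem Runs.loop_checkRow (k n : ℕ) (rw r cl a4 a13 : List Bool) (rows : List (List Bool)) :
    ∀ f, (∀ a ∈ rows, a.length = n) →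
    ∃ f', Runs (.loop 12 .checkRow) (checkStk k n f rw r (joinRows rows) [] cl a4 a13)
      (checkStk k n f' rw r [] [] cl a4 a13) ((86 * n + 11 * r.length + 31) * rows.length + 1) ∧
      (f' = 0 ↔ f = 0 ∧ ∀ a ∈ rows, Hit a r) := by
  induction rows with
  | nil => intro f _; exact ⟨f, (Runs.loop_nil rfl).mono (by simp), by simp⟩
  | cons a rows ih =>
    intro f h
    obtain ⟨f₁, h1, h1'⟩ := Runs.checkRow k n f rw r (joinRows rows) cl a4 a13 a (h a (by simp))
    obtain ⟨f₂, h2, h2'⟩ := ih f₁ fun b hb => h b (by simp [hb])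
    refine ⟨f₂, (Runs.loop_cons (by simp [checkStk, joinRows, stk]) ?_ h2).mono
      (B := (86 * n + 11 * r.length + 30) + _ + 1) ?_, ?_⟩
    · simpa [joinRows] using h1
    · rw [List.length_cons, mul_add]; omega
    · rw [h2', h1']; simp [and_assoc]

theorem Runs.checkHits (k n : ℕ) (r cl a4 a13 : List Bool) {rows : List (List Bool)}
    (hrows : ∀ a ∈ rows, a.length = n) :
    ∃ σ, Runs .checkHits (checkStk k n 0 (joinRows rows) r [] [] cl a4 a13) σ
      (86 * (n + r.length + (joinRows rows).length + 1) ^ 2) ∧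
      ((σ 0).head? = some true ↔ r.count true ≤ k ∧ ∀ a ∈ rows, Hit a r) := by
  obtain ⟨k', f, h1, h1'⟩ := Runs.checkCount k n (joinRows rows) r cl a4 a13
  obtain ⟨f', h2, h2'⟩ := Runs.loop_checkRow k' n (joinRows rows) r cl a4 a13 rows f hrows
  have h3 : ∃ σ, Runs (.branch 17 (.push 0 true) (.push 0 false) (.push 0 false))
      (checkStk k' n f' (joinRows rows) r [] [] cl a4 a13) σ 2 ∧
      ((σ 0).head? = some true ↔ f' = 0) := by
    cases f' with
    | zero => exact ⟨_, Runs.branch_nil rfl (Runs.push _ _ _), by simp⟩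
    | succ f' => exact ⟨_, Runs.branch_true (l := unary f') rfl (Runs.push _ _ _), by simp⟩
  obtain ⟨σ, h3, h3'⟩ := h3
  refine ⟨σ, (h1.seq (((Runs.copy_stk (x := 3) (y := 12) (t := 11) (by decide) (by decide)
    (by decide) (by simp) rfl).congr
      (τ := checkStk k' n f (joinRows rows) r (joinRows rows) [] cl a4
      a13) (by simp [checkStk])).seq (h2.seq h3))).mono ?_, ?_⟩
  · have hl := length_le_joinRows rows
    have := Nat.mul_le_mul_left (86 * n + 11 * r.length + 31) hl
    simp
    generalize (joinRows rows).length = L at *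
    nlinarith [Nat.zero_le n, Nat.zero_le r.length, Nat.zero_le L]
  · rw [h3', h2', h1']

/-- The hypothesis of the simulated algorithm is checked in time polynomial in its length. -/
theorem Runs.check (k n b m : ℕ) (σ : Stacks) {rows : List (List Bool)}
    (hrows : ∀ a ∈ rows, a.length = n) :
    ∃ σ', Runs .check (ParamPAC.joint (stk (kept n k b (joinRows rows))) m σ) σ'
      (94 * (n + (σ 0).length + (joinRows rows).length + 1) ^ 2) ∧
      ((σ' 0).head? = some true ↔ (σ 0).count true ≤ k ∧ ∀ a ∈ rows, Hit a (σ 0)) := by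
  obtain ⟨σ', h, h'⟩ := Runs.checkHits k n (σ 0) (unary m) (List.replicate k false) (unary b) hrows
  have h2 := h.shift 30 (by decide)
    (Function.update (ParamPAC.joint (stk (kept n k b (joinRows rows))) m σ)
    30 [])
  refine ⟨_, ((Runs.move (by decide) _).seq (((Runs.move (by decide) _).congr ?_).seq h2)).mono ?_,
    h'⟩
  · funext i
    by_cases hi : i < 30
    · simp only [hi, if_true]
      by_cases h16 : i = 16
      · subst h16
        change ((σ 0).reverse ++ []).reverse ++ [] = σ 0
        simp
      · interval_cases i <;> first | rfl | exact absurd rfl h16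
    · simp only [hi, if_false]
      rw [Function.update_of_ne (by omega), Function.update_of_ne (by omega)]
      by_cases h30 : i = 30
      · subst h30; simp
      · rw [Function.update_of_ne (by omega), Function.update_of_ne (by omega),
          Function.update_of_ne (by omega)]
  · have e30 : ParamPAC.joint (stk (kept n k b (joinRows rows))) m σ 30 = σ 0 := rfl
    have e11 : ParamPAC.joint (stk (kept n k b (joinRows rows))) m σ 11 = [] := rfl
    simp [e30, e11]
    generalize (joinRows rows).length = L
    nlinarith [Nat.zero_le n, Nat.zero_le (σ 0).length, Nat.zero_le L]

/-- A string that passes the check yields a hitting set, formed by the elements one of whose three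
copies it contains. -/
theorem hasHittingSet_of_hit {n k : ℕ} {rows : List (List Bool)}
    (hrows : ∀ a ∈ rows, a.length = n) {r : List Bool} (hk : r.count true ≤ k)
    (h : ∀ a ∈ rows, Hit a r) : HasHittingSet n rows k := by
  classical
  obtain ⟨S, hS, -⟩ := exists_of_fvsRep_eq (r := r) (N := r.length) rfl
  have hcard : S.card ≤ k := by rwa [hS, count_bitsOf] at hk
  refine ⟨Finset.univ.filter fun i : Fin n => ∃ v ∈ S, (v : ℕ) % n = i, ?_, fun a ha => ?_⟩
  · rcases Nat.eq_zero_or_pos n with rfl | hn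
    · simp
    · refine le_trans (Finset.card_le_card (t := S.image fun v => ⟨(v : ℕ) % n, Nat.mod_lt _ hn⟩)
        fun i hi => ?_) (Finset.card_image_le.trans hcard)
      obtain ⟨v, hv, e⟩ := (Finset.mem_filter.1 hi).2
      exact Finset.mem_image.2 ⟨v, hv, Fin.ext e⟩
  · obtain ⟨i, hi, hr⟩ := h a ha
    have hi' := (isOn_triple a [] i).1 (by simpa using hi)
    have hi2 : IsOn a (i % a.length) := by
      rcases hi' with h | h
      · exact h.2
      · simp [IsOn] at h
    rw [hrows a ha] at hi2
    have hlt := hi2.lt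
    rw [hrows a ha] at hlt
    have hmem : (⟨i, hr.lt⟩ : Fin r.length) ∈ S := by
      have : IsOn (bitsOf S) i := by rwa [← hS]
      simpa [IsOn, bitsOf, hr.lt] using this
    exact ⟨⟨i % n, hlt⟩, Finset.mem_filter.2 ⟨Finset.mem_univ _, _, hmem, rfl⟩, hi2⟩

/-! ### Preparing the simulation -/

namespace Prog

/-- Halve the unary number on stack 7. -/
def halve : Prog :=
  .seq (.loop 7 (.seq (.pop 7) (.branch 7 (skip 11) (.seq (.pop 7) (.push 8 true))
    (.seq (.pop 7) (.push 8 true))))) (move 8 7)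

/-- Put as many bits on stack 13 as there are binary digits in the number on stack 7. -/
def countDigits : Prog := .loop 7 (.seq (.push 13 true) halve)

/-- Multiply the unary number on stack 20 by the one on stack 17. -/
def mulClock : Prog := .seq (move 20 18)
    (forBits 18 (pushEach 17 20 true 11) (pushEach 17 20 true 11))

/-- Multiply the unary number on stack 20 by a power of the one on stack 17. -/
def mulClockPow : ℕ → Prog
  | 0 => skip 11
  | c + 1 => .seq (mulClockPow c) mulClock

/-- From a decoded instance, compute the auxiliary stacks of the sampling program, the number
`3 n + k` of vertices on stack 16 and its square on stack 15. -/
def prepareSampler : Prog :=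
  .seq (pushEach 3 7 true 11) (.seq countDigits (.seq (pushEach 1 4 false 11)
    (.seq (pushEach 1 16 true 11) (.seq (pushEach 2 16 true 11) (.seq (pushEach 2 16 true 11)
      (.seq (pushEach 2 16 true 11) (.seq (copy 16 10 11) squareVertices)))))))

/-- Multiply the number on stack 20 by a power of the size of the input of the learning
algorithm. -/
def prepareClock (c : ℕ) : Prog :=
  .seq (pushEach 15 17 true 11) (.seq (pushEach 16 17 true 11) (.seq (pushEach 3 17 true 11)
    (.seq (pushEach 3 17 true 11) (.seq (.push 17 true) (.seq (.push 17 true) (.seq (.push 17 true)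
      (.seq (.push 17 true) (.seq (.push 17 true) (.seq (mulClockPow c) (.push 20 true))))))))))

/-- Write the inputs of the learning algorithm. -/
def prepareInputs : Prog :=
  .seq (move 15 30) (.seq (pushEach 3 31 true 11) (.seq (pushEach 3 31 true 11)
    (.seq (.push 31 true) (.seq (.push 31 true) (.seq (.push 32 true) (.seq (.push 32 true)
      (.seq (pushEach 1 33 true 11) (.seq (.push 34 true) (.seq (clear 16) (clear 17))))))))))

end Prog

/-- The stacks during the preparation of the simulation. -/
def setupStk (k n : ℕ) (rw s4 s7 s8 s10 s13 s15 s16 s17 s18 s20 : List Bool)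
    (inputs : List (List Bool)) : Stacks :=
  stk ([] :: unary k :: unary n :: rw :: s4 :: [] :: [] :: s7 :: s8 :: [] :: s10 ::
    [] :: [] :: s13 ::
    [] :: s15 :: s16 :: s17 :: s18 :: [] :: s20 :: [] :: [] :: [] :: [] :: [] :: [] :: [] :: [] ::
    [] :: inputs)

theorem length_unary (m : ℕ) : (unary m).length = m := by simp [unary]

theorem unary_append (a b : ℕ) : unary a ++ unary b = unary (a + b) := by
  simp [unary, List.replicate_append_replicate]

theorem reverse_unary (a : ℕ) : (unary a).reverse = unary a := by simp [unary]

section setup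

variable (k n : ℕ) (rw s4 s7 s8 s10 s13 s15 s16 s17 s18 s20 : List Bool)
  (inputs : List (List Bool))

theorem Runs.halve (m : ℕ) :
    Runs .halve (setupStk k n rw s4 (unary m) [] s10 s13 s15 s16 s17 s18 s20 inputs)
      (setupStk k n rw s4 (unary (m / 2)) [] s10 s13 s15 s16 s17 s18 s20 inputs) (7 * m + 2) := by
  have key : ∀ m a, Runs (.loop 7 (.seq (.pop 7) (.branch 7 (.skip 11)
      (.seq (.pop 7) (.push 8 true)) (.seq (.pop 7) (.push 8 true)))))
      (setupStk k n rw s4 (unary m) (unary a) s10 s13 s15 s16 s17 s18 s20 inputs)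
      (setupStk k n rw s4 [] (unary (a + m / 2)) s10 s13 s15 s16 s17 s18 s20 inputs)
      (5 * m + 1) := by
    intro m
    induction m using Nat.strong_induction_on with
    | _ m ih =>
      intro a
      match m with
      | 0 => exact Runs.loop_nil rfl
      | 1 =>
        exact (Runs.loop_cons (σ₂ := setupStk k n rw s4 [] (unary a) s10 s13 s15 s16 s17 s18 s20
          inputs) (by simp [stk, unary]) ((Runs.pop_stk 7 (by simp)).seq
          (Runs.branch_nil rfl (Runs.skip 11 _))) (Runs.loop_nil rfl)).mono (by omega)
      | m + 2 =>
        have h := ih m (by omega) (a + 1)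
        rw [show a + 1 + m / 2 = a + (m + 2) / 2 by omega] at h
        exact (Runs.loop_cons (by simp [stk, unary]) ((Runs.pop_stk 7 (by simp)).seq
          (Runs.branch_true (l := unary m) rfl ((Runs.pop_stk 7 (by simp)).seq
          (Runs.push_stk 8 true (by simp))))) h).mono (by omega)
  have h := key m 0
  rw [zero_add] at h
  refine ((h.seq (Runs.move_stk (x := 8) (y := 7) (by decide) (by simp) (by simp))).mono ?_).congr
    ?_
  · simp [length_unary]; omega
  · simp [setupStk, reverse_unary]

theorem Runs.countDigits (m : ℕ) :
    ∀ a, ∃ b, Runs .countDigits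
      (setupStk k n rw s4 (unary m) [] s10 (unary a) s15 s16 s17 s18 s20 inputs)
      (setupStk k n rw s4 [] [] s10 (unary (a + b)) s15 s16 s17 s18 s20 inputs) (22 * m + 1) ∧
      m < 2 ^ b ∧ (2 ^ b ≤ 2 * m ∨ m = 0 ∧ b = 0) := by
  induction m using Nat.strong_induction_on with
  | _ m ih =>
    intro a
    rcases Nat.eq_zero_or_pos m with rfl | hm
    · exact ⟨0, Runs.loop_nil rfl, by simp, Or.inr ⟨rfl, rfl⟩⟩
    · obtain ⟨b, hb, h1, h2⟩ := ih (m / 2) (by omega) (a + 1)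
      rw [show a + 1 + b = a + (b + 1) by omega] at hb
      refine ⟨b + 1, (Runs.loop_cons ?_ (((Runs.push_stk 13 true (by simp)).congr rfl).seq
        (Runs.halve k n rw s4 s10 (unary (a + 1)) s15 s16 s17 s18 s20 inputs m))
          hb).mono ?_, ?_, ?_⟩
      · simp [stk, unary]; omega
      · omega
      · rw [pow_succ]; omega
      · rw [pow_succ]
        rcases h2 with h2 | ⟨h2, rfl⟩
        · omega
        · left; omega

theorem Runs.mulClock (v M : ℕ) :
    Runs .mulClock (setupStk k n rw s4 s7 s8 s10 s13 s15 s16 (unary M) [] (unary v) inputs)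
      (setupStk k n rw s4 s7 s8 s10 s13 s15 s16 (unary M) [] (unary (v * M)) inputs)
      ((9 * M + 9) * v + 2) := by
  have hg : ∀ i, (fun l : List Bool => unary M ++ l)^[i] [] = unary (i * M) := by
    intro i
    induction i with
    | zero => simp [unary]
    | succ i ih => rw [Function.iterate_succ_apply', ih, unary_append]; congr 1; ring
  have h := Runs.forBits_iterate (x := 18) (p := .pushEach 17 20 true 11)
    (fun l (r : List Bool) => setupStk k n rw s4 s7 s8 s10 s13 s15 s16 (unary M) l r inputs)
    (fun l => unary M ++ l) (9 * M + 2) (fun _ _ => rfl) (fun _ _ _ => update_stk (by simp) _)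
    (unary v) [] (fun l₂ i _ => ((Runs.pushEach_stk true (by decide) (by decide) (by decide)
      (by simp) rfl).mono (by simp [length_unary])).congr (by simp [setupStk, unary]))
  rw [hg, length_unary] at h
  refine (Runs.seq ((Runs.move_stk (x := 20) (y := 18) (by decide) (by simp) (by simp)).congr
    (by simp [setupStk, reverse_unary])) h).mono ?_
  simp [length_unary]
  ring_nf
  omega

theorem Runs.mulClockPow (v M : ℕ) (hM : 0 < M) (c : ℕ) :
    Runs (.mulClockPow c) (setupStk k n rw s4 s7 s8 s10 s13 s15 s16 (unary M) [] (unary v) inputs)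
      (setupStk k n rw s4 s7 s8 s10 s13 s15 s16 (unary M) [] (unary (v * M ^ c)) inputs)
      (c * ((9 * M + 9) * (v * M ^ c) + 2) + 2) := by
  induction c with
  | zero => simpa [Prog.mulClockPow] using Runs.skip 11 _
  | succ c ih =>
    have h := ih.seq (Runs.mulClock k n rw s4 s7 s8 s10 s13 s15 s16 inputs (v * M ^ c) M)
    rw [mul_assoc, ← pow_succ] at h
    refine h.mono ?_
    have h1 : (9 * M + 9) * (v * M ^ c) ≤ (9 * M + 9) * (v * M ^ (c + 1)) :=
      Nat.mul_le_mul_left _ (Nat.mul_le_mul_left _ (Nat.pow_le_pow_right hM (by omega)))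
    calc _ ≤ (c * ((9 * M + 9) * (v * M ^ (c + 1)) + 2) + 2) +
          ((9 * M + 9) * (v * M ^ (c + 1)) + 2) := by gcongr
      _ = _ := by ring

end setup

theorem Runs.prepareSampler (k n : ℕ) (rw s20 : List Bool) (inputs : List (List Bool)) :
    ∃ b, Runs .prepareSampler (setupStk k n rw [] [] [] [] [] [] [] [] [] s20 inputs)
      (setupStk k n rw (List.replicate k false) [] [] [] (unary b)
        (unary ((3 * n + k) * (3 * n + k))) (unary (3 * n + k)) [] [] s20 inputs)
      (100 * (n + k + rw.length + 1) ^ 2) ∧ rw.length < 2 ^ b ∧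
      2 ^ b ≤ 2 * rw.length + 1 := by
  obtain ⟨b, hb, h1, h2⟩ := Runs.countDigits k n rw [] [] [] [] [] [] s20 inputs rw.length 0
  refine ⟨b, ?_, h1, ?_⟩
  have hsq := Runs.squareVertices [] (unary k) (unary n) rw (List.replicate k false) [] [] [] [] []
    [] (unary b) [] [] ([] :: [] :: [] :: s20 :: [] :: [] :: [] :: [] :: [] :: [] ::
      [] :: [] :: [] ::
      inputs) (3 * n + k)
  rw [zero_add] at hb
  swap
  · rcases h2 with h2 | ⟨-, rfl⟩
    · omega
    · simp
  refine ((Runs.seq ((Runs.pushEach_stk (x := 3) (y := 7) (t := 11) true (by decide) (by decide)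
      (by decide) (by simp) rfl).congr (by simp [setupStk, unary])) (hb.seq
    (((Runs.pushEach_stk (x := 1) (y := 4) (t := 11) false (by decide) (by decide) (by decide)
      (by simp) rfl).congr (τ := setupStk k n rw (List.replicate k false) [] [] [] (unary b)
        [] [] [] [] s20 inputs) (by simp [setupStk, unary])).seq
    (((Runs.pushEach_stk (x := 1) (y := 16) (t := 11) true (by decide) (by decide) (by decide)
      (by simp) rfl).congr (τ := setupStk k n rw (List.replicate k false) [] [] [] (unary b)
        [] (unary k) [] [] s20 inputs) (by simp [setupStk, unary])).seq
    (((Runs.pushEach_stk (x := 2) (y := 16) (t := 11) true (by decide) (by decide) (by decide)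
      (by simp) rfl).congr (τ := setupStk k n rw (List.replicate k false) [] [] [] (unary b)
        [] (unary (n + k)) [] [] s20 inputs) (by simp [setupStk, unary])).seq
    (((Runs.pushEach_stk (x := 2) (y := 16) (t := 11) true (by decide) (by decide) (by decide)
      (by simp) rfl).congr (τ := setupStk k n rw (List.replicate k false) [] [] [] (unary b)
        [] (unary (n + (n + k))) [] [] s20 inputs) (by simp [setupStk, unary])).seq
    (((Runs.pushEach_stk (x := 2) (y := 16) (t := 11) true (by decide) (by decide) (by decide)
      (by simp) rfl).congr (τ := setupStk k n rw (List.replicate k false) [] [] [] (unary b)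
        [] (unary (3 * n + k)) [] [] s20 inputs) (by
          rw [show 3 * n + k = n + (n + (n + k)) by ring]; simp [setupStk, unary])).seq
    (((Runs.copy_stk (x := 16) (y := 10) (t := 11) (by decide) (by decide) (by decide) (by simp)
      rfl).congr (by simp)).seq hsq)))))))).mono ?_).congr ?_
  · simp [length_unary]
    generalize rw.length = L
    nlinarith [Nat.zero_le n, Nat.zero_le k, Nat.zero_le L]
  · simp [setupStk]

theorem Runs.prepareClock (c k n v N2 N : ℕ) (rw s4 s13 : List Bool) (inputs : List (List Bool)) :
    Runs (.prepareClock c) (setupStk k n rw s4 [] [] [] s13 (unary N2) (unary N) [] [] (unary v)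
        inputs)
      (setupStk k n rw s4 [] [] [] s13 (unary N2) (unary N)
        (unary (N2 + N + (2 * rw.length + 2) + 2 + 1)) []
        (unary (v * (N2 + N + (2 * rw.length + 2) + 2 + 1) ^ c + 1)) inputs)
      (9 * N2 + 9 * N + 18 * rw.length + 14 +
        (c * ((9 * (N2 + N + (2 * rw.length + 2) + 2 + 1) + 9) *
        (v * (N2 + N + (2 * rw.length + 2) + 2 + 1) ^ c) + 2) + 2) + 1) := by
  have h := Runs.mulClockPow k n rw s4 [] [] [] s13 (unary N2) (unary N) inputs v
    (N2 + N + (2 * rw.length + 2) + 2 + 1) (by omega) c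
  have e : unary (N2 + N + (2 * rw.length + 2) + 2 + 1) = true :: true :: true :: true :: true ::
      (unary rw.length ++ (unary rw.length ++ (unary N ++ unary N2))) := by
    simp only [unary_append]
    rw [show N2 + N + (2 * rw.length + 2) + 2 + 1 = rw.length + (rw.length + (N + N2)) + 5 by ring]
    rfl
  refine (((Runs.pushEach_stk (x := 15) (y := 17) (t := 11) true (by decide) (by decide)
      (by decide) (by simp) rfl).congr (τ := setupStk k n rw s4 [] [] [] s13 (unary N2) (unary N)
        (unary N2) [] (unary v) inputs) (by simp [setupStk, unary])).seq
    (((Runs.pushEach_stk (x := 16) (y := 17) (t := 11) true (by decide) (by decide)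
      (by decide) (by simp) rfl).congr (τ := setupStk k n rw s4 [] [] [] s13 (unary N2) (unary N)
        (unary N ++ unary N2) [] (unary v) inputs) (by simp [setupStk, unary])).seq
    (((Runs.pushEach_stk (x := 3) (y := 17) (t := 11) true (by decide) (by decide)
      (by decide) (by simp) rfl).congr (τ := setupStk k n rw s4 [] [] [] s13 (unary N2) (unary N)
        (unary rw.length ++ (unary N ++ unary N2)) [] (unary v) inputs)
        (by simp [setupStk, unary])).seq
    (((Runs.pushEach_stk (x := 3) (y := 17) (t := 11) true (by decide) (by decide)
      (by decide) (by simp) rfl).congr (τ := setupStk k n rw s4 [] [] [] s13 (unary N2) (unary N)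
        (unary rw.length ++ (unary rw.length ++ (unary N ++ unary N2))) [] (unary v) inputs)
        (by simp [setupStk, unary])).seq
    (((Runs.push_stk 17 true (by simp))).seq ((Runs.push_stk 17 true (by simp)).seq
    ((Runs.push_stk 17 true (by simp)).seq ((Runs.push_stk 17 true (by simp)).seq
    (((Runs.push_stk 17 true (by simp)).congr (by rw [e]; rfl)).seq
    (h.seq ((Runs.push_stk 20 true (by simp)).congr rfl))))))))))).mono ?_
  simp [length_unary]
  omega

theorem Runs.prepareInputs (k n N2 N m b : ℕ) (rw s17 : List Bool) :
    Runs .prepareInputs (setupStk k n rw (List.replicate k false) [] [] [] (unary b) (unary N2)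
        (unary N) s17 [] (unary m) [[], [], [], [], []])
      (ParamPAC.joint (stk (kept n k b rw)) m (stk (learnerInputs N2 (2 * rw.length + 2) 2 k 1)))
      (4 * N2 + 18 * rw.length + 9 * k + 2 * N + 2 * s17.length + 20) := by
  have e : unary (2 * rw.length + 2) = true :: true :: (unary rw.length ++ unary rw.length) := by
    rw [unary_append, two_mul]
    rfl
  have hfin : setupStk k n rw (List.replicate k false) [] [] [] (unary b) [] [] [] [] (unary m)
      (learnerInputs N2 (2 * rw.length + 2) 2 k 1) =
      ParamPAC.joint (stk (kept n k b rw)) m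
        (stk (learnerInputs N2 (2 * rw.length + 2) 2 k 1)) := by
    funext i
    rcases Nat.lt_or_ge i 30 with hi | hi
    · interval_cases i <;> rfl
    · obtain ⟨j, rfl⟩ : ∃ j, i = j + 30 := ⟨i - 30, by omega⟩
      rw [joint_high]
      rfl
  rw [← hfin]
  refine (((Runs.move_stk (x := 15) (y := 30) (by decide) (by simp) (by simp)).congr
      (τ := setupStk k n rw (List.replicate k false) [] [] [] (unary b) [] (unary N) s17 []
        (unary m) [unary N2, [], [], [], []]) (by simp [setupStk, unary])).seq
    (((Runs.pushEach_stk (x := 3) (y := 31) (t := 11) true (by decide) (by decide) (by decide)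
      (by simp) rfl).congr (τ := setupStk k n rw (List.replicate k false) [] [] [] (unary b) []
        (unary N) s17 [] (unary m) [unary N2, unary rw.length, [], [], []])
        (by simp [setupStk, unary])).seq
    (((Runs.pushEach_stk (x := 3) (y := 31) (t := 11) true (by decide) (by decide) (by decide)
      (by simp) rfl).congr (τ := setupStk k n rw (List.replicate k false) [] [] [] (unary b) []
        (unary N) s17 [] (unary m) [unary N2, unary rw.length ++ unary rw.length, [], [], []])
        (by simp [setupStk, unary])).seq
    ((Runs.push_stk 31 true (by simp)).seq
    (((Runs.push_stk 31 true (by simp)).congr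
      (τ := setupStk k n rw (List.replicate k false) [] [] []
        (unary b) [] (unary N) s17 [] (unary m) [unary N2, unary (2 * rw.length + 2), [], [], []])
        (by rw [e]; rfl)).seq
    ((Runs.push_stk 32 true (by simp)).seq ((Runs.push_stk 32 true (by simp)).seq
    (((Runs.pushEach_stk (x := 1) (y := 33) (t := 11) true (by decide) (by decide) (by decide)
      (by simp) rfl).congr (τ := setupStk k n rw (List.replicate k false) [] [] [] (unary b) []
        (unary N) s17 [] (unary m) [unary N2, unary (2 * rw.length + 2), unary 2, unary k, []])
        (by simp [setupStk, unary])).seq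
    ((Runs.push_stk 34 true (by simp)).seq ((Runs.clear_stk 16 (by simp)).seq
      ((Runs.clear_stk 17 (by simp)).congr rfl))))))))))).mono ?_
  simp [length_unary]
  omega

/-- Put the value that `p` computes for the number on stack 1 on stack 20; numbers on stack 14 carry
the end mark `false` of `encodeList`. -/
def Prog.computeBound (p : Prog) : Prog :=
  .seq (.push 14 false) (.seq (copy 1 14 11) (.seq p (.seq (move 14 20) (.pop 20))))

/-- Prepare the simulation of a learning algorithm whose running time is bounded by a function
computed by `p` and a polynomial of degree `c`. -/
def Prog.setup (p : Prog) (c : ℕ) : Prog :=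
  .seq decode (.seq (computeBound p) (.seq prepareSampler (.seq (prepareClock c) prepareInputs)))

/-- The clock for the simulation: the running time of the learning algorithm on graphs with
`3 n + k` vertices, where `v` is the value of the computable factor, for error
`1 / (2 L + 2)`. -/
def clock (n k L v c : ℕ) : ℕ :=
  v * ((3 * n + k) * (3 * n + k) + (3 * n + k) + (2 * L + 2) + 2 + 1) ^ c + 1

/-- A bound for the time needed to prepare the simulation. -/
def setupCost (V G τ c : ℕ) : ℕ :=
  2000 * V ^ 2 + 4 * G + τ + c * (200 * V ^ 2 * (G * (21 * V ^ 2) ^ c) + 2)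

/-- The instance is decoded, and everything the simulation needs is computed: the number `b` of
coins per sample, the clock and the inputs of the learning algorithm. -/
theorem Runs.setup {p : Prog} {g t : ℕ → ℕ}
    (hp : ∀ σ k, Runs p (frame σ 14 [encodeList [k]]) (frame σ 14 [encodeList [g k]]) (t k))
    (c : ℕ) (x : List Bool) (k : ℕ) {G τ : ℕ} (hG : ∀ k' ≤ k, g k' ≤ G) (hτ : ∀ k' ≤ k, t k' ≤ τ) :
    ∃ n rows k' b, IsFamily n rows ∧ k' ≤ k ∧ n ≤ x.length + 1 ∧
      (joinRows rows).length ≤ x.length + 2 ∧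
      ((x, k) ∈ hittingSet ↔ HasHittingSet n rows k') ∧
      (joinRows rows).length < 2 ^ b ∧ 2 ^ b ≤ 2 * (joinRows rows).length + 1 ∧
      Runs (.setup p c) (stk (instanceInputs x k))
        (ParamPAC.joint (stk (kept n k' b (joinRows rows)))
          (clock n k' (joinRows rows).length (g k') c)
          (stk (learnerInputs ((3 * n + k') * (3 * n + k'))
            (2 * (joinRows rows).length + 2) 2 k' 1)))
        (setupCost (x.length + k + 2) G τ c) := by
  obtain ⟨n, rows, k', hr, hk, hn, hL, hiff, hdec⟩ := Runs.decode [] [] []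
    (List.replicate 22 []) x k
  obtain ⟨b, hb, hb1, hb2⟩ := Runs.prepareSampler k' n (joinRows rows) (unary (g k'))
    [[], [], [], [], []]
  refine ⟨n, rows, k', b, hr, hk, hn, hL, hiff, hb1, hb2, ?_⟩
  set N := 3 * n + k' with hN
  have h2 := Runs.prepareClock c k' n (g k') (N * N) N (joinRows rows) (List.replicate k' false)
    (unary b) [[], [], [], [], []]
  have h3 := Runs.prepareInputs k' n (N * N) N (clock n k' (joinRows rows).length (g k') c) b
    (joinRows rows) (unary (N * N + N + (2 * (joinRows rows).length + 2) + 2 + 1))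
  have hstart : stk (instanceInputs x k) = stk ([x, unary k] ++ List.replicate 33 []) :=
    (stk_append_nil [x, unary k] 33).symm
  have hcomp : ∀ j, frame (stk [[], unary k', unary n, joinRows rows]) 14 [encodeList [j]] =
      stk ([[], unary k', unary n, joinRows rows, [], [], [], [], [], [], [], [], [], [],
        encodeList [j]] ++ List.replicate 20 []) := by
    intro j
    rw [stk_append_nil]
    have e := frame_append (fun _ => []) 0
      [[], unary k', unary n, joinRows rows, [], [], [], [], [], [],
      [], [], [], []] [encodeList [j]]
    rw [frame_zero, frame_zero, List.length] at e
    have e' := stk_append_nil [[], unary k', unary n, joinRows rows] 10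
    exact (congrArg (fun σ => frame σ 14 [encodeList [j]]) e'.symm).trans e.symm
  have hp' := hp (stk [[], unary k', unary n, joinRows rows]) k'
  rw [hcomp, hcomp] at hp'
  have henc : ∀ j, encodeList [j] = unary j ++ [false] := fun j => by simp [encodeList, unary]
  have hmid : Runs (.computeBound p)
      (setupStk k' n (joinRows rows) [] [] [] [] [] [] [] [] [] [] [[], [], [], [], []])
      (setupStk k' n (joinRows rows) [] [] [] [] [] [] [] [] [] (unary (g k')) [[], [], [], [], []])
      (1 + (9 * k' + 2 + (t k' + (4 * (g k' + 1) + 1 + 1)))) := by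
    refine ((Runs.push_stk 14 false (by simp)).seq
      (((Runs.copy_stk (x := 1) (y := 14) (t := 11) (by decide) (by decide) (by decide) (by simp)
        rfl).congr (by rw [henc]; rfl)).seq (hp'.seq
      ((Runs.move_stk (x := 14) (y := 20) (by decide) (by simp) (by simp)).seq
      (Runs.pop_stk 20 (by simp)))))).mono ?_ |>.congr ?_
    · simp [length_unary, henc]
    · simp [setupStk, henc, reverse_unary]
  have hdec' := hdec.congr (τ := setupStk k' n (joinRows rows) [] [] [] [] [] [] [] [] [] []
    [[], [], [], [], []]) rfl
  have hall := hdec'.seq (hmid.seq (hb.seq (h2.seq h3)))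
  rw [hstart]
  refine hall.mono ?_
  have hg := hG k' hk
  have ht := hτ k' hk
  rw [length_unary]
  generalize (joinRows rows).length = L at *
  obtain ⟨V, hV⟩ : ∃ V, V = x.length + k + 2 := ⟨_, rfl⟩
  have hV2 : 2 ≤ V := by omega
  have e1 : x.length + k + 1 ≤ V := by omega
  have e2 : n + k' + L + 1 ≤ 2 * V := by omega
  have e3 : N ≤ 4 * V := by omega
  have e4 : N * N ≤ 16 * V ^ 2 := (Nat.mul_le_mul e3 e3).trans (by nlinarith)
  have e5 : 2 * V ≤ V ^ 2 := by nlinarith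
  have e6 : N * N + N + (2 * L + 2) + 2 + 1 ≤ 21 * V ^ 2 := by omega
  have e7 : g k' * (N * N + N + (2 * L + 2) + 2 + 1) ^ c ≤ G * (21 * V ^ 2) ^ c := by gcongr
  have e8 : (9 * (N * N + N + (2 * L + 2) + 2 + 1) + 9) *
      (g k' * (N * N + N + (2 * L + 2) + 2 + 1) ^ c) ≤ 200 * V ^ 2 * (G * (21 * V ^ 2) ^ c) :=
    Nat.mul_le_mul (by omega) e7
  have e9 := Nat.mul_le_mul_left c (Nat.add_le_add_right e8 2)
  have e10 : 100 * (x.length + k + 1) ^ 2 ≤ 100 * V ^ 2 := by gcongr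
  have e11 : 100 * (n + k' + L + 1) ^ 2 ≤ 400 * V ^ 2 := by
    calc _ ≤ 100 * (2 * V) ^ 2 := by gcongr
      _ = _ := by ring
  rw [← hV, setupCost]
  omega

/-! ### A learning algorithm finds hitting sets -/

/-- A program without access to samples puts at most one bit on each stack per step. -/
theorem Prog.length_stack_le (F x : ℕ) : ∀ (p : Prog) (s s' : State),
    some s' ∈ (p.eval noOracle F s).support →
      (s'.stack x).length + s.time ≤ (s.stack x).length + s'.time := by
  intro p
  induction p with
  | push y b =>
    intro s s' h
    simp only [Prog.eval, PMF.support_pure, Set.mem_singleton_iff, Option.some.injEq] at h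
    subst h
    by_cases hx : x = y
    · subst hx; simp [State.tick, State.set]; omega
    · simp [State.tick, State.set, hx]
  | pop y =>
    intro s s' h
    simp only [Prog.eval, PMF.support_pure, Set.mem_singleton_iff, Option.some.injEq] at h
    subst h
    by_cases hx : x = y
    · subst hx; simp [State.tick, State.set]; omega
    · simp [State.tick, State.set, hx]
  | toss y =>
    intro s s' h
    simp only [Prog.eval, PMF.mem_support_map_iff, Option.some.injEq] at h
    obtain ⟨b, _, rfl⟩ := h
    by_cases hx : x = y
    · subst hx; simp [State.tick, State.set]; omega
    · simp [State.tick, State.set, hx]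
  | query y z =>
    intro s s' h
    simp only [Prog.eval, noOracle, PMF.mem_support_map_iff, Option.some.injEq, PMF.support_pure,
      Set.mem_singleton_iff, exists_eq_left] at h
    subst h
    by_cases hz : x = z
    · subst hz
      simp [State.tick, State.set]; omega
    · simp [State.tick, State.set, hz]
  | seq p q ihp ihq =>
    intro s s' h
    simp only [Prog.eval, PMF.mem_support_bind_iff] at h
    obtain ⟨o, ho, h⟩ := h
    cases o with
    | none => simp at h
    | some s₁ =>
      have := ihp _ _ ho
      have := ihq _ _ h
      omega
  | branch y p q r ihp ihq ihr =>
    intro s s' h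
    simp only [Prog.eval] at h
    have : (s'.stack x).length + s.tick.time ≤ (s.tick.stack x).length + s'.time := by
      match s.stack y, h with
      | [], h => exact ihp _ _ h
      | false :: _, h => exact ihq _ _ h
      | true :: _, h => exact ihr _ _ h
    simp only [State.tick] at this
    omega
  | loop y p ih =>
    have key : ∀ j s s', some s' ∈ (runLoop y (p.eval noOracle F) j s).support →
        (s'.stack x).length + s.time ≤ (s.stack x).length + s'.time := by
      intro j
      induction j with
      | zero => intro s s' h; simp [runLoop] at h
      | succ j ihj =>
        intro s s' h
        by_cases hs : s.stack y = []
        · rw [runLoop_nil hs] at h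
          simp only [PMF.support_pure, Set.mem_singleton_iff, Option.some.injEq] at h
          subst h
          simp [State.tick]
        · rw [runLoop_cons hs, PMF.mem_support_bind_iff] at h
          obtain ⟨o, ho, h⟩ := h
          cases o with
          | none => simp at h
          | some s₁ =>
            have h1 := ih _ _ ho
            have h2 := ihj _ _ h
            simp only [State.tick] at h1
            omega
    exact fun s s' h => key F s s' h

theorem drop_joinRows {n : ℕ} {rows : List (List Bool)} (hrows : ∀ a ∈ rows, a.length = n) (j : ℕ) :
    (joinRows rows).drop (j * (n + 1)) = joinRows (rows.drop j) := by
  induction j generalizing rows with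
  | zero => simp
  | succ j ih =>
    cases rows with
    | nil => simp [joinRows]
    | cons a rows =>
      have e : joinRows (a :: rows) = (true :: a) ++ joinRows rows := rfl
      rw [List.drop_succ_cons, ← ih fun b hb => hrows b (by simp [hb]), e, add_mul, one_mul,
        add_comm, ← List.drop_drop, List.drop_left' (by simp [hrows a (by simp)])]

theorem rowAt_joinRows {n : ℕ} {rows : List (List Bool)} (hrows : ∀ a ∈ rows, a.length = n) {j : ℕ}
    (hj : j < rows.length) : rowAt n (joinRows rows) j = rows[j] := by
  have hl := hrows _ (List.getElem_mem hj)
  rw [rowAt, drop_joinRows hrows, List.drop_eq_getElem_cons hj]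
  have e : joinRows (rows[j] :: rows.drop (j + 1)) =
    true :: (rows[j] ++ joinRows (rows.drop (j + 1))) := rfl
  rw [e, List.tail_cons, List.takeD_eq_take _ (by simp [hl]), List.take_left' hl]

/-- Behind the last row there are only empty ones; they pad the family to `2 ^ b` rows, and their
samples are empty graphs. -/
theorem rowAt_of_le {n : ℕ} {rows : List (List Bool)} (hrows : ∀ a ∈ rows, a.length = n) {j : ℕ}
    (hj : rows.length ≤ j) : rowAt n (joinRows rows) j = List.replicate n false := by
  rw [rowAt, drop_joinRows hrows, List.drop_eq_nil_of_le hj]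
  simp [joinRows, List.takeD_nil]

theorem length_tripled (n k : ℕ) (rw : List Bool) (j : ℕ) :
    (tripled (rowAt n rw j) k).length = 3 * n + k := by
  simp [tripled, rowAt]; omega

theorem isOn_tripled {a : List Bool} {k v : ℕ} :
    IsOn (tripled a k) v ↔ v < 3 * a.length ∧ IsOn a (v % a.length) := by
  rw [tripled, isOn_triple]
  refine or_iff_left ?_
  rintro ⟨-, h⟩
  have := List.mem_of_getElem? h
  simp at this

theorem kappa_learningFVS (r : List Bool) : learningFVS.kappa r = r.count true :=
  le_antisymm (Nat.sInf_le (le_refl (r.count true)))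
    (le_csInf ⟨_, le_refl (r.count true)⟩ fun _ h => h)

/-- The oracle that draws the cycle of a random row. -/
noncomputable def rowOracle (n k b : ℕ) (rw : List Bool) : Oracle :=
  (coins b).map fun w => (cycBits (tripled (rowAt n rw (valueOf w)) k), true)

/-- If there is a hitting set, the vertex set formed by it and further vertices is a consistent
representation; hence a learning algorithm finds, with probability one half, a representation that
errs on no row, and this one hits all rows. -/
theorem le_prob_of_learner {A : Prog} {T : ℕ} {n k b : ℕ} {rows : List (List Bool)}
    (hr : IsFamily n rows) (hH : HasHittingSet n rows k) (hb : (joinRows rows).length < 2 ^ b)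
    (hA : ∀ (r₀ : List Bool) (c₀ : (Fin ((3 * n + k) * (3 * n + k)) → Bool) → Bool),
      r₀.length = 3 * n + k → fvsRep r₀ = ⟨(3 * n + k) * (3 * n + k), c₀⟩ →
      ∀ D : PMF (Fin ((3 * n + k) * (3 * n + k)) → Bool), k = learningFVS.kappa r₀ →
      A.HaltsWithin (sampleOracle c₀ D) (learnerInputs ((3 * n + k) * (3 * n + k))
        (2 * (joinRows rows).length + 2) 2 k 1) T (fun s => (s.stack 0).count true ≤ k) ∧
      2⁻¹ ≤ A.prob (sampleOracle c₀ D) (learnerInputs ((3 * n + k) * (3 * n + k))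
        (2 * (joinRows rows).length + 2) 2 k 1) T (fun s =>
          ∃ c : (Fin ((3 * n + k) * (3 * n + k)) → Bool) → Bool,
            fvsRep (s.stack 0) = ⟨(3 * n + k) * (3 * n + k), c⟩ ∧
            err c c₀ D < (2⁻¹ : ENNReal) ^ b)) :
    A.HaltsWithin (rowOracle n k b (joinRows rows)) (learnerInputs ((3 * n + k) * (3 * n + k))
        (2 * (joinRows rows).length + 2) 2 k 1) T (fun _ => True) ∧
      2⁻¹ ≤ A.prob (rowOracle n k b (joinRows rows)) (learnerInputs ((3 * n + k) * (3 * n + k))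
        (2 * (joinRows rows).length + 2) 2 k 1) T (fun s =>
          (s.stack 0).count true ≤ k ∧ ∀ a ∈ rows, Hit a (s.stack 0)) := by
  classical
  have hrows : ∀ a ∈ rows, a.length = n := fun a ha => (hr a ha).1
  set N := 3 * n + k with hN
  have hn : n ≤ N := by omega
  obtain ⟨H, hHk, hHr⟩ := hH
  -- the hidden representation must have parameter exactly `k`; the `k` vertices that belong to no
  -- element make room for a set of this size
  obtain ⟨S₀, hS₀, hS₀k⟩ := Finset.exists_superset_card_eq (s := H.map (Fin.castLEEmb hn)) (n := k)
    (by simpa using hHk) (by simp [hN])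
  let X : List Bool → List Bool := fun w => tripled (rowAt n (joinRows rows) (valueOf w)) k
  have hXl : ∀ w, (X w).length = N := fun w => length_tripled n k _ _
  let D : PMF (Fin (N * N) → Bool) := (coins b).map fun w => cycMatrix N (X w)
  let c₀ : (Fin (N * N) → Bool) → Bool := fun x =>
    decide (IsFeedbackVertexSet (graphOf N x) (S₀ : Set (Fin N)))
  have hc₀ : ∀ w, c₀ (cycMatrix N (X w)) = true := by
    intro w
    simp only [c₀, decide_eq_true_eq]
    rcases Nat.lt_or_ge (valueOf w) rows.length with hj | hj
    · obtain ⟨i, hi, hon⟩ := hHr _ (List.getElem_mem hj)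
      have hlen := hrows _ (List.getElem_mem hj)
      refine isFVS_of_hit _ (Fin.castLE hn i)
        (Finset.mem_coe.2 (hS₀ (Finset.mem_map.2 ⟨i, hi, rfl⟩))) ?_
      simp only [X]
      rw [rowAt_joinRows hrows hj, isOn_tripled, hlen]
      simp only [Fin.val_castLE]
      refine ⟨by omega, ?_⟩
      rwa [Nat.mod_eq_of_lt i.2]
    · refine isFVS_of_no_bits ?_ _
      simp only [X]
      rw [rowAt_of_le hrows hj]
      simp [tripled]
  -- all labels are `true`, so samples can be drawn without knowledge of the hidden set
  have hO : sampleOracle c₀ D = rowOracle n k b (joinRows rows) := by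
    unfold sampleOracle rowOracle
    simp only [D, PMF.map_comp]
    congr 1
    funext w
    simp only [Function.comp, hc₀]
    rw [← cycBits_eq (hXl w)]
  obtain ⟨h1, h2⟩ := hA (bitsOf S₀) c₀ (by simp [bitsOf]) (fvsRep_bitsOf S₀) D
    (by rw [kappa_learningFVS, count_bitsOf, hS₀k])
  rw [hO] at h1 h2
  refine ⟨h1.mono le_rfl fun _ _ => trivial, h2.trans ?_⟩
  unfold Prog.prob
  refine PMF.toOuterMeasure_mono _ ?_
  rintro o ⟨⟨s, rfl, hs, c, hc, herr⟩, ho⟩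
  obtain ⟨s', hs', -, hcount⟩ := h1 _ ho
  cases hs'
  refine ⟨s, rfl, hs, hcount, fun a ha => ?_⟩
  obtain ⟨S, hS, hSc⟩ := exists_of_fvsRep_eq hc
  obtain ⟨j, hj, rfl⟩ := List.getElem_of_mem ha
  obtain ⟨w, hw, hwj⟩ := exists_valueOf b j
    (lt_of_lt_of_le hj ((length_le_joinRows rows).trans hb.le))
  have hXw : X w = tripled rows[j] k := by
    simp only [X]
    rw [hwj, rowAt_joinRows hrows hj]
  -- an error on the cycle of a row alone has probability at least `2⁻¹ ^ b`
  have hcw : c (cycMatrix N (X w)) = true := by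
    by_contra hne
    refine absurd herr (not_lt.2 ((le_coins hw).trans ?_))
    calc coins b w ≤ D (cycMatrix N (X w)) := by
          simp only [D, PMF.map_apply]
          exact le_trans (by simp) (ENNReal.le_tsum w)
      _ = D.toOuterMeasure {cycMatrix N (X w)} := (PMF.toOuterMeasure_apply_singleton _ _).symm
      _ ≤ err c c₀ D := by
          refine MeasureTheory.measure_mono ?_
          rintro x rfl
          simp only [Set.mem_ofPred_eq, hc₀]
          exact hne
  obtain ⟨i1, i2, i3, e1, e2, o1, o2, o3⟩ := exists_three_isOn (p := List.replicate k false)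
    (hr _ ha).2
  have hlX := hXl w
  rw [hSc, hXw] at hcw
  rw [hXw] at hlX
  obtain ⟨v, hv, hon⟩ := hit_of_isFVS hlX e1 e2 o1 o2 o3 _ hcw
  rw [isOn_tripled] at hon
  refine ⟨v, ?_, ?_⟩
  · have := (isOn_triple rows[j] [] v).2 (Or.inl hon)
    simpa using this
  · rw [hS]
    simpa [IsOn, bitsOf] using hv

/-! ### The randomized algorithm for Hitting Set -/

/-- Solve Hitting Set with the learning algorithm `A`. -/
def Prog.solve (p : Prog) (c : ℕ) (A : Prog) : Prog :=
  .seq (setup p c) (.seq (simulate drawSample A) check)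

/-- A bound for the time of the simulation, in terms of the size `V` of the instance. -/
def simulationCost (a V G c : ℕ) : ℕ := a * (1300 * V ^ 2) * (G * (21 * V ^ 2) ^ c + 2)

/-- A bound for the running time of `Prog.solve`. -/
def solveCost (a V G τ c : ℕ) : ℕ :=
  setupCost V G τ c + simulationCost a V G c +
    94 * (3 * V + 16 * V ^ 2 + simulationCost a V G c) ^ 2

theorem drawCost_le {n k b L V : ℕ} (hV : 2 ≤ V) (hn : n + 1 ≤ V) (hk : k ≤ V) (hL : L ≤ V)
    (hb : 2 ^ b ≤ 2 * L + 1) : drawCost n k b L + 1 ≤ 1300 * V ^ 2 := by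
  have h1 : 2 ^ b ≤ 3 * V := by omega
  have h2 : b ≤ 3 * V := Nat.lt_two_pow_self.le.trans h1
  have h3 : (13 * 2 ^ b + 6) * b ≤ (13 * (3 * V) + 6) * (3 * V) := by gcongr
  have h4 : 2 ^ b * (13 * n + 13) ≤ 3 * V * (13 * V) := Nat.mul_le_mul h1 (by omega)
  have h5 : 60 * (3 * n + k + 1) ^ 2 ≤ 60 * (4 * V) ^ 2 :=
    Nat.mul_le_mul_left _ (Nat.pow_le_pow_left (by omega) 2)
  unfold drawCost
  nlinarith

/-- Correctness of the algorithm: `A` is a learning algorithm whose running time on the samples that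
belong to a family with a hitting set is below the clock. -/
theorem solve_correct {p A : Prog} {g t : ℕ → ℕ}
    (hp : ∀ σ k, Runs p (frame σ 14 [encodeList [k]]) (frame σ 14 [encodeList [g k]]) (t k))
    (c : ℕ)
    (hA : ∀ (n k b : ℕ) (rows : List (List Bool)), IsFamily n rows → HasHittingSet n rows k →
      (joinRows rows).length < 2 ^ b → 2 ^ b ≤ 2 * (joinRows rows).length + 1 →
      ∃ T, T + 1 ≤ clock n k (joinRows rows).length (g k) c ∧
        A.HaltsWithin (rowOracle n k b (joinRows rows)) (learnerInputs ((3 * n + k) * (3 * n + k))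
          (2 * (joinRows rows).length + 2) 2 k 1) T (fun _ => True) ∧
        2⁻¹ ≤ A.prob (rowOracle n k b (joinRows rows)) (learnerInputs ((3 * n + k) * (3 * n + k))
          (2 * (joinRows rows).length + 2) 2 k 1) T (fun s =>
            (s.stack 0).count true ≤ k ∧ ∀ a ∈ rows, Hit a (s.stack 0)))
    (x : List Bool) (k : ℕ) {G τ : ℕ} (hG : ∀ k' ≤ k, g k' ≤ G) (hτ : ∀ k' ≤ k, t k' ≤ τ) :
    (Prog.solve p c A).HaltsWithin noOracle (instanceInputs x k)
        (solveCost (simCost A) (x.length + k + 2) G τ c)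
        (fun s => s.Accepts → (x, k) ∈ hittingSet) ∧
      ((x, k) ∈ hittingSet → 2⁻¹ ≤ (Prog.solve p c A).prob noOracle (instanceInputs x k)
        (solveCost (simCost A) (x.length + k + 2) G τ c) State.Accepts) := by
  obtain ⟨n, rows, k', b, hr, hk, hn, hL, hiff, hb, hb', t₀, ht₀, hset⟩ := Runs.setup hp c x k hG hτ
  have hrows : ∀ a ∈ rows, a.length = n := fun a ha => (hr a ha).1
  set V := x.length + k + 2 with hV
  set L := (joinRows rows).length with hLdef
  set N := 3 * n + k' with hN
  set clk := clock n k' L (g k') c with hclk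
  set base := stk (kept n k' b (joinRows rows)) with hbase
  set inp := stk (learnerInputs (N * N) (2 * L + 2) 2 k' 1) with hinp
  set K := simCost A * (drawCost n k' b L + 1) with hK
  set F := solveCost (simCost A) V G τ c with hF
  -- bounds for the three parts of the computation
  have e3 : N ≤ 4 * V := by omega
  have e4 : N * N ≤ 16 * V ^ 2 := (Nat.mul_le_mul e3 e3).trans (by nlinarith)
  have e5 : 2 * V ≤ V ^ 2 := by nlinarith
  have hclkb : clk + 1 ≤ G * (21 * V ^ 2) ^ c + 2 := by
    have e6 : N * N + N + (2 * L + 2) + 2 + 1 ≤ 21 * V ^ 2 := by omega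
    have e7 : g k' * (N * N + N + (2 * L + 2) + 2 + 1) ^ c ≤ G * (21 * V ^ 2) ^ c := by
      gcongr
      exact hG k' hk
    have e8 : clk = g k' * (N * N + N + (2 * L + 2) + 2 + 1) ^ c + 1 := rfl
    omega
  have hsim : K * (clk + 1) ≤ simulationCost (simCost A) V G c :=
    Nat.mul_le_mul (Nat.mul_le_mul_left _ (drawCost_le (by omega) (by omega) (by omega) (by omega)
      hb')) hclkb
  have hsetF : setupCost V G τ c + simulationCost (simCost A) V G c ≤ F := by
    rw [hF, solveCost]; omega
  obtain ⟨hsafe, hdom⟩ := (sampler_drawSample n k' b (joinRows rows)).simulated A F clk inp t₀ 0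
    (hsim.trans (by omega))
  set ν := (Prog.simulate .drawSample A).eval noOracle F ⟨joint base clk inp, t₀, 0⟩ with hν
  have heval : (Prog.solve p c A).run noOracle (instanceInputs x k) F = ν.bind fun o =>
      match o with
      | none => PMF.pure none
      | some s' => Prog.check.eval noOracle F s' := by
    rw [Prog.run, initial_eq_stk, Prog.solve]
    conv_lhs => unfold Prog.eval
    rw [hset _ _ _ _ (by omega), PMF.pure_bind, zero_add]
    rfl
  -- the check is deterministic, and correct for whatever hypothesis the simulation leaves behind
  have hcheck : ∀ o ∈ ν.support, ∃ m σ t₁ q, o = some ⟨joint base m σ, t₁, q⟩ ∧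
      ∃ s', Prog.check.eval noOracle F ⟨joint base m σ, t₁, q⟩ = PMF.pure (some s') ∧
        s'.time ≤ F ∧ (s'.Accepts ↔ (σ 0).count true ≤ k' ∧ ∀ a ∈ rows, Hit a (σ 0)) := by
    intro o ho
    obtain ⟨m, hm, σ, t₁, q, rfl, ht₁⟩ := hsafe o ho
    have hlen : (σ 0).length + t₀ ≤ (inp 0).length + t₁ := Prog.length_stack_le F 30 _ _ _ ho
    have h30 : (inp 0).length = N * N := by simp [inp, stk, learnerInputs, unary]
    have ht₁' : t₁ ≤ t₀ + K * (clk + 1) :=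
      ht₁.trans (Nat.add_le_add_left (Nat.mul_le_mul_left K (by omega)) t₀)
    have hσ : (σ 0).length ≤ N * N + K * (clk + 1) := by omega
    obtain ⟨σ', ⟨u, hu, hrun⟩, hacc⟩ := Runs.check k' n b m σ hrows
    rw [← hLdef] at hu hrun
    have hcost : 94 * (n + (σ 0).length + L + 1) ^ 2 ≤
        94 * (3 * V + 16 * V ^ 2 + simulationCost (simCost A) V G c) ^ 2 :=
      Nat.mul_le_mul_left _ (Nat.pow_le_pow_left (by omega) 2)
    have hF' : setupCost V G τ c + simulationCost (simCost A) V G c +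
        94 * (n + (σ 0).length + L + 1) ^ 2 ≤ F := by
      rw [hF, solveCost]; omega
    exact ⟨m, σ, t₁, q, rfl, _, hrun _ _ _ _ (by omega), by simp only; omega, hacc⟩
  refine ⟨fun o ho => ?_, fun hx => ?_⟩
  · rw [heval, PMF.mem_support_bind_iff] at ho
    obtain ⟨o₁, ho₁, ho⟩ := ho
    obtain ⟨m, σ, t₁, q, rfl, s', hs', ht, hacc⟩ := hcheck o₁ ho₁
    simp only at ho
    rw [hs', PMF.support_pure, Set.mem_singleton_iff] at ho
    refine ⟨s', ho, ht, fun ha => hiff.2 ?_⟩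
    obtain ⟨h1, h2⟩ := hacc.1 ha
    exact hasHittingSet_of_hit hrows h1 h2
  · obtain ⟨T, hT, hh, hprob⟩ := hA n k' b rows hr (hiff.1 hx) hb hb'
    refine hprob.trans ?_
    unfold Prog.prob
    rw [heval, ← ev_indicator, ← ev_indicator, ev_bind]
    -- transfer the probability of success from the learner to its simulation
    refine hdom T ⟨inp, 0, 0⟩ rfl (by simpa using hT) ?_ _ _ ?_
    · intro o ho
      obtain ⟨s, hs, hs', -⟩ := hh o ho
      exact ⟨s, hs, hs'⟩
    · rintro o ho o' ho' ⟨s, s', m', rfl, rfl, hst, -⟩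
      obtain ⟨m, σ, t₁, q, he, s'', hs'', ht, hacc⟩ := hcheck _ ho'
      cases he
      obtain ⟨rfl, rfl⟩ := joint_inj hst
      simp only [hs'', ev_pure]
      by_cases hs : s.time ≤ T ∧ (s.stack 0).count true ≤ k' ∧ ∀ a ∈ rows, Hit a (s.stack 0)
      · rw [Set.indicator_of_mem (s := {o | ∃ s, o = some s ∧ s.time ≤ F ∧ s.Accepts})
          ⟨s'', rfl, ht, hacc.2 hs.2⟩]
        exact Set.indicator_le_self' (fun _ _ => zero_le_one) _
      · rw [Set.indicator_of_notMem]
        · exact zero_le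
        · rintro ⟨s₁, he, h1, h2⟩
          cases he
          exact hs ⟨h1, h2⟩

/-- The running time has the required form, as the values and the running time of the program for
the factor of the clock depend on the parameter only. -/
theorem fptBound_solveCost (a c : ℕ) {G τ : ℕ → ℕ} (hG : Computable G) (hτ : Computable τ) :
    FPTBound fun n k => solveCost a (n + k + 1 + 1) (G k) (τ k) c := by
  have hV : FPTBound fun n k => n + k + 1 + 1 := FPTBound.size.add (FPTBound.const 1)
  have hV2 := hV.pow 2
  have hclk := (FPTBound.param hG).mul (((FPTBound.const 21).mul hV2).pow c)
  have hsim := ((FPTBound.const a).mul ((FPTBound.const 1300).mul hV2)).mul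
    (hclk.add (FPTBound.const 2))
  have hset := ((((FPTBound.const 2000).mul hV2).add ((FPTBound.const 4).mul
    (FPTBound.param hG))).add (FPTBound.param hτ)).add ((FPTBound.const c).mul
    ((((FPTBound.const 200).mul hV2).mul hclk).add (FPTBound.const 2)))
  exact (hset.add hsim).add ((FPTBound.const 94).mul
    (((((FPTBound.const 3).mul hV).add ((FPTBound.const 16).mul hV2)).add hsim).pow 2))

/-- If vertex sets can be learnt, then Hitting Set has a randomized algorithm: it runs the learner
with an error below the probability of each row, and checks the hypothesis. -/
theorem hittingSet_mem_randFPT (h : learningFVS ∈ fptSamplePAC) : hittingSet ∈ RandFPT := by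
  obtain ⟨T, ⟨f, c, hf, -, hT⟩, S, -, -, -, A, C, hA⟩ := h
  -- the factor of the clock that depends on the parameter; the distribution has parameter `1`
  let g : ℕ → ℕ := fun k => C * f (k, 1)
  have hg : Computable g := computable_mul (Computable.const C)
    (hf.comp (Computable.id.pair (Computable.const 1)))
  obtain ⟨p, t, ht, hp⟩ := exists_runs_of_computable hg
  obtain ⟨G, hG, hGm, hgG⟩ := exists_monotone_bound hg
  obtain ⟨τ, hτ, hτm, htτ⟩ := exists_monotone_bound ht
  obtain ⟨F, c', hF, hFm, hFb⟩ := fptBound_solveCost (simCost A) c hG hτ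
  refine ⟨.solve (p 14) c A, F, c', hF, hFm, fun x k => ?_⟩
  have h := solve_correct (A := A) (hp 14) c ?_ x k
    (fun k' hk' => (hgG k').trans (hGm hk')) (fun k' hk' => (htτ k').trans (hτm hk'))
  · obtain ⟨h1, h2⟩ := h
    have hb := hFb x.length k
    exact ⟨h1.mono hb fun _ h => h, fun hx => (h2 hx).trans (Prog.prob_mono h1 hb _)⟩
  · intro n k b rows hr hH hb hb'
    set L := (joinRows rows).length with hL
    set N := 3 * n + k with hN
    refine ⟨C * T (N * N, N, 2 * L + 2, 2, k, 1), ?_, le_prob_of_learner hr hH hb ?_⟩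
    · rw [clock]
      refine Nat.add_le_add_right ((Nat.mul_le_mul_left C (hT _ _ _ _ _ _)).trans ?_) 1
      rw [← mul_assoc]
    · intro r₀ c₀ hlen hrep D hkap
      -- learn with error `1 / (2 * L + 2)`, less than `2⁻¹ ^ b`, and confidence `1 / 2`
      have hpos : (0 : ℚ) < 2 * L + 2 := by positivity
      obtain ⟨h1, h2⟩ := hA (N * N) (1 / (2 * L + 2)) (1 / 2) (by positivity)
        ((div_le_one hpos).2 (by have : (0 : ℚ) ≤ L := by positivity
                                 linarith)) (by norm_num) (by norm_num) r₀ c₀ hrep D k 1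
        (2 * L + 2) 2 hkap rfl (by
          rw [one_div_one_div]
          exact_mod_cast (Nat.ceil_natCast (R := ℚ) (2 * L + 2)).symm) (by norm_num)
      rw [hlen] at h1 h2
      refine ⟨h1.mono le_rfl fun s hs => hs.2, ?_⟩
      have hhalf : (2⁻¹ : ENNReal) ≤ 1 - ENNReal.ofReal ((1 / 2 : ℚ) : ℝ) := by
        have : ENNReal.ofReal ((1 / 2 : ℚ) : ℝ) = 2⁻¹ := by
          rw [show ((1 / 2 : ℚ) : ℝ) =
            (2 : ℝ)⁻¹ by norm_num, ENNReal.ofReal_inv_of_pos (by norm_num)]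
          norm_num
        rw [this, ENNReal.one_sub_inv_two]
      have hε : ENNReal.ofReal ((1 / (2 * L + 2) : ℚ) : ℝ) < (2⁻¹ : ENNReal) ^ b := by
        have e1 : ((1 / (2 * L + 2) : ℚ) : ℝ) =
          ((2 * L + 2 : ℕ) : ℝ)⁻¹ := by push_cast; rw [one_div]
        rw [e1, ENNReal.ofReal_inv_of_pos (by positivity), ENNReal.ofReal_natCast,
          ENNReal.inv_pow.symm,
          ENNReal.inv_lt_inv]
        exact_mod_cast (by omega : 2 ^ b < 2 * L + 2)
      refine (hhalf.trans h2).trans (MeasureTheory.measure_mono ?_)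
      rintro o ⟨s, rfl, hs, c, hc, herr⟩
      exact ⟨s, rfl, hs, c, hc, herr.trans_lt hε⟩

/-- Hitting Set is complete for `W2`, and `RandFPT` is closed under reductions. -/
theorem w2_subset_randFPT (h : learningFVS ∈ fptSamplePAC) : W2 ⊆ RandFPT := fun _ hL =>
  mem_randFPT_of_reduces hL (hittingSet_mem_randFPT h)

end ParamPAC

theorem mainTheorem6 :
    ParamPAC.ReducesInto ParamPAC.hittingSet (ParamPAC.consistency ParamPAC.learningFVS)
        ParamPAC.positiveSamples ∧
      (ParamPAC.learningFVS ∈ ParamPAC.fptSamplePAC → ParamPAC.W2 ⊆ ParamPAC.RandFPT) ∧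
      (ParamPAC.RandFPT ⊆ ParamPAC.FPT →
        ParamPAC.learningFVS ∈ ParamPAC.fptSamplePAC → ParamPAC.FPT = ParamPAC.W2) :=
  ⟨ParamPAC.reducesInto_consistency, ParamPAC.w2_subset_randFPT, fun h h' =>
    ParamPAC.fpt_subset_w2.antisymm ((ParamPAC.w2_subset_randFPT h').trans h)⟩
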